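/- **Setting.** Let $n$ be a positive integer and let $\mathfrak F=\bigoplus_{k\ge 0}(\mathbb C^n)^{\otimes k}$ be the full Fock space, with orthonormal basis $(e_w)$ indexed by the words $w$ in the letters $1,\dots,n$. Let $L_i\xi=e_i\otimes\xi$ and $R_i\xi=\xi\otimes e_i$ be the left and right creation operators, $\mathfrak l_n$ the norm-closed unital algebra generated by $L_1,\dots,L_n$, and $L[\zeta]=\sum_i\zeta_iL_i$ for $\zeta\in\mathbb C^n$. Let $X=\begin{pmatrix}x&y\\ z^t&X_{22}\end{pmatrix}\in U(1,n)$, i.e. $X^*JX=J$ with $J=\operatorname{diag}(-1,I_n)$. There is a unique unitary $U_X$ on $\mathfrak F$ such that $\Phi_X(A):=U_XAU_X^*$ satisfies $\Phi_X(L[\zeta])=(xI-L[z])^{-1}\bigl(L[X_{22}\zeta]-(\zeta\cdot y^t)I\bigr)$ for all $\zeta\in\mathbb C^n$ and $U_Xe_\emptyset=(xI-L[z])^{-1}e_\emptyset$; moreover $\Phi_X(\mathfrak l_n)=\mathfrak l_n$. Let $\phi_X(\lambda)=(x-\lambda z^t)^{-1}(\lambda X_{22}-y)$ be the associated automorphism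 of the open unit ball of $\mathbb C^n$ (whose points are written as rows). Let $H$ be a complex Hilbert space and $T=(T_1,\dots,T_n)$ a row contraction on $H$: $T_i\in\mathcal L(H)$ and $\sum_iT_iT_i^*\le I$; $T$ is also regarded as a contraction $H^n\to H$. For a word $w=i_1\cdots i_k$ put $T_w=T_{i_1}\cdots T_{i_k}$. For $f\in\mathfrak l_n$, $f(T)$ is defined by the contractive functional calculus, the unique continuous unital homomorphism $\mathfrak l_n\to\mathcal L(H)$ with $L_i\mapsto T_i$. For a contraction $A$ put $D_A=(I-A^*A)^{1/2}$ and $\mathcal D_A=\overline{\operatorname{ran}D_A}$. The Poisson kernel $K_T:H\to\mathfrak F\otimes\mathcal D_{T^*}$ and the characteristic function $\Theta_T:\mathfrak F\otimes\mathcal D_T\to\mathfrak F\otimes\mathcal D_{T^*}$ are the contractions $$K_Th=\sum_w e_w\otimes D_{T^*}T_w^*h,$$ $$\Theta_T=-I\otimes T+(I\otimes D_{T^*})\Bigl(I-\sum_iR_i\otimes T_i^*\Bigr)^{-1}[R_1\otimes I,\dots,R_n\otimes I](I\otimes D_T),$$ the latter being understood as a formal Fourier series in the $R_i$. Let $\mathfrak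 j\subset\mathfrak l_n$ be a norm-closed two-sided ideal. $T$ is called *$\mathfrak j$-constrained* if $f(T)=0$ for all $f\in\mathfrak j$. Let $\mathfrak J$ be the WOT-closure of $\mathfrak j$ in $\mathcal L(\mathfrak F)$. For a set $\mathfrak A\subset\mathcal L(\mathfrak F)$ let $\mathcal N_{\mathfrak A}=\mathfrak F\ominus\mathcal M_{\mathfrak A}$, where $\mathcal M_{\mathfrak A}$ is the closed linear span of $\{A\xi: A\in\mathfrak A,\ \xi\in\mathfrak F\}$. The constrained Poisson kernel and the constrained characteristic function are $$K_{\mathfrak A,T}=P_{\mathcal N_{\mathfrak A}\otimes\mathcal D_{T^*}}K_T:\ H\to\mathcal N_{\mathfrak A}\otimes\mathcal D_{T^*},\qquad \Theta_{\mathfrak A,T}=P_{\mathcal N_{\mathfrak A}\otimes\mathcal D_{T^*}}\Theta_T|_{\mathcal N_{\mathfrak A}\otimes\mathcal D_T}.$$ **Theorem.** Let $T$ be a row contraction on $H$ and $X\in U(1,n)$. Then the tuple $T'=\Phi_X^{-1}(T)$, defined by $T'_i=\bigl(\Phi_X^{-1}(L_i)\bigr)(T)$, is a row contraction, and the following hold.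 1. There are unitary operators $Z:\mathcal D_{T'}\to\mathcal D_T$ and $Z_*:\mathcal D_{T'^*}\to\mathcal D_{T^*}$ such that $$(\ast)\qquad \Theta_{T'}=(U_X\otimes Z_*^*)\,\Theta_T\,(U_X^*\otimes Z),\qquad K_{T'}=(U_X\otimes Z_*^*)\,K_T .$$ 2. Let $Z,Z_*$ be any unitary operators with $(\ast)$, and let $\mathfrak j\subset\mathfrak l_n$ be a norm-closed two-sided ideal such that $T$ is $\mathfrak j$-constrained. Put $\mathfrak j'=\Phi_X(\mathfrak j)$ and $\mathfrak J'=\Phi_X(\mathfrak J)$. Then $\mathfrak j'$ is a norm-closed two-sided ideal of $\mathfrak l_n$, $T'$ is $\mathfrak j'$-constrained, $\mathfrak J'$ is the WOT-closure of $\mathfrak j'$, $U_X$ maps $\mathcal N_{\mathfrak J}$ into $\mathcal N_{\mathfrak J'}$ and $U_X^*$ maps $\mathcal N_{\mathfrak J'}$ into $\mathcal N_{\mathfrak J}$, and, with the corresponding restrictions of $U_X\otimes Z_*^*$ and $U_X^*\otimes Z$, $$\Theta_{\mathfrak J',T'}=(U_X\otimes Z_*^*)\,\Theta_{\mathfrak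 J,T}\,(U_X^*\otimes Z),\qquad K_{\mathfrak J',T'}=(U_X\otimes Z_*^*)\,K_{\mathfrak J,T}.$$ 3. Let $\mathfrak c$ be the commutator ideal of $\mathfrak l_n$ (the smallest norm-closed two-sided ideal containing all commutators) and $\mathfrak C$ its WOT-closure. Then $T$ is $\mathfrak c$-constrained if and only if $T_iT_k=T_kT_i$ for all $i,k$; $\Phi_X(\mathfrak c)=\mathfrak c$ and $\Phi_X(\mathfrak C)=\mathfrak C$; and $U_X$ and $U_X^*$ leave $\mathcal N_{\mathfrak C}$ invariant. If $T$ is commuting, then $T'$ is commuting, and for all unitary operators $Z,Z_*$ with $(\ast)$, $$\Theta_{\mathfrak C,T'}=(U_X\otimes Z_*^*)\,\Theta_{\mathfrak C,T}\,(U_X^*\otimes Z),\qquad K_{\mathfrak C,T'}=(U_X\otimes Z_*^*)\,K_{\mathfrak C,T},$$ and the commutative characteristic function $$\theta_T(\lambda)=-T+D_{T^*}\Bigl(I-\sum_i\lambda_iT_i^*\Bigr)^{-1}[\lambda_1I,\dots,\lambda_nI]\,D_T:\ \mathcal D_T\to\mathcal D_{T^*}$$ satisfies $\theta_{T'}(\lambda)=Z_*^*\,\theta_T(\phi_X(\lambda))\,Z$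 for all $\lambda\in\mathbb C^n$ with $\sum_i|\lambda_i|^2<1$. -/

import Mathlib

namespace NCFock

open scoped InnerProductSpace ENNReal

noncomputable section

set_option linter.unusedSectionVars false

/-- The Hilbert tensor product `F ⊗ E` of the full Fock space `F` on `n` generators with a Hilbert
space `E`, in the model `ℓ²(words; E)`: a vector `f` stands for `∑_w e_w ⊗ f w`. Words in the
letters `1, …, n` are lists. Simple tensors are given by `tmul`, they span a dense subspace
(`span_tmul_dense`), and `tensorOp A B` acts on them by `ξ ⊗ k ↦ A ξ ⊗ B k` (`tensorOp_tmul`). -/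
abbrev FockTensor (n : ℕ) (E : Type*) [NormedAddCommGroup E] : Type _ :=
  lp (fun _ : List (Fin n) => E) 2

/-- The full Fock space on `n` generators, with orthonormal basis `e_w`. -/
abbrev Fock (n : ℕ) : Type := FockTensor n ℂ

section Build

variable {n : ℕ} {V E E' : Type*} [NormedAddCommGroup V] [NormedSpace ℂ V]
  [NormedAddCommGroup E] [InnerProductSpace ℂ E] [NormedAddCommGroup E'] [InnerProductSpace ℂ E']

theorem norm_sq_eq_tsum (f : FockTensor n E) : ‖f‖ ^ 2 = ∑' w, ‖f w‖ ^ 2 := by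
  have := lp.norm_rpow_eq_tsum (p := 2) (by norm_num) f
  simpa using this

theorem summable_norm_sq (f : FockTensor n E) : Summable fun w => ‖f w‖ ^ 2 := by
  have := (lp.memℓp f).summable (by norm_num)
  simpa using this

theorem sum_norm_sq_le (f : FockTensor n E) (s : Finset (List (Fin n))) :
    ∑ w ∈ s, ‖f w‖ ^ 2 ≤ ‖f‖ ^ 2 := by
  rw [norm_sq_eq_tsum]
  exact (summable_norm_sq f).sum_le_tsum s (fun _ _ => by positivity)

/-- A linear map given by coordinates, with a bound on its finite sections, as a bounded operator. -/
def ofCoords (φ : V →ₗ[ℂ] (List (Fin n) → E)) (C : ℝ)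
    (h : ∀ v (s : Finset (List (Fin n))), ∑ w ∈ s, ‖φ v w‖ ^ 2 ≤ (C * ‖v‖) ^ 2) :
    V →L[ℂ] FockTensor n E :=
  LinearMap.mkContinuous
    { toFun := fun v => ⟨φ v, memℓp_gen' (C := (C * ‖v‖) ^ 2) (fun s => by simpa using h v s)⟩
      map_add' := fun x y => by ext w; simp [map_add]; rfl
      map_smul' := fun c x => by ext w; simp } |C| (fun v => by
        refine lp.norm_le_of_forall_sum_le (by norm_num) (by positivity) (fun s => ?_)
        have := h v s
        rw [← sq_abs, abs_mul, abs_norm] at this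
        simpa using this)

@[simp] theorem ofCoords_apply (φ : V →ₗ[ℂ] (List (Fin n) → E)) (C : ℝ)
    (h : ∀ v (s : Finset (List (Fin n))), ∑ w ∈ s, ‖φ v w‖ ^ 2 ≤ (C * ‖v‖) ^ 2) (v : V)
    (w : List (Fin n)) : ofCoords φ C h v w = φ v w := rfl

theorem ofCoords_norm_le (φ : V →ₗ[ℂ] (List (Fin n) → E)) (C : ℝ)
    (h : ∀ v (s : Finset (List (Fin n))), ∑ w ∈ s, ‖φ v w‖ ^ 2 ≤ (C * ‖v‖) ^ 2) :
    ‖ofCoords φ C h‖ ≤ |C| :=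
  LinearMap.mkContinuous_norm_le _ (abs_nonneg C) _

/-- The basis vector `e_w`. -/
def e (w : List (Fin n)) : Fock n := lp.single 2 w 1

/-- Apply a bounded operator in every coordinate: `I ⊗ B`. -/
def ampRight (B : E →L[ℂ] E') : FockTensor n E →L[ℂ] FockTensor n E' :=
  ofCoords
    { toFun := fun f w => B (f w)
      map_add' := fun x y => by ext w; simp
      map_smul' := fun c x => by ext w; simp } ‖B‖ (fun f s => by
        calc ∑ w ∈ s, ‖B (f w)‖ ^ 2 ≤ ∑ w ∈ s, ‖B‖ ^ 2 * ‖f w‖ ^ 2 := by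
              refine Finset.sum_le_sum (fun w _ => ?_)
              rw [← mul_pow]
              exact pow_le_pow_left₀ (norm_nonneg _) (B.le_opNorm _) 2
          _ ≤ (‖B‖ * ‖f‖) ^ 2 := by
              rw [← Finset.mul_sum, mul_pow]
              exact mul_le_mul_of_nonneg_left (sum_norm_sq_le f s) (by positivity))

@[simp] theorem ampRight_apply (B : E →L[ℂ] E') (f : FockTensor n E) (w : List (Fin n)) :
    ampRight B f w = B (f w) := rfl

/-- The simple tensor `ξ ⊗ k`. -/
def tmul (ξ : Fock n) (k : E) : FockTensor n E :=
  ampRight (ContinuousLinearMap.toSpanSingleton ℂ k) ξ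

@[simp] theorem tmul_apply (ξ : Fock n) (k : E) (w : List (Fin n)) : tmul ξ k w = ξ w • k := by
  simp [tmul]

/-- the slice of `f` against `k`, i.e. `w ↦ ⟪k, f w⟫`. -/
def slice (k : E) : FockTensor n E →L[ℂ] Fock n := ampRight (innerSL ℂ k)

@[simp] theorem slice_apply (k : E) (f : FockTensor n E) (w : List (Fin n)) :
    slice k f w = ⟪k, f w⟫_ℂ := by simp [slice]

theorem enorm_sq_eq_tsum (f : FockTensor n E) : ‖f‖ₑ ^ 2 = ∑' w, ‖f w‖ₑ ^ 2 := by
  have h := norm_sq_eq_tsum f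
  have h2 := summable_norm_sq f
  have : ‖f‖ₑ ^ 2 = ENNReal.ofReal (‖f‖ ^ 2) := by
    rw [ENNReal.ofReal_pow (norm_nonneg _), ofReal_norm]
  rw [this, h, ENNReal.ofReal_tsum_of_nonneg (fun _ => by positivity) h2]
  exact tsum_congr (fun w => by rw [ENNReal.ofReal_pow (norm_nonneg _), ofReal_norm])

theorem enorm_sq_eq_tsum_inner {ι : Type*} (b : HilbertBasis ι ℂ E) (x : E) :
    ‖x‖ₑ ^ 2 = ∑' i, ‖⟪b i, x⟫_ℂ‖ₑ ^ 2 := by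
  have h0 : ‖x‖ = ‖b.repr x‖ := (b.repr.norm_map x).symm
  have h := lp.norm_rpow_eq_tsum (p := 2) (by norm_num) (b.repr x)
  have h2 := (lp.memℓp (b.repr x)).summable (by norm_num)
  simp only [ENNReal.toReal_ofNat, Real.rpow_ofNat, b.repr_apply_apply] at h h2
  have : ‖x‖ₑ ^ 2 = ENNReal.ofReal (‖x‖ ^ 2) := by
    rw [ENNReal.ofReal_pow (norm_nonneg _), ofReal_norm]
  rw [this, h0, h, ENNReal.ofReal_tsum_of_nonneg (fun _ => by positivity) h2]
  exact tsum_congr (fun w => by rw [ENNReal.ofReal_pow (norm_nonneg _), ofReal_norm])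

end Build

section Amp

variable {n : ℕ} {E E' : Type*}
  [NormedAddCommGroup E] [InnerProductSpace ℂ E] [CompleteSpace E]
  [NormedAddCommGroup E'] [InnerProductSpace ℂ E']

theorem e_apply (w v : List (Fin n)) : e w v = if v = w then 1 else 0 := by
  by_cases h : v = w
  · subst h; simp [e]
  · simp [e, h]

theorem inner_e_left (w : List (Fin n)) (ξ : Fock n) : ⟪e w, ξ⟫_ℂ = ξ w := by
  rw [e, lp.inner_single_left]; simp

theorem hasSum_e (ξ : Fock n) : HasSum (fun w => ξ w • e w) ξ := by
  have h := lp.hasSum_single (E := fun _ : List (Fin n) => ℂ) (p := 2) (by norm_num) ξ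
  refine h.congr_fun (fun w => ?_) 
  rw [e, ← lp.single_smul]; simp

theorem entry_eq (A : Fock n →L[ℂ] Fock n) (v w : List (Fin n)) :
    A (e w) v = starRingEnd ℂ ((ContinuousLinearMap.adjoint A (e v)) w) := by
  rw [← inner_e_left, ← inner_e_left, inner_conj_symm, ContinuousLinearMap.adjoint_inner_left]

theorem summable_amp (A : Fock n →L[ℂ] Fock n) (f : FockTensor n E) (v : List (Fin n)) :
    Summable fun w => A (e w) v • f w := by
  refine Summable.of_norm ?_
  have h := ((summable_norm_sq (ContinuousLinearMap.adjoint A (e v))).add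
    (summable_norm_sq f))
  refine Summable.of_nonneg_of_le (fun _ => norm_nonneg _) (fun w => ?_) h
  rw [norm_smul, entry_eq A, RCLike.norm_conj]
  nlinarith [sq_nonneg (‖(ContinuousLinearMap.adjoint A (e v)) w‖ - ‖f w‖),
    sq_nonneg (‖(ContinuousLinearMap.adjoint A (e v)) w‖ + ‖f w‖)]

/-- The coordinates of `(A ⊗ I) f`: `((A ⊗ I) f)_v = ∑_w ⟨A e_w, e_v⟩ f_w`. -/
def ampCoords (A : Fock n →L[ℂ] Fock n) : FockTensor n E →ₗ[ℂ] (List (Fin n) → E) where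
  toFun f v := ∑' w, A (e w) v • f w
  map_add' f g := by
    ext v
    simp only [lp.coeFn_add, Pi.add_apply, smul_add]
    exact (summable_amp A f v).tsum_add (summable_amp A g v)
  map_smul' c f := by
    ext v
    simp only [lp.coeFn_smul, Pi.smul_apply, RingHom.id_apply, smul_comm _ c]
    exact (summable_amp A f v).tsum_const_smul c

theorem inner_ampCoords (A : Fock n →L[ℂ] Fock n) (f : FockTensor n E) (k : E)
    (v : List (Fin n)) : ⟪k, ampCoords A f v⟫_ℂ = A (slice k f) v := by
  have h1 := ((summable_amp A f v).hasSum.mapL (innerSL ℂ k)).tsum_eq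
  have h2 := (((hasSum_e (slice k f)).mapL A).mapL (lp.evalCLM ℂ (fun _ : List (Fin n) => ℂ) 2 v)).tsum_eq
  simp only [innerSL_apply_apply] at h1
  change _ = A (slice k f) v at h2
  rw [← h2]
  change ⟪k, ∑' w, A (e w) v • f w⟫_ℂ = _
  rw [← h1]
  refine tsum_congr (fun w => ?_)
  rw [map_smul, map_smul, inner_smul_right, slice_apply, smul_eq_mul, mul_comm]
  rfl

theorem ampCoords_bound (A : Fock n →L[ℂ] Fock n) (f : FockTensor n E)
    (s : Finset (List (Fin n))) :
    ∑ v ∈ s, ‖ampCoords A f v‖ ^ 2 ≤ (‖A‖ * ‖f‖) ^ 2 := by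
  obtain ⟨ι, b, -⟩ := exists_hilbertBasis ℂ E
  have key : ∑ v ∈ s, ‖ampCoords A f v‖ₑ ^ 2 ≤ (‖A‖ₑ * ‖f‖ₑ) ^ 2 := by
    calc ∑ v ∈ s, ‖ampCoords A f v‖ₑ ^ 2
        = ∑ v ∈ s, ∑' i, ‖A (slice (b i) f) v‖ₑ ^ 2 := by
          refine Finset.sum_congr rfl (fun v _ => ?_)
          rw [enorm_sq_eq_tsum_inner b]
          simp [inner_ampCoords]
      _ ≤ ∑' v, ∑' i, ‖A (slice (b i) f) v‖ₑ ^ 2 := ENNReal.sum_le_tsum s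
      _ = ∑' i, ‖A (slice (b i) f)‖ₑ ^ 2 := by
          rw [ENNReal.tsum_comm]; simp [enorm_sq_eq_tsum]
      _ ≤ ∑' i, ‖A‖ₑ ^ 2 * ‖slice (b i) f‖ₑ ^ 2 := by
          refine ENNReal.tsum_le_tsum (fun i => ?_)
          rw [← mul_pow]
          exact pow_le_pow_left₀ (zero_le) (A.le_opENorm _) 2
      _ = (‖A‖ₑ * ‖f‖ₑ) ^ 2 := by
          rw [ENNReal.tsum_mul_left, mul_pow, enorm_sq_eq_tsum f]
          congr 1
          simp_rw [enorm_sq_eq_tsum, enorm_sq_eq_tsum_inner b (f _), slice_apply]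
          rw [ENNReal.tsum_comm]
  have h3 : ENNReal.ofReal (∑ v ∈ s, ‖ampCoords A f v‖ ^ 2) ≤
      ENNReal.ofReal ((‖A‖ * ‖f‖) ^ 2) := by
    rw [ENNReal.ofReal_sum_of_nonneg (fun _ _ => by positivity)]
    rw [ENNReal.ofReal_pow (by positivity), ENNReal.ofReal_mul (by positivity)]
    simpa [ENNReal.ofReal_pow, ofReal_norm] using key
  exact (ENNReal.ofReal_le_ofReal_iff (by positivity)).1 h3

/-- `A ⊗ I_E`. -/
def ampLeft (A : Fock n →L[ℂ] Fock n) : FockTensor n E →L[ℂ] FockTensor n E :=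
  ofCoords (ampCoords A) ‖A‖ (ampCoords_bound A)

theorem ampLeft_apply (A : Fock n →L[ℂ] Fock n) (f : FockTensor n E) (v : List (Fin n)) :
    ampLeft A f v = ∑' w, A (e w) v • f w := rfl

theorem norm_ampLeft_le (A : Fock n →L[ℂ] Fock n) :
    ‖(ampLeft A : FockTensor n E →L[ℂ] FockTensor n E)‖ ≤ ‖A‖ :=
  (ofCoords_norm_le (E := E) (ampCoords A) ‖A‖ (ampCoords_bound A)).trans (abs_norm _).le

theorem inner_ampLeft (A : Fock n →L[ℂ] Fock n) (f : FockTensor n E) (k : E)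
    (v : List (Fin n)) : ⟪k, ampLeft A f v⟫_ℂ = A (slice k f) v := inner_ampCoords A f k v

theorem slice_ampLeft (A : Fock n →L[ℂ] Fock n) (f : FockTensor n E) (k : E) :
    slice k (ampLeft A f) = A (slice k f) := by
  ext v; simp [inner_ampLeft]

theorem ext_slice {f g : FockTensor n E} (h : ∀ k, slice k f = slice k g) : f = g := by
  ext v
  refine ext_inner_left ℂ (fun k => ?_)
  rw [← slice_apply, ← slice_apply, h]

/-- The tensor product `A ⊗ B` of bounded operators. -/
def tensorOp (A : Fock n →L[ℂ] Fock n) (B : E →L[ℂ] E') : FockTensor n E →L[ℂ] FockTensor n E' :=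
  ampRight B ∘L ampLeft A

theorem tensorOp_tmul (A : Fock n →L[ℂ] Fock n) (B : E →L[ℂ] E') (ξ : Fock n) (k : E) :
    tensorOp A B (tmul ξ k) = tmul (A ξ) (B k) := by
  have : ampLeft A (tmul ξ k) = tmul (A ξ) k := by
    refine ext_slice (fun k' => ?_)
    rw [slice_ampLeft]
    have h (ξ : Fock n) : slice k' (tmul ξ k) = ⟪k', k⟫_ℂ • ξ := by
      ext v; simp [mul_comm]
    rw [h, h, map_smul]
  ext v
  simp [tensorOp, this]

/-- Simple tensors span a dense subspace. -/
theorem span_tmul_dense : (Submodule.span ℂ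
    {f : FockTensor n E | ∃ ξ k, f = tmul ξ k}).topologicalClosure = ⊤ := by
  rw [eq_top_iff]
  intro f _
  have h := lp.hasSum_single (E := fun _ : List (Fin n) => E) (p := 2) (by norm_num) f
  refine mem_closure_of_tendsto h (Filter.Eventually.of_forall (fun s => ?_))
  refine Submodule.sum_mem _ (fun w _ => Submodule.subset_span ⟨e w, f w, ?_⟩)
  ext v
  by_cases hv : v = w
  · subst hv; simp [e_apply]
  · simp [e_apply, hv]

end Amp

section Creation

variable {n : ℕ}

/-- The left creation operator `L_i ξ = e_i ⊗ ξ`. -/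
def creation (i : Fin n) : Fock n →L[ℂ] Fock n :=
  ofCoords
    { toFun := fun ξ w => if w.head? = some i then ξ w.tail else 0
      map_add' := fun ξ η => by ext w; by_cases h : w.head? = some i <;> simp [h]
      map_smul' := fun c ξ => by ext w; by_cases h : w.head? = some i <;> simp [h] } 1
    (fun ξ s => by
      have h1 : ∑ w ∈ s, ‖(if w.head? = some i then ξ w.tail else 0 : ℂ)‖ ^ 2 =
          ∑ w ∈ s.filter (fun w => w.head? = some i), ‖ξ w.tail‖ ^ 2 := by
        rw [Finset.sum_filter]
        exact Finset.sum_congr rfl (fun w _ => by by_cases h : w.head? = some i <;> simp [h])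
      change ∑ w ∈ s, ‖(if w.head? = some i then ξ w.tail else 0 : ℂ)‖ ^ 2 ≤ _
      rw [h1, one_mul]
      have h2 : Set.InjOn List.tail
          (s.filter (fun w => w.head? = some i) : Set (List (Fin n))) := by
        intro a ha b hb hab
        simp only [Finset.coe_filter, Set.mem_ofPred_eq] at ha hb
        cases a <;> cases b <;> simp_all
      rw [← Finset.sum_image (f := fun v => ‖ξ v‖ ^ 2) h2]
      exact sum_norm_sq_le ξ _)

@[simp] theorem creation_nil (i : Fin n) (ξ : Fock n) : creation i ξ [] = 0 := rfl

theorem creation_apply (i : Fin n) (ξ : Fock n) (w : List (Fin n)) :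
    creation i ξ w = if w.head? = some i then ξ w.tail else 0 := rfl

@[simp] theorem creation_cons (i j : Fin n) (ξ : Fock n) (w : List (Fin n)) :
    creation i ξ (j :: w) = if j = i then ξ w else 0 := by
  simp [creation_apply]

theorem creation_e (i : Fin n) (w : List (Fin n)) : creation i (e w) = e (i :: w) := by
  ext v
  cases v with
  | nil => simp [e_apply]
  | cons j v => by_cases h : j = i <;> simp [e_apply, h]

theorem ext_e {E : Type*} [NormedAddCommGroup E] [NormedSpace ℂ E] {A B : Fock n →L[ℂ] E}
    (h : ∀ w, A (e w) = B (e w)) : A = B := by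
  ext ξ
  have hA := (hasSum_e ξ).mapL A
  have hB := (hasSum_e ξ).mapL B
  simp only [map_smul, h] at hA hB
  exact hA.unique hB

theorem inner_creation (i k : Fin n) (ξ η : Fock n) :
    ⟪creation i ξ, creation k η⟫_ℂ = if i = k then ⟪ξ, η⟫_ℂ else 0 := by
  have h0 : innerSL ℂ (creation i ξ) ∘L creation k =
      if i = k then innerSL ℂ ξ else 0 := by
    refine ext_e (fun w => ?_)
    have : ⟪creation i ξ, e (k :: w)⟫_ℂ = if i = k then ⟪ξ, e w⟫_ℂ else 0 := by
      rw [← inner_conj_symm, inner_e_left, ← inner_conj_symm ξ, inner_e_left, creation_cons]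
      by_cases h : i = k
      · simp [h]
      · simp [h, Ne.symm h]
    rw [ContinuousLinearMap.comp_apply, innerSL_apply_apply, creation_e, this]
    split_ifs <;> simp
  have := congrArg (fun f => f η) h0
  simp only [ContinuousLinearMap.comp_apply, innerSL_apply_apply] at this
  rw [this]
  split_ifs <;> simp

theorem inner_e_nil_creation (i : Fin n) (ξ : Fock n) : ⟪e [], creation i ξ⟫_ℂ = 0 := by
  rw [inner_e_left]; rfl

/-- The norm-closed unital algebra generated by the left creation operators. -/
def discAlgebra (n : ℕ) : Subalgebra ℂ (Fock n →L[ℂ] Fock n) :=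
  (Algebra.adjoin ℂ (Set.range (creation (n := n)))).topologicalClosure

theorem creation_mem (i : Fin n) : creation i ∈ discAlgebra n :=
  Subalgebra.le_topologicalClosure _ (Algebra.subset_adjoin ⟨i, rfl⟩)

end Creation

section General

theorem inverse_mem {A : Type*} [NormedRing A] [NormedAlgebra ℂ A] [CompleteSpace A]
    (S : Subalgebra ℂ A) (hS : IsClosed (S : Set A)) {c : ℂ} {a : A} (ha : a ∈ S)
    (h : ‖a‖ < ‖c‖) : IsUnit (algebraMap ℂ A c - a) ∧
      Ring.inverse (algebraMap ℂ A c - a) ∈ S := by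
  have hc : c ≠ 0 := by rintro rfl; simp at h; linarith [norm_nonneg a]
  have h1 : ‖c⁻¹ • a‖ < 1 := by
    rw [norm_smul, norm_inv, inv_mul_lt_one₀ (by positivity)]; exact h
  have hs : Summable fun k => (c⁻¹ • a) ^ k := summable_geometric_of_norm_lt_one h1
  set b := ∑' k, (c⁻¹ • a) ^ k with hb
  have hbS : b ∈ S := hS.mem_of_tendsto hs.hasSum
    (Filter.Eventually.of_forall (fun t => S.sum_mem (fun k _ => S.pow_mem (S.smul_mem ha _) _)))
  have h2 : b * (1 - c⁻¹ • a) = 1 := geom_series_mul_neg _ h1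
  have h3 : (1 - c⁻¹ • a) * b = 1 := mul_neg_geom_series _ h1
  have h4 : algebraMap ℂ A c - a = c • (1 - c⁻¹ • a) := by
    rw [smul_sub, smul_inv_smul₀ hc, Algebra.algebraMap_eq_smul_one]
  let u : Aˣ := ⟨algebraMap ℂ A c - a, c⁻¹ • b, by rw [h4]; simp [h3, hc], by
    rw [h4]; simp [h2, hc]⟩
  refine ⟨u.isUnit, ?_⟩
  rw [show algebraMap ℂ A c - a = u from rfl, Ring.inverse_unit]
  exact S.smul_mem hbS _

variable {n : ℕ} {F : Type*} [NormedAddCommGroup F] [InnerProductSpace ℂ F]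

theorem norm_comb_le (W : Fin n → (F →L[ℂ] F))
    (hW : ∀ i k ξ η, ⟪W i ξ, W k η⟫_ℂ = if i = k then ⟪ξ, η⟫_ℂ else 0) (a : Fin n → ℂ) :
    ‖∑ i, a i • W i‖ ≤ √(∑ i, ‖a i‖ ^ 2) := by
  refine ContinuousLinearMap.opNorm_le_bound _ (by positivity) (fun ξ => ?_)
  refine abs_le_of_sq_le_sq' ?_ (by positivity) |>.2
  rw [mul_pow, Real.sq_sqrt (by positivity)]
  have hn : ∀ v : F, ((‖v‖ ^ 2 : ℝ) : ℂ) = ⟪v, v⟫_ℂ := fun v => by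
    rw [inner_self_eq_norm_sq_to_K]; simp
  have h1 : ((‖(∑ i, a i • W i) ξ‖ ^ 2 : ℝ) : ℂ) = ((∑ i, ‖a i‖ ^ 2) * ‖ξ‖ ^ 2 : ℝ) := by
    rw [hn, Complex.ofReal_mul, hn, _root_.sum_apply, sum_inner, Complex.ofReal_sum,
      Finset.sum_mul]
    refine Finset.sum_congr rfl (fun i _ => ?_)
    rw [inner_sum, Finset.sum_eq_single i]
    · rw [_root_.smul_apply, inner_smul_left, inner_smul_right, hW, if_pos rfl,
        ← mul_assoc, Complex.conj_mul', Complex.ofReal_pow]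
    · intro k _ hk
      rw [_root_.smul_apply, _root_.smul_apply, inner_smul_left,
        inner_smul_right, hW, if_neg (Ne.symm hk), mul_zero, mul_zero]
    · intro h; exact absurd (Finset.mem_univ i) h
  exact le_of_eq (Complex.ofReal_injective h1)

end General

section Automorphisms

variable {n : ℕ}

/-- The signature matrix `J = diag(-1, I_n)`. -/
def signature (n : ℕ) : Matrix (Unit ⊕ Fin n) (Unit ⊕ Fin n) ℂ := Matrix.fromBlocks (-1) 0 0 1

/-- The group `U(1,n)` of matrices `X` with `X^* J X = J`. -/
structure PseudoUnitary (n : ℕ) where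
  mat : Matrix (Unit ⊕ Fin n) (Unit ⊕ Fin n) ℂ
  rel : mat.conjTranspose * signature n * mat = signature n

namespace PseudoUnitary

variable (X : PseudoUnitary n)

/-- The blocks of `X`: scalar entry `x`, first row `y`, first column `z`, lower right block. -/
def x : ℂ := X.mat (.inl ()) (.inl ())

/-- the first row of `X` off the corner -/
def y (i : Fin n) : ℂ := X.mat (.inl ()) (.inr i)

/-- the first column of `X` off the corner -/
def z (i : Fin n) : ℂ := X.mat (.inr i) (.inl ())

/-- the lower right block of `X` -/
def blk : Matrix (Fin n) (Fin n) ℂ := X.mat.toBlocks₂₂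

theorem mul_conj : X.mat * signature n * X.mat.conjTranspose = signature n := by
  have hJ : signature n * signature n = 1 := by
    simp [signature, Matrix.fromBlocks_multiply]
  have h1 : (signature n * X.mat.conjTranspose * signature n) * X.mat = 1 := by
    rw [Matrix.mul_assoc, Matrix.mul_assoc, ← Matrix.mul_assoc X.mat.conjTranspose, X.rel, hJ]
  have h2 := mul_eq_one_comm.1 h1
  calc X.mat * signature n * X.mat.conjTranspose
      = (X.mat * (signature n * X.mat.conjTranspose * signature n)) * signature n := by
        simp only [Matrix.mul_assoc, hJ, Matrix.mul_one]
    _ = signature n := by rw [h2, Matrix.one_mul]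

theorem col_rel (p q : Unit ⊕ Fin n) :
    - (star (X.mat (.inl ()) p) * X.mat (.inl ()) q) + ∑ j, star (X.mat (.inr j) p) * X.mat (.inr j) q =
      signature n p q := by
  have := congrFun (congrFun X.rel p) q
  rw [← this]
  simp [Matrix.mul_apply, signature, Fintype.sum_sum_type, Matrix.one_apply]

theorem row_rel (p q : Unit ⊕ Fin n) :
    - (X.mat p (.inl ()) * star (X.mat q (.inl ()))) + ∑ j, X.mat p (.inr j) * star (X.mat q (.inr j)) =
      signature n p q := by
  have := congrFun (congrFun X.mul_conj p) q
  rw [← this]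
  simp [Matrix.mul_apply, signature, Fintype.sum_sum_type, Matrix.one_apply]

theorem norm_z_lt : √(∑ i, ‖X.z i‖ ^ 2) < ‖X.x‖ := by
  have h := X.col_rel (.inl ()) (.inl ())
  simp only [signature, Matrix.fromBlocks_apply₁₁] at h
  have h2 : ((-(‖X.x‖ ^ 2) + ∑ j, ‖X.z j‖ ^ 2 : ℝ) : ℂ) = (-1 : ℝ) := by
    push_cast
    simp only [← Complex.conj_mul']
    simpa [x, z] using h
  have h3 : -(‖X.x‖ ^ 2) + ∑ j, ‖X.z j‖ ^ 2 = -1 := by exact_mod_cast h2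
  rw [Real.sqrt_lt' ?_]
  · linarith
  · by_contra h0
    have : ‖X.x‖ = 0 := le_antisymm (not_lt.1 h0) (norm_nonneg _)
    rw [this] at h3
    have : 0 ≤ ∑ j, ‖X.z j‖ ^ 2 := by positivity
    nlinarith

theorem norm_y_lt : √(∑ i, ‖X.y i‖ ^ 2) < ‖X.x‖ := by
  have h := X.row_rel (.inl ()) (.inl ())
  simp only [signature, Matrix.fromBlocks_apply₁₁] at h
  have h2 : ((-(‖X.x‖ ^ 2) + ∑ j, ‖X.y j‖ ^ 2 : ℝ) : ℂ) = (-1 : ℝ) := by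
    push_cast
    simp only [← Complex.mul_conj']
    simpa [x, y] using h
  have h3 : -(‖X.x‖ ^ 2) + ∑ j, ‖X.y j‖ ^ 2 = -1 := by exact_mod_cast h2
  rw [Real.sqrt_lt' ?_]
  · linarith
  · by_contra h0
    have : ‖X.x‖ = 0 := le_antisymm (not_lt.1 h0) (norm_nonneg _)
    rw [this] at h3
    have : 0 ≤ ∑ j, ‖X.y j‖ ^ 2 := by positivity
    nlinarith

end PseudoUnitary

/-- `L[ζ] = ∑ ζ_i L_i`. -/
def linComb (ζ : Fin n → ℂ) : Fock n →L[ℂ] Fock n := ∑ i, ζ i • creation i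

theorem linComb_mem (ζ : Fin n → ℂ) : linComb ζ ∈ discAlgebra n :=
  Subalgebra.sum_mem _ (fun i _ => Subalgebra.smul_mem _ (creation_mem i) _)

theorem norm_linComb_le (ζ : Fin n → ℂ) : ‖linComb ζ‖ ≤ √(∑ i, ‖ζ i‖ ^ 2) :=
  norm_comb_le _ inner_creation ζ

variable (X : PseudoUnitary n)

/-- `x I - L[z]`. -/
def denom : Fock n →L[ℂ] Fock n := algebraMap ℂ _ X.x - linComb X.z

/-- `(x I - L[z])⁻¹ (L[X₂₂ ζ] - (ζ · y) I)`, the image of `L[ζ]` under `Φ_X`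
(see `conjAut_linComb`); here `X₂₂` is the lower right block of `X`. -/
def genImage (ζ : Fin n → ℂ) : Fock n →L[ℂ] Fock n :=
  Ring.inverse (denom X) * (linComb (X.blk.mulVec ζ) - algebraMap ℂ _ (ζ ⬝ᵥ X.y))

theorem denom_spec : IsUnit (denom X) ∧ Ring.inverse (denom X) ∈ discAlgebra n :=
  inverse_mem _ (Subalgebra.isClosed_topologicalClosure _) (linComb_mem _)
    ((norm_linComb_le _).trans_lt X.norm_z_lt)

theorem genImage_mem (ζ : Fin n → ℂ) : genImage X ζ ∈ discAlgebra n :=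
  Subalgebra.mul_mem _ (denom_spec X).2
    (Subalgebra.sub_mem _ (linComb_mem _) (Subalgebra.algebraMap_mem _ _))

theorem denom_mul_inverse : denom X * Ring.inverse (denom X) = 1 :=
  Ring.mul_inverse_cancel _ (denom_spec X).1

/-- the image of `L_i` -/
def gen (i : Fin n) : Fock n →L[ℂ] Fock n := genImage X (Pi.single i 1)

theorem denom_mul_gen (i : Fin n) :
    denom X * gen X i = linComb (fun j => X.blk j i) - algebraMap ℂ _ (X.y i) := by
  rw [gen, genImage, ← mul_assoc, denom_mul_inverse, one_mul]
  congr 2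
  · ext j; simp
  · simp

/-- the image of the vacuum under the implementing unitary -/
def vac : Fock n := Ring.inverse (denom X) (e [])

theorem denom_vac : denom X (vac X) = e [] := by
  have := congrArg (fun A => A (e [])) (denom_mul_inverse X)
  simpa [vac] using this

theorem indef_inner (h h' : Unit ⊕ Fin n → Fock n) :
    - ⟪∑ q, X.mat (.inl ()) q • h q, ∑ q, X.mat (.inl ()) q • h' q⟫_ℂ
      + ∑ j, ⟪∑ q, X.mat (.inr j) q • h q, ∑ q, X.mat (.inr j) q • h' q⟫_ℂ
    = - ⟪h (.inl ()), h' (.inl ())⟫_ℂ + ∑ j, ⟪h (.inr j), h' (.inr j)⟫_ℂ := by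
  have h1 : ∀ p, ⟪∑ q, X.mat p q • h q, ∑ q, X.mat p q • h' q⟫_ℂ =
      ∑ q, ∑ q', star (X.mat p q) * X.mat p q' * ⟪h q, h' q'⟫_ℂ := by
    intro p
    rw [sum_inner]
    refine Finset.sum_congr rfl (fun q _ => ?_)
    rw [inner_sum]
    refine Finset.sum_congr rfl (fun q' _ => ?_)
    rw [inner_smul_left, inner_smul_right, starRingEnd_apply]; ring
  simp only [h1]
  rw [Finset.sum_comm (s := (Finset.univ : Finset (Fin n))), ← Finset.sum_neg_distrib, ← Finset.sum_add_distrib]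
  have h2 : ∀ q, -∑ q', star (X.mat (.inl ()) q) * X.mat (.inl ()) q' * ⟪h q, h' q'⟫_ℂ +
      ∑ j, ∑ q', star (X.mat (.inr j) q) * X.mat (.inr j) q' * ⟪h q, h' q'⟫_ℂ =
      ∑ q', signature n q q' * ⟪h q, h' q'⟫_ℂ := by
    intro q
    rw [Finset.sum_comm, ← Finset.sum_neg_distrib, ← Finset.sum_add_distrib]
    refine Finset.sum_congr rfl (fun q' _ => ?_)
    rw [← X.col_rel q q', add_mul, Finset.sum_mul]
    ring
  simp only [h2]
  simp [Fintype.sum_sum_type, signature, Matrix.one_apply]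

/-- Key identity: an isometry property obtained from `J`-unitarity. -/
theorem inner_key (c c' : ℂ) (η η' : Fin n → Fock n) :
    ⟪c • vac X + ∑ i, gen X i (η i), c' • vac X + ∑ i, gen X i (η' i)⟫_ℂ =
      star c * c' + ∑ i, ⟪η i, η' i⟫_ℂ := by
  have hA : ∀ (c : ℂ) (η : Fin n → Fock n),
      ∑ q, X.mat (.inl ()) q • (Sum.elim (fun _ => c • vac X + ∑ i, gen X i (η i)) η : _ → Fock n) q
      = c • e [] + ∑ j, creation j (∑ q, X.mat (.inr j) q •
        (Sum.elim (fun _ => c • vac X + ∑ i, gen X i (η i)) η : _ → Fock n) q) := by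
    intro c η
    set g := c • vac X + ∑ i, gen X i (η i) with hg
    have h1 : denom X g = c • e [] + ∑ i, (linComb (fun j => X.blk j i) (η i) - X.y i • η i) := by
      rw [hg, map_add, map_smul, denom_vac, map_sum]
      congr 1
      refine Finset.sum_congr rfl (fun i _ => ?_)
      have := congrArg (fun A => A (η i)) (denom_mul_gen X i)
      simpa [Algebra.algebraMap_eq_smul_one] using this
    have h2 : denom X g = X.x • g - linComb X.z g := by
      simp [denom, Algebra.algebraMap_eq_smul_one]
    rw [h2] at h1
    simp only [Fintype.sum_sum_type, Sum.elim_inl, Sum.elim_inr, Finset.univ_unique,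
      Finset.sum_singleton, map_add, map_sum, map_smul, Finset.sum_add_distrib]
    have h3 : X.x • g = linComb X.z g + (c • e [] +
        ∑ i, (linComb (fun j => X.blk j i) (η i) - X.y i • η i)) := by
      rw [← h1]; abel
    change X.x • g + ∑ i, X.y i • η i = _
    rw [h3, Finset.sum_sub_distrib]
    have h4 : linComb X.z g = ∑ j, X.mat (.inr j) (.inl ()) • creation j g := by
      simp [linComb, PseudoUnitary.z]
    have h5 : ∑ i, linComb (fun j => X.blk j i) (η i) =
        ∑ j, ∑ i, X.mat (.inr j) (.inr i) • creation j (η i) := by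
      rw [Finset.sum_comm]
      simp [linComb, PseudoUnitary.blk, Matrix.toBlocks₂₂]
    rw [h4, h5]
    change _ = c • e [] + (∑ j, X.mat (.inr j) (.inl ()) • creation j g + _)
    abel
  have hB := indef_inner X (Sum.elim (fun _ => c • vac X + ∑ i, gen X i (η i)) η)
    (Sum.elim (fun _ => c' • vac X + ∑ i, gen X i (η' i)) η')
  rw [hA c η, hA c' η'] at hB
  have hC : ∀ (q q' : Fin n → Fock n), ⟪c • e [] + ∑ j, creation j (q j),
      c' • e [] + ∑ j, creation j (q' j)⟫_ℂ = star c * c' + ∑ j, ⟪q j, q' j⟫_ℂ := by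
    intro q q'
    have h6 : ∀ (i : Fin n) (ξ : Fock n), ⟪creation i ξ, e []⟫_ℂ = 0 := fun i ξ => by
      rw [← inner_conj_symm, inner_e_nil_creation, map_zero]
    have h7 : ⟪(e [] : Fock n), e []⟫_ℂ = 1 := by rw [inner_e_left]; simp [e_apply]
    simp only [inner_add_left, inner_add_right, inner_smul_left, inner_smul_right, sum_inner,
      inner_sum, inner_creation, inner_e_nil_creation, h6, h7]
    simp [mul_comm]
  rw [hC] at hB
  simp only [Sum.elim_inl, Sum.elim_inr] at hB
  linear_combination hB

/-- The vectors `Φ_X(L_w) (x I - L[z])⁻¹ e_∅`. -/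
def basisImage : List (Fin n) → Fock n
  | [] => vac X
  | i :: w => gen X i (basisImage w)

theorem inner_vac_vac : ⟪vac X, vac X⟫_ℂ = 1 := by
  simpa using inner_key X 1 1 0 0

theorem inner_vac_gen (i : Fin n) (ξ : Fock n) : ⟪vac X, gen X i ξ⟫_ℂ = 0 := by
  have := inner_key X 1 0 0 (Pi.single i ξ)
  simp only [one_smul, Pi.zero_apply, map_zero, Finset.sum_const_zero, add_zero, zero_smul,
    zero_add, mul_zero, inner_zero_left] at this
  rw [← this, Finset.sum_eq_single i]
  · simp
  · intro b _ hb; simp [hb]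
  · simp

theorem inner_gen_gen (i k : Fin n) (ξ η : Fock n) :
    ⟪gen X i ξ, gen X k η⟫_ℂ = if i = k then ⟪ξ, η⟫_ℂ else 0 := by
  have := inner_key X 0 0 (Pi.single i ξ) (Pi.single k η)
  have h : ∀ (i : Fin n) (ξ : Fock n),
      ∑ j, gen X j ((Pi.single i ξ : Fin n → Fock n) j) = gen X i ξ := by
    intro i ξ
    rw [Finset.sum_eq_single i]
    · simp
    · intro b _ hb; simp [hb]
    · simp
  rw [h, h] at this
  simp only [zero_smul, zero_add, star_zero, mul_zero] at this
  rw [this, Finset.sum_eq_single k]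
  · by_cases hik : i = k
    · subst hik; simp
    · simp [hik, Ne.symm hik]
  · intro b _ hb; simp [hb]
  · simp

theorem orthonormal_basisImage : Orthonormal ℂ (basisImage X) := by
  rw [orthonormal_iff_ite]
  intro w
  induction w with
  | nil =>
    intro v
    cases v with
    | nil => simpa [basisImage] using inner_vac_vac X
    | cons j v => simpa [basisImage] using inner_vac_gen X j _
  | cons i w ih =>
    intro v
    cases v with
    | nil =>
      have := inner_vac_gen X i (basisImage X w)
      have h2 : ⟪gen X i (basisImage X w), vac X⟫_ℂ = 0 := by
        rw [← inner_conj_symm, this, map_zero]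
      simpa [basisImage] using h2
    | cons j v =>
      simp only [basisImage, inner_gen_gen, ih, List.cons.injEq]
      by_cases h : i = j <;> simp [h]

/-- the norm-closed algebra generated by the images of the creation operators -/
def genAlgebra : Subalgebra ℂ (Fock n →L[ℂ] Fock n) :=
  (Algebra.adjoin ℂ (Set.range (gen X))).topologicalClosure

theorem gen_mem (i : Fin n) : gen X i ∈ genAlgebra X :=
  Subalgebra.le_topologicalClosure _ (Algebra.subset_adjoin ⟨i, rfl⟩)

theorem denom_mul_comb (c : ℂ) (a : Fin n → ℂ) :
    denom X * (algebraMap ℂ _ c + ∑ i, a i • gen X i) =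
      algebraMap ℂ _ (c * X.x - ∑ i, a i * X.y i) +
        linComb (fun k => ∑ i, a i * X.blk k i - c * X.z k) := by
  rw [mul_add, Finset.mul_sum]
  simp only [mul_smul_comm, denom_mul_gen, smul_sub, Finset.sum_sub_distrib]
  have h1 : linComb (fun k => ∑ i, a i * X.blk k i - c * X.z k) =
      ∑ i, a i • linComb (fun j => X.blk j i) - c • linComb X.z := by
    simp only [linComb, sub_smul, Finset.sum_smul, Finset.sum_sub_distrib, Finset.smul_sum,
      smul_smul]
    rw [Finset.sum_comm]
  rw [h1, denom]
  simp only [Algebra.algebraMap_eq_smul_one, sub_smul, Finset.sum_smul, smul_sub,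
    smul_smul, mul_smul_comm, mul_one]
  abel

theorem denom_mul_eq_one :
    denom X * (algebraMap ℂ _ (star X.x) + ∑ i, star (X.y i) • gen X i) = 1 := by
  rw [denom_mul_comb]
  have h1 : star X.x * X.x - ∑ i, star (X.y i) * X.y i = 1 := by
    have := X.row_rel (.inl ()) (.inl ())
    simp only [signature, Matrix.fromBlocks_apply₁₁, Matrix.neg_apply, Matrix.one_apply_eq] at this
    simp only [PseudoUnitary.x, PseudoUnitary.y, mul_comm (star _)]
    linear_combination -this
  have h2 : (fun k => ∑ i, star (X.y i) * X.blk k i - star X.x * X.z k) = 0 := by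
    ext k
    have := X.row_rel (.inr k) (.inl ())
    simp only [signature, Matrix.fromBlocks_apply₂₁, Matrix.zero_apply] at this
    simp only [PseudoUnitary.x, PseudoUnitary.y, PseudoUnitary.z, PseudoUnitary.blk,
      Matrix.toBlocks₂₂, Matrix.of_apply, mul_comm (star _), Pi.zero_apply]
    linear_combination this
  rw [h1, h2]
  simp [linComb]

theorem denom_mul_eq_creation (j : Fin n) :
    denom X * (algebraMap ℂ _ (star (X.z j)) + ∑ i, star (X.blk j i) • gen X i) = creation j := by
  rw [denom_mul_comb]
  have h1 : star (X.z j) * X.x - ∑ i, star (X.blk j i) * X.y i = 0 := by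
    have := X.row_rel (.inl ()) (.inr j)
    simp only [signature, Matrix.fromBlocks_apply₁₂, Matrix.zero_apply] at this
    simp only [PseudoUnitary.x, PseudoUnitary.y, PseudoUnitary.z, PseudoUnitary.blk,
      Matrix.toBlocks₂₂, Matrix.of_apply, mul_comm (star _)]
    linear_combination -this
  have h2 : (fun k => ∑ i, star (X.blk j i) * X.blk k i - star (X.z j) * X.z k) =
      Pi.single j 1 := by
    ext k
    have := X.row_rel (.inr k) (.inr j)
    simp only [signature, Matrix.fromBlocks_apply₂₂, Matrix.one_apply] at this
    simp only [PseudoUnitary.z, PseudoUnitary.blk,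
      Matrix.toBlocks₂₂, Matrix.of_apply, mul_comm (star _), Pi.single_apply]
    linear_combination this
  rw [h1, h2]
  simp [linComb, Pi.single_apply]

theorem denom_mem : denom X ∈ genAlgebra X := by
  have h1 := (denom_spec X).1
  have h2 : Ring.inverse (algebraMap ℂ _ (star X.x) - ∑ i, (-star (X.y i)) • gen X i) ∈
      genAlgebra X := by
    refine (inverse_mem _ (Subalgebra.isClosed_topologicalClosure _)
      (Subalgebra.sum_mem _ (fun i _ => Subalgebra.smul_mem _ (gen_mem X i) _)) ?_).2
    refine (norm_comb_le _ (inner_gen_gen X) _).trans_lt ?_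
    simpa using X.norm_y_lt
  have h3 : algebraMap ℂ _ (star X.x) - ∑ i, (-star (X.y i)) • gen X i =
      Ring.inverse (denom X) := by
    rw [← mul_one (Ring.inverse (denom X)), ← denom_mul_eq_one X, ← mul_assoc,
      Ring.inverse_mul_cancel _ h1, one_mul]
    simp [sub_eq_add_neg]
  rw [h3] at h2
  obtain ⟨u, hu⟩ := h1
  rw [← hu, Ring.inverse_unit, Ring.inverse_unit, inv_inv] at h2
  rwa [← hu]

theorem creation_mem_gen (j : Fin n) : creation j ∈ genAlgebra X := by
  rw [← denom_mul_eq_creation X j]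
  exact Subalgebra.mul_mem _ (denom_mem X) (Subalgebra.add_mem _ (Subalgebra.algebraMap_mem _ _)
    (Subalgebra.sum_mem _ (fun i _ => Subalgebra.smul_mem _ (gen_mem X i) _)))

theorem genAlgebra_eq : genAlgebra X = discAlgebra n := by
  apply le_antisymm
  · refine Subalgebra.topologicalClosure_minimal (Algebra.adjoin_le ?_)
      (Subalgebra.isClosed_topologicalClosure _)
    rintro _ ⟨i, rfl⟩
    exact genImage_mem X _
  · refine Subalgebra.topologicalClosure_minimal (Algebra.adjoin_le ?_)
      (Subalgebra.isClosed_topologicalClosure _)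
    rintro _ ⟨i, rfl⟩
    exact creation_mem_gen X i

theorem genAlgebra_apply_mem {A : Fock n →L[ℂ] Fock n} (hA : A ∈ genAlgebra X) {ξ : Fock n}
    (hξ : ξ ∈ (Submodule.span ℂ (Set.range (basisImage X))).topologicalClosure) :
    A ξ ∈ (Submodule.span ℂ (Set.range (basisImage X))).topologicalClosure := by
  set S := (Submodule.span ℂ (Set.range (basisImage X))).topologicalClosure with hS
  have hSc : IsClosed (S : Set (Fock n)) := Submodule.isClosed_topologicalClosure _
  have h1 : ∀ i, ∀ ξ ∈ S, gen X i ξ ∈ S := by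
    intro i ξ hξ
    have h2 : S ≤ S.comap (gen X i : Fock n →ₗ[ℂ] Fock n) := by
      refine Submodule.topologicalClosure_minimal _ (Submodule.span_le.2 ?_)
        (hSc.preimage (gen X i).continuous)
      rintro _ ⟨w, rfl⟩
      exact Submodule.le_topologicalClosure _ (Submodule.subset_span ⟨i :: w, rfl⟩)
    exact h2 hξ
  have h3 : ∀ A ∈ Algebra.adjoin ℂ (Set.range (gen X)), ∀ ξ ∈ S, A ξ ∈ S := by
    intro A hA
    induction hA using Algebra.adjoin_induction with
    | mem A hA => obtain ⟨i, rfl⟩ := hA; exact h1 i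
    | algebraMap r =>
      intro ξ hξ
      simpa [Algebra.algebraMap_eq_smul_one] using S.smul_mem r hξ
    | add A B _ _ hA hB => intro ξ hξ; exact S.add_mem (hA ξ hξ) (hB ξ hξ)
    | mul A B _ _ hA hB => intro ξ hξ; exact hA _ (hB ξ hξ)
  have h4 : IsClosed {A : Fock n →L[ℂ] Fock n | A ξ ∈ S} :=
    hSc.preimage (ContinuousLinearMap.apply ℂ (Fock n) ξ).continuous
  exact closure_minimal (fun A hA => h3 A hA ξ hξ) h4 hA

theorem dense_basisImage :
    ⊤ ≤ (Submodule.span ℂ (Set.range (basisImage X))).topologicalClosure := by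
  have h0 : vac X ∈ (Submodule.span ℂ (Set.range (basisImage X))).topologicalClosure :=
    Submodule.le_topologicalClosure _ (Submodule.subset_span ⟨[], rfl⟩)
  have h1 : ∀ w, e w ∈ (Submodule.span ℂ (Set.range (basisImage X))).topologicalClosure := by
    intro w
    induction w with
    | nil =>
      rw [← denom_vac X]
      exact genAlgebra_apply_mem X (denom_mem X) h0
    | cons i w ih =>
      rw [← creation_e]
      exact genAlgebra_apply_mem X (creation_mem_gen X i) ih
  intro ξ _
  refine (Submodule.isClosed_topologicalClosure _).mem_of_tendsto (hasSum_e ξ)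
    (Filter.Eventually.of_forall (fun s => ?_))
  exact Submodule.sum_mem _ (fun w _ => Submodule.smul_mem _ _ (h1 w))

/-- The unitary `U_X`: it maps `L_w e_∅ = e_w` to `Φ_X(L_w) (x I - L[z])⁻¹ e_∅`. -/
def fockUnitary : Fock n ≃ₗᵢ[ℂ] Fock n :=
  (HilbertBasis.mk (orthonormal_basisImage X) (dense_basisImage X)).repr.symm

theorem fockUnitary_e (w : List (Fin n)) : fockUnitary X (e w) = basisImage X w := by
  rw [fockUnitary, e, HilbertBasis.repr_symm_single, HilbertBasis.coe_mk]

/-- The automorphism `Φ_X(A) = U_X A U_X^*`, on all bounded operators of the Fock space. On the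
generators it is `Φ_X(L[ζ]) = (x I - L[z])⁻¹ (L[X₂₂ ζ] - (ζ · y) I)`, see `conjAut_linComb`. -/
def conjAut : (Fock n →L[ℂ] Fock n) ≃⋆ₐ[ℂ] (Fock n →L[ℂ] Fock n) :=
  (fockUnitary X).conjStarAlgEquiv

theorem conjAut_creation (i : Fin n) : conjAut X (creation i) = gen X i := by
  have h : (conjAut X (creation i)) ∘L (fockUnitary X : Fock n →L[ℂ] Fock n) =
      gen X i ∘L (fockUnitary X : Fock n →L[ℂ] Fock n) := by
    refine ext_e (fun w => ?_)
    change fockUnitary X (creation i ((fockUnitary X).symm (fockUnitary X (e w)))) =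
      gen X i (fockUnitary X (e w))
    rw [LinearIsometryEquiv.symm_apply_apply, creation_e, fockUnitary_e, fockUnitary_e]
    rfl
  ext1 ξ
  have := congrArg (fun A => A ((fockUnitary X).symm ξ)) h
  simpa using this

theorem conjAut_linComb (ζ : Fin n → ℂ) : conjAut X (linComb ζ) = genImage X ζ := by
  have h1 : linComb (X.blk.mulVec ζ) = ∑ i, ζ i • linComb (fun j => X.blk j i) := by
    simp only [linComb, Matrix.mulVec, dotProduct, Finset.sum_smul, Finset.smul_sum, smul_smul]
    rw [Finset.sum_comm]
    exact Finset.sum_congr rfl (fun i _ => Finset.sum_congr rfl (fun j _ => by rw [mul_comm]))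
  have h2 : genImage X ζ = ∑ i, ζ i • gen X i := by
    have h3 : ∀ i, gen X i = Ring.inverse (denom X) *
        (linComb (fun j => X.blk j i) - algebraMap ℂ _ (X.y i)) := by
      intro i
      rw [← denom_mul_gen, ← mul_assoc, Ring.inverse_mul_cancel _ (denom_spec X).1, one_mul]
    simp only [h3, ← mul_smul_comm, ← Finset.mul_sum, smul_sub, Finset.sum_sub_distrib]
    rw [genImage, h1]
    congr 2
    simp only [dotProduct, map_sum, map_mul, Algebra.smul_def]
  rw [h2, linComb, map_sum]
  exact Finset.sum_congr rfl (fun i _ => by rw [map_smul, conjAut_creation])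

/-- The defining property of `U_X`. -/
theorem fockUnitary_vacuum (A : Fock n →L[ℂ] Fock n) :
    fockUnitary X (A (e [])) = conjAut X A (Ring.inverse (denom X) (e [])) := by
  change _ = fockUnitary X (A ((fockUnitary X).symm (basisImage X [])))
  rw [← fockUnitary_e, LinearIsometryEquiv.symm_apply_apply]

theorem map_discAlgebra :
    (discAlgebra n).map
      ((conjAut X).toAlgEquiv : (Fock n →L[ℂ] Fock n) →ₐ[ℂ] (Fock n →L[ℂ] Fock n)) =
        discAlgebra n := by
  have h := Subalgebra.topologicalClosure_map
    ((fockUnitary X).toContinuousLinearEquiv.conjContinuousAlgEquiv :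
      (Fock n →L[ℂ] Fock n) →A[ℂ] (Fock n →L[ℂ] Fock n))
    ((fockUnitary X).toContinuousLinearEquiv.conjContinuousAlgEquiv).toHomeomorph.isClosedMap
    (Algebra.adjoin ℂ (Set.range (creation (n := n))))
  have h2 : (Algebra.adjoin ℂ (Set.range (creation (n := n)))).map
      ((conjAut X).toAlgEquiv : (Fock n →L[ℂ] Fock n) →ₐ[ℂ] (Fock n →L[ℂ] Fock n)) =
      Algebra.adjoin ℂ (Set.range (gen X)) := by
    rw [AlgHom.map_adjoin, ← Set.range_comp]
    congr 2
    ext1 i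
    exact conjAut_creation X i
  refine h.symm.trans ?_
  refine Eq.trans ?_ (genAlgebra_eq X)
  exact congrArg Subalgebra.topologicalClosure h2

/-- The automorphism `Φ_X` of the norm-closed algebra generated by the `L_i`. -/
def aut : discAlgebra n ≃ₐ[ℂ] discAlgebra n :=
  ((conjAut X).toAlgEquiv.subalgebraMap (discAlgebra n)).trans
    (Subalgebra.equivOfEq _ _ (map_discAlgebra X))

theorem aut_coe (f : discAlgebra n) : (aut X f : Fock n →L[ℂ] Fock n) = conjAut X f := rfl

end Automorphisms

section Defect

open ContinuousLinearMap

variable {E F : Type*} [NormedAddCommGroup E] [InnerProductSpace ℂ E] [CompleteSpace E]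
  [NormedAddCommGroup F] [InnerProductSpace ℂ F] [CompleteSpace F]

/-- The defect operator `D_A = (1 - A^*A)^{1/2}`. -/
def defectOp (A : E →L[ℂ] F) : E →L[ℂ] E := CFC.sqrt (1 - adjoint A ∘L A)

/-- The defect space, the closure of the range of `D_A`. -/
def defectSpace (A : E →L[ℂ] F) : Submodule ℂ E := (defectOp A).range.topologicalClosure

instance (A : E →L[ℂ] F) : CompleteSpace (defectSpace A) :=
  (Submodule.isClosed_topologicalClosure _).completeSpace_coe

theorem defectOp_nonneg (A : E →L[ℂ] F) : 0 ≤ defectOp A := CFC.sqrt_nonneg _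

theorem adjoint_defectOp (A : E →L[ℂ] F) : adjoint (defectOp A) = defectOp A :=
  (IsSelfAdjoint.of_nonneg (defectOp_nonneg A)).adjoint_eq

theorem one_sub_nonneg {A : E →L[ℂ] F} (h : ‖A‖ ≤ 1) : 0 ≤ 1 - adjoint A ∘L A := by
  rw [ContinuousLinearMap.nonneg_iff_isPositive, ContinuousLinearMap.isPositive_def']
  refine ⟨?_, fun x => ?_⟩
  · exact (IsSelfAdjoint.one _).sub (isPositive_adjoint_comp_self A).isSelfAdjoint
  · have h1 : ‖A x‖ ≤ ‖x‖ := by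
      simpa using (A.le_opNorm x).trans (mul_le_mul_of_nonneg_right h (norm_nonneg x))
    simp only [reApplyInnerSelf, sub_apply, one_apply_eq_self, inner_sub_left, coe_comp, Function.comp,
      adjoint_inner_left, map_sub, inner_self_eq_norm_sq]
    have := pow_le_pow_left₀ (norm_nonneg _) h1 2
    linarith

theorem defectOp_mul_self {A : E →L[ℂ] F} (h : ‖A‖ ≤ 1) :
    defectOp A ∘L defectOp A = 1 - adjoint A ∘L A :=
  CFC.sqrt_mul_sqrt_self _ (one_sub_nonneg h)

theorem defectOp_adjoint_mul_self {A : E →L[ℂ] F} (h : ‖A‖ ≤ 1) :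
    defectOp (adjoint A) ∘L defectOp (adjoint A) = 1 - A ∘L adjoint A := by
  rw [defectOp_mul_self (by simpa using h), adjoint_adjoint]

/-- `A D_A = D_{A^*} A`. -/
theorem comp_defectOp {A : E →L[ℂ] F} (h : ‖A‖ ≤ 1) :
    A ∘L defectOp A = defectOp (adjoint A) ∘L A := by
  set D := defectOp A with hD
  set G := defectOp (adjoint A) with hG
  have hDD : D ∘L D = 1 - adjoint A ∘L A := defectOp_mul_self h
  have hGG : G ∘L G = 1 - A ∘L adjoint A := defectOp_adjoint_mul_self h
  have hDs : adjoint D = D := adjoint_defectOp A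
  have hGs : adjoint G = G := adjoint_defectOp _
  set X := A ∘L D - G ∘L A with hX
  have h1 : X ∘L D = -(G ∘L X) := by
    have e1 : A ∘L (D ∘L D) = (G ∘L G) ∘L A := by
      rw [hDD, hGG]; ext x; simp
    rw [hX, sub_comp, comp_sub, comp_assoc, e1, comp_assoc, comp_assoc]
    abel
  have h2 : (adjoint X ∘L X) ∘L D = -(adjoint X ∘L G ∘L X) := by
    rw [comp_assoc, h1, comp_neg]
  have h3 : D ∘L (adjoint X ∘L X) = (adjoint X ∘L X) ∘L D := by
    have := congrArg adjoint h2
    rw [adjoint_comp, hDs, adjoint_comp, adjoint_adjoint, map_neg, adjoint_comp, adjoint_comp,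
      adjoint_adjoint, hGs, comp_assoc, ← h2] at this
    exact this
  have hP : (0 : E →L[ℂ] E) ≤ adjoint X ∘L X := 
    (ContinuousLinearMap.nonneg_iff_isPositive _).2 (isPositive_adjoint_comp_self X)
  have h4 : (0 : E →L[ℂ] E) ≤ (adjoint X ∘L X) ∘L D :=
    Commute.mul_nonneg hP (defectOp_nonneg A) h3.symm
  have h5 : (0 : E →L[ℂ] E) ≤ adjoint X ∘L G ∘L X := by
    have := (ContinuousLinearMap.nonneg_iff_isPositive _).1 (defectOp_nonneg (adjoint A))
    exact (ContinuousLinearMap.nonneg_iff_isPositive _).2 (this.adjoint_conj X)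
  have h6 : (adjoint X ∘L X) ∘L D = 0 := by
    refine le_antisymm ?_ h4
    rw [h2]; exact neg_nonpos.2 h5
  have h7 : X ∘L D = 0 := by
    rw [← adjoint_comp_self_eq_zero_iff, adjoint_comp, hDs, comp_assoc, ← comp_assoc _ X D, h6,
      comp_zero]
  have h8 : G ∘L X = 0 := by
    rw [h1] at h7; exact neg_eq_zero.1 h7
  have h9 : X ∘L adjoint X = -(G ∘L A ∘L adjoint X) := by
    have : D ∘L adjoint X = 0 := by
      have := congrArg adjoint h7
      rwa [adjoint_comp, hDs, map_zero] at this
    conv_lhs => rw [hX, sub_comp, comp_assoc, this, comp_zero, zero_sub, comp_assoc]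
  have h10 : adjoint X ∘L G = 0 := by
    have := congrArg adjoint h8
    rwa [adjoint_comp, hGs, map_zero] at this
  have h11 : adjoint (X ∘L adjoint X) ∘L (X ∘L adjoint X) = 0 := by
    rw [adjoint_comp, adjoint_adjoint, comp_assoc, h9, comp_neg, ← comp_assoc, h10]
    simp
  rw [adjoint_comp_self_eq_zero_iff] at h11
  have h12 : adjoint (adjoint X) ∘L adjoint X = 0 := by rw [adjoint_adjoint]; exact h11
  rw [adjoint_comp_self_eq_zero_iff] at h12
  have h13 : X = 0 := by simpa using congrArg adjoint h12
  exact sub_eq_zero.1 h13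

theorem norm_defectOp_sq {A : E →L[ℂ] F} (h : ‖A‖ ≤ 1) (x : E) :
    ‖defectOp A x‖ ^ 2 = ‖x‖ ^ 2 - ‖A x‖ ^ 2 := by
  rw [apply_norm_sq_eq_inner_adjoint_left, adjoint_defectOp, defectOp_mul_self h,
    apply_norm_sq_eq_inner_adjoint_left A, ← inner_self_eq_norm_sq (𝕜 := ℂ)]
  simp only [sub_apply, one_apply_eq_self, inner_sub_left, map_sub]

/-- unitarity of the colligation -/
theorem energy {A : E →L[ℂ] F} (h : ‖A‖ ≤ 1) (x : F) (k : E) :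
    ‖defectOp (adjoint A) x - A k‖ ^ 2 + ‖adjoint A x + defectOp A k‖ ^ 2 =
      ‖x‖ ^ 2 + ‖k‖ ^ 2 := by
  have h1 : ⟪defectOp (adjoint A) x, A k⟫_ℂ = ⟪adjoint A x, defectOp A k⟫_ℂ := by
    rw [← adjoint_inner_right, adjoint_defectOp, adjoint_inner_left, ← comp_apply, ← comp_apply,
      comp_defectOp h]
  rw [@norm_sub_sq ℂ, @norm_add_sq ℂ, h1, norm_defectOp_sq h, norm_defectOp_sq (by simpa using h)]
  ring

theorem mem_defectSpace (A : E →L[ℂ] F) (x : E) : defectOp A x ∈ defectSpace A :=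
  Submodule.le_topologicalClosure _ ⟨x, rfl⟩

theorem map_defectSpace {A : E →L[ℂ] F} (h : ‖A‖ ≤ 1) {k : E} (hk : k ∈ defectSpace A) :
    A k ∈ defectSpace (adjoint A) := by
  have h2 : defectSpace A ≤ (defectSpace (adjoint A)).comap (A : E →ₗ[ℂ] F) := by
    refine Submodule.topologicalClosure_minimal _ ?_
      ((Submodule.isClosed_topologicalClosure _).preimage A.continuous)
    rintro _ ⟨x, rfl⟩
    change A (defectOp A x) ∈ defectSpace (adjoint A)
    have h3 : A (defectOp A x) = defectOp (adjoint A) (A x) :=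
      congrArg (fun B : E →L[ℂ] F => B x) (comp_defectOp h)
    rw [h3]
    exact mem_defectSpace _ _
  exact h2 hk

end Defect

section Multi

open ContinuousLinearMap

variable {n : ℕ} {H : Type*} [NormedAddCommGroup H] [InnerProductSpace ℂ H] [CompleteSpace H]

/-- A multicontraction: `T = (T_1, …, T_n)` with `∑ T_i T_i^* ≤ 1`. -/
structure MultiContraction (n : ℕ) (H : Type*) [NormedAddCommGroup H] [InnerProductSpace ℂ H]
    [CompleteSpace H] where
  op : Fin n → (H →L[ℂ] H)
  contr : ∑ i, op i ∘L adjoint (op i) ≤ 1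

/-- `H^n` -/
abbrev Pow (n : ℕ) (H : Type*) : Type _ := PiLp 2 (fun _ : Fin n => H)

/-- The row operator `(T_1 ⋯ T_n) : H^n → H`. -/
def rowOp (T : Fin n → (H →L[ℂ] H)) : Pow n H →L[ℂ] H := ∑ i, T i ∘L PiLp.proj 2 (fun _ => H) i

theorem rowOp_apply (T : Fin n → (H →L[ℂ] H)) (k : Pow n H) : rowOp T k = ∑ i, T i (k i) := by
  simp [rowOp]

theorem adjoint_rowOp_apply (T : Fin n → (H →L[ℂ] H)) (h : H) (i : Fin n) :
    (adjoint (rowOp T) h) i = adjoint (T i) h := by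
  have : adjoint (rowOp T) h = WithLp.toLp 2 (fun i => adjoint (T i) h) := by
    refine ext_inner_right ℂ (fun k => ?_)
    rw [adjoint_inner_left, rowOp_apply, PiLp.inner_apply, inner_sum]
    simp [adjoint_inner_left]
  rw [this]

namespace MultiContraction

variable (T : MultiContraction n H)

/-- the row operator of `T` -/
abbrev row : Pow n H →L[ℂ] H := rowOp T.op

theorem norm_row_le : ‖T.row‖ ≤ 1 := by
  have h1 : ∀ h, ‖adjoint T.row h‖ ^ 2 ≤ ‖h‖ ^ 2 := by
    intro h
    have h2 := ((ContinuousLinearMap.le_def _ _).1 T.contr).re_inner_nonneg_left h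
    have h3 : ‖adjoint T.row h‖ ^ 2 = ∑ i, ‖adjoint (T.op i) h‖ ^ 2 := by
      rw [PiLp.norm_sq_eq_of_L2]
      simp only [adjoint_rowOp_apply]
    simp only [sub_apply, one_apply_eq_self, inner_sub_left, map_sub, sum_apply, sum_inner,
      map_sum, coe_comp, Function.comp] at h2
    have h4 : ∀ i, RCLike.re ⟪T.op i (adjoint (T.op i) h), h⟫_ℂ = ‖adjoint (T.op i) h‖ ^ 2 := by
      intro i
      rw [← adjoint_inner_right, inner_self_eq_norm_sq]
    simp only [h4, inner_self_eq_norm_sq] at h2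
    linarith
  rw [← LinearIsometryEquiv.norm_map adjoint]
  refine opNorm_le_bound _ zero_le_one (fun h => ?_)
  rw [one_mul]
  exact abs_le_of_sq_le_sq' (h1 h) (norm_nonneg _) |>.2

/-- `𝒟_T ⊆ H^n` -/
abbrev defect : Submodule ℂ (Pow n H) := defectSpace T.row

/-- `𝒟_{T^*} ⊆ H` -/
abbrev defectStar : Submodule ℂ H := defectSpace (adjoint T.row)

/-- `T_w = T_{i_1} ⋯ T_{i_k}` for `w = i_1 ⋯ i_k`. -/
def word (w : List (Fin n)) : H →L[ℂ] H := (w.map T.op).prod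

end MultiContraction

/-- words of length `N` -/
def level (n : ℕ) : ℕ → Finset (List (Fin n))
  | 0 => {[]}
  | N + 1 => (level n N ×ˢ (Finset.univ : Finset (Fin n))).image (fun p => p.1 ++ [p.2])

theorem mem_level {N : ℕ} {w : List (Fin n)} : w ∈ level n N ↔ w.length = N := by
  induction N generalizing w with
  | zero => simp [level]
  | succ N ih =>
    simp only [level, Finset.mem_image, Finset.mem_product, ih, Finset.mem_univ, and_true,
      Prod.exists]
    constructor
    · rintro ⟨v, i, hv, rfl⟩; simp [hv]
    · intro hw
      have hne : w ≠ [] := by rintro rfl; simp at hw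
      refine ⟨w.dropLast, w.getLast hne, by simp [hw], List.dropLast_append_getLast hne⟩

theorem sum_level_succ {N : ℕ} (g : List (Fin n) → ℝ) :
    ∑ w ∈ level n (N + 1), g w = ∑ w ∈ level n N, ∑ i, g (w ++ [i]) := by
  rw [level, Finset.sum_image, Finset.sum_product]
  rintro ⟨v, i⟩ _ ⟨v', i'⟩ _ h
  simpa using List.append_inj' h rfl

theorem energy_sum (T : MultiContraction n H) (x : List (Fin n) → H) (f : List (Fin n) → Pow n H)
    (hx : ∀ u i, x (u ++ [i]) = adjoint (T.op i) (x u) + (defectOp T.row (f u)) i) (N : ℕ) :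
    ∑ m ∈ Finset.range N, ∑ u ∈ level n m, ‖defectOp (adjoint T.row) (x u) - T.row (f u)‖ ^ 2
      + ∑ u ∈ level n N, ‖x u‖ ^ 2 =
    ‖x []‖ ^ 2 + ∑ m ∈ Finset.range N, ∑ u ∈ level n m, ‖f u‖ ^ 2 := by
  induction N with
  | zero => simp [level]
  | succ N ih =>
    rw [Finset.sum_range_succ, Finset.sum_range_succ, sum_level_succ, ← add_assoc, ← ih]
    have h1 : ∀ u, ∑ i, ‖x (u ++ [i])‖ ^ 2 =
        ‖adjoint T.row (x u) + defectOp T.row (f u)‖ ^ 2 := by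
      intro u
      rw [PiLp.norm_sq_eq_of_L2]
      refine Finset.sum_congr rfl (fun i _ => ?_)
      rw [hx, PiLp.add_apply, adjoint_rowOp_apply]
    simp only [h1]
    have h2 : ∑ u ∈ level n N, ‖defectOp (adjoint T.row) (x u) - T.row (f u)‖ ^ 2 +
        ∑ u ∈ level n N, ‖adjoint T.row (x u) + defectOp T.row (f u)‖ ^ 2 =
        ∑ u ∈ level n N, ‖x u‖ ^ 2 + ∑ u ∈ level n N, ‖f u‖ ^ 2 := by
      rw [← Finset.sum_add_distrib, ← Finset.sum_add_distrib]
      exact Finset.sum_congr rfl (fun u _ => energy T.norm_row_le _ _)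
    linarith

theorem sum_range_level (g : List (Fin n) → ℝ) (N : ℕ) :
    ∑ m ∈ Finset.range N, ∑ u ∈ level n m, g u =
      ∑ u ∈ (Finset.range N).biUnion (level n), g u := by
  rw [Finset.sum_biUnion]
  intro a _ b _ hab
  refine Finset.disjoint_left.2 (fun w h1 h2 => hab ?_)
  rw [← mem_level.1 h1, ← mem_level.1 h2]

theorem energy_bound (T : MultiContraction n H) (x : List (Fin n) → H) (f : FockTensor n T.defect)
    (hx : ∀ u i, x (u ++ [i]) = adjoint (T.op i) (x u) + (defectOp T.row (f u : Pow n H)) i)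
    (s : Finset (List (Fin n))) :
    ∑ u ∈ s, ‖defectOp (adjoint T.row) (x u) - T.row (f u)‖ ^ 2 ≤ ‖x []‖ ^ 2 + ‖f‖ ^ 2 := by
  set N := s.sup List.length + 1 with hN
  have h1 := energy_sum T x (fun u => (f u : Pow n H)) hx N
  rw [sum_range_level, sum_range_level] at h1
  have h2 : s ⊆ (Finset.range N).biUnion (level n) := by
    intro w hw
    simp only [Finset.mem_biUnion, Finset.mem_range]
    exact ⟨w.length, Nat.lt_succ_of_le (Finset.le_sup hw), mem_level.2 rfl⟩
  have h3 := sum_norm_sq_le f ((Finset.range N).biUnion (level n))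
  have h4 : 0 ≤ ∑ u ∈ level n N, ‖x u‖ ^ 2 := by positivity
  have h5 := Finset.sum_le_sum_of_subset_of_nonneg h2
    (f := fun u => ‖defectOp (adjoint T.row) (x u) - T.row (f u)‖ ^ 2)
    (fun _ _ _ => by positivity)
  simp only [Submodule.coe_norm] at h3
  linarith

theorem adjoint_word_nil (T : MultiContraction n H) (h : H) : adjoint (T.word []) h = h := by
  have : adjoint (1 : H →L[ℂ] H) = 1 := star_one _
  simp [MultiContraction.word, this]

theorem word_append (T : MultiContraction n H) (u v : List (Fin n)) :
    T.word (u ++ v) = T.word u ∘L T.word v := by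
  simp [MultiContraction.word, ContinuousLinearMap.mul_def]

theorem adjoint_word_append_singleton (T : MultiContraction n H) (u : List (Fin n)) (i : Fin n)
    (h : H) : adjoint (T.word (u ++ [i])) h = adjoint (T.op i) (adjoint (T.word u) h) := by
  rw [word_append, adjoint_comp]
  simp [MultiContraction.word]

/-- The Poisson kernel `K_T h = ∑_w e_w ⊗ D_{T^*} T_w^* h`. -/
def poisson (T : MultiContraction n H) : H →L[ℂ] FockTensor n T.defectStar :=
  ofCoords
    { toFun := fun h w => ⟨defectOp (adjoint T.row) (adjoint (T.word w) h), mem_defectSpace _ _⟩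
      map_add' := fun h k => by ext w; simp
      map_smul' := fun c h => by ext w; simp } 1 (fun h s => by
        have h1 := energy_bound T (fun w => adjoint (T.word w) h) 0 (fun u i => by
          simp [adjoint_word_append_singleton]) s
        simpa [adjoint_word_nil] using h1)

theorem poisson_apply (T : MultiContraction n H) (h : H) (w : List (Fin n)) :
    (poisson T h w : H) = defectOp (adjoint T.row) (adjoint (T.word w) h) := rfl

/-- The vector `x = (I - ∑ R_i ⊗ T_i^*)⁻¹ [R_1 ⊗ I, …, R_n ⊗ I] (I ⊗ D_T) f` in coordinates:
`x_u = ∑_{u = v i s} T_s^* (D_T f_v)_i`, a finite sum over the factorizations of the word `u` at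
one of its letters. Since `(R_i ξ)_{u i} = ξ_u`, the equation
`(I - ∑ R_i ⊗ T_i^*) x = ∑ R_i ⊗ (D_T f)_i` reads `x_∅ = 0`,
`x_{u i} = T_i^* x_u + (D_T f_u)_i`; this is `state_append`. -/
def state (T : MultiContraction n H) (f : List (Fin n) → T.defect) (u : List (Fin n)) : H :=
  ∑ m : Fin u.length, adjoint (T.word (u.drop (m + 1))) (defectOp T.row (f (u.take m)) u[m])

theorem state_append (T : MultiContraction n H) (f : List (Fin n) → T.defect) (u : List (Fin n))
    (i : Fin n) : state T f (u ++ [i]) =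
      adjoint (T.op i) (state T f u) + (defectOp T.row (f u : Pow n H)) i := by
  have h0 : ∀ (l : ℕ) (hl : (u ++ [i]).length = l),
    state T f (u ++ [i]) = ∑ m : Fin l, adjoint (T.word ((u ++ [i]).drop (m + 1)))
      (defectOp T.row (f ((u ++ [i]).take m)) ((u ++ [i])[m]'(by omega))) := by
    rintro _ rfl; rfl
  rw [h0 (u.length + 1) (by simp), Fin.sum_univ_castSucc, state, map_sum]
  congr 1
  · refine Finset.sum_congr rfl (fun m _ => ?_)
    have hm : (m : ℕ) < u.length := m.2
    rw [← adjoint_word_append_singleton]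
    have h1 : (u ++ [i]).drop (m + 1) = u.drop (m + 1) ++ [i] := by
      rw [List.drop_append_of_le_length (by omega)]
    have h2 : (u ++ [i]).take m = u.take m := by
      rw [List.take_append_of_le_length (by omega)]
    simp [h1, h2, List.getElem_append_left hm]
  · simp [adjoint_word_nil]

/-- The characteristic function `Θ_T : F ⊗ 𝒟_T → F ⊗ 𝒟_{T^*}`,
`Θ_T = -I ⊗ T + (I ⊗ D_{T^*}) (I - ∑ R_i ⊗ T_i^*)⁻¹ [R_1 ⊗ I, …, R_n ⊗ I] (I ⊗ D_T)`, where `R_i`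
are the right creation operators; the formal Fourier series in the `R_i` is evaluated coordinate
by coordinate, where it is a finite sum (see `state` and `charFun_apply`). -/
def charFun (T : MultiContraction n H) : FockTensor n T.defect →L[ℂ] FockTensor n T.defectStar :=
  ofCoords
    { toFun := fun f u => ⟨-(T.row (f u)) + defectOp (adjoint T.row) (state T f u),
        Submodule.add_mem _ (Submodule.neg_mem _ (map_defectSpace T.norm_row_le (f u).2))
          (mem_defectSpace _ _)⟩
      map_add' := fun f g => by
        ext u; simp [state, Finset.sum_add_distrib]; abel
      map_smul' := fun c f => by
        ext u; simp [state, Finset.smul_sum] } 1 (fun f s => by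
        have h1 := energy_bound T (state T f) f (state_append T f) s
        simpa [state, neg_add_eq_sub] using h1)

theorem charFun_apply (T : MultiContraction n H) (f : FockTensor n T.defect) (u : List (Fin n)) :
    (charFun T f u : H) = -(T.row (f u)) +
      defectOp (adjoint T.row) (∑ m : Fin u.length,
        adjoint (T.word (u.drop (m + 1))) (defectOp T.row (f (u.take m)) u[m])) := rfl

end Multi

section Calculus

open ContinuousLinearMap Filter Topology

variable {n : ℕ} {H : Type*} [NormedAddCommGroup H] [InnerProductSpace ℂ H] [CompleteSpace H]

theorem contr_iff (S : Fin n → (H →L[ℂ] H)) :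
    ∑ i, S i ∘L adjoint (S i) ≤ 1 ↔ ∀ h, ∑ i, ‖adjoint (S i) h‖ ^ 2 ≤ ‖h‖ ^ 2 := by
  have h4 : ∀ h, RCLike.re ⟪(1 - ∑ i, S i ∘L adjoint (S i)) h, h⟫_ℂ =
      ‖h‖ ^ 2 - ∑ i, ‖adjoint (S i) h‖ ^ 2 := by
    intro h
    have : ∀ i, RCLike.re ⟪S i (adjoint (S i) h), h⟫_ℂ = ‖adjoint (S i) h‖ ^ 2 := by
      intro i
      rw [← adjoint_inner_right, inner_self_eq_norm_sq]
    simp only [sub_apply, one_apply_eq_self, inner_sub_left, map_sub, sum_apply, sum_inner,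
      map_sum, coe_comp, Function.comp, this, inner_self_eq_norm_sq]
  rw [ContinuousLinearMap.le_def]
  constructor
  · intro hp h
    have := hp.re_inner_nonneg_left h
    rw [h4] at this
    linarith
  · intro hp
    rw [ContinuousLinearMap.isPositive_def']
    refine ⟨(IsSelfAdjoint.one _).sub (isSelfAdjoint_sum _ (fun i _ =>
      (isPositive_self_comp_adjoint (S i)).isSelfAdjoint)), fun h => ?_⟩
    rw [reApplyInnerSelf, h4]
    linarith [hp h]

/-- `r T` -/
def scale (T : MultiContraction n H) (r : ℝ) (hr : r ∈ Set.Ico (0 : ℝ) 1) :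
    MultiContraction n H where
  op i := (r : ℂ) • T.op i
  contr := by
    rw [contr_iff]
    intro h
    have h1 := (contr_iff _).1 T.contr h
    have h2 : ∀ i, ‖adjoint ((r : ℂ) • T.op i) h‖ ^ 2 = r ^ 2 * ‖adjoint (T.op i) h‖ ^ 2 := by
      intro i
      rw [map_smulₛₗ, smul_apply, norm_smul, mul_pow]
      simp
    simp only [h2]
    rw [← Finset.mul_sum]
    have h3 : r ^ 2 ≤ 1 := pow_le_one₀ hr.1 hr.2.le
    have h5 : 0 ≤ ∑ i, ‖adjoint (T.op i) h‖ ^ 2 := by positivity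
    nlinarith

theorem sum_level_word_le (T : MultiContraction n H) (h : H) (N : ℕ) :
    ∑ u ∈ level n N, ‖adjoint (T.word u) h‖ ^ 2 ≤ ‖h‖ ^ 2 := by
  have h1 := energy_sum T (fun w => adjoint (T.word w) h) 0 (fun u i => by
          simp [adjoint_word_append_singleton]) N
  have h2 : 0 ≤ ∑ m ∈ Finset.range N, ∑ u ∈ level n m,
      ‖defectOp (adjoint T.row) (adjoint (T.word u) h) -
        T.row ((0 : List (Fin n) → Pow n H) u)‖ ^ 2 := by positivity
  simp only [Pi.zero_apply, norm_zero, ne_eq, OfNat.ofNat_ne_zero, not_false_eq_true, zero_pow,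
    Finset.sum_const_zero, add_zero, adjoint_word_nil] at h1 h2
  linarith

theorem word_scale (T : MultiContraction n H) (r : ℝ) (hr : r ∈ Set.Ico (0 : ℝ) 1)
    (u : List (Fin n)) : (scale T r hr).word u = ((r : ℂ) ^ u.length) • T.word u := by
  induction u with
  | nil => simp [MultiContraction.word]
  | cons i u ih =>
    simp only [MultiContraction.word, List.map_cons, List.prod_cons, List.length_cons] at ih ⊢
    rw [ih, pow_succ', mul_smul]
    simp only [scale, smul_mul_assoc, mul_smul_comm]
    exact smul_comm _ _ _

theorem norm_poisson_scale (T : MultiContraction n H) (r : ℝ) (hr : r ∈ Set.Ico (0 : ℝ) 1)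
    (h : H) : ‖h‖ ≤ ‖poisson (scale T r hr) h‖ := by
  set S := scale T r hr
  have h1 : ∀ N : ℕ, ‖h‖ ^ 2 ≤ ‖poisson S h‖ ^ 2 + (r ^ 2) ^ N * ‖h‖ ^ 2 := by
    intro N
    have e1 := energy_sum S (fun w => adjoint (S.word w) h) 0 (fun u i => by
          simp [adjoint_word_append_singleton]) N
    simp only [Pi.zero_apply, norm_zero, ne_eq, OfNat.ofNat_ne_zero, not_false_eq_true, zero_pow,
      Finset.sum_const_zero, add_zero, adjoint_word_nil, map_zero, sub_zero] at e1
    rw [sum_range_level] at e1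
    have e2 := sum_norm_sq_le (poisson S h) ((Finset.range N).biUnion (level n))
    simp only [Submodule.coe_norm, poisson_apply] at e2
    have e3 : ∑ u ∈ level n N, ‖adjoint (S.word u) h‖ ^ 2 ≤ (r ^ 2) ^ N * ‖h‖ ^ 2 := by
      calc ∑ u ∈ level n N, ‖adjoint (S.word u) h‖ ^ 2
          = ∑ u ∈ level n N, (r ^ 2) ^ N * ‖adjoint (T.word u) h‖ ^ 2 := by
            refine Finset.sum_congr rfl (fun u hu => ?_)
            rw [word_scale, map_smulₛₗ, smul_apply, norm_smul, mul_pow, mem_level.1 hu]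
            rw [starRingEnd_apply, norm_star, norm_pow, Complex.norm_real, Real.norm_eq_abs,
              ← pow_mul, mul_comm N 2, pow_mul, sq_abs]
        _ ≤ _ := by
            rw [← Finset.mul_sum]
            exact mul_le_mul_of_nonneg_left (sum_level_word_le T h N) (by positivity)
    linarith
  have h2 : Tendsto (fun N : ℕ => ‖poisson S h‖ ^ 2 + (r ^ 2) ^ N * ‖h‖ ^ 2) atTop
      (𝓝 (‖poisson S h‖ ^ 2 + 0 * ‖h‖ ^ 2)) := by
    refine Tendsto.const_add _ (Tendsto.mul_const _ ?_)
    exact tendsto_pow_atTop_nhds_zero_of_lt_one (by positivity)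
      (pow_lt_one₀ hr.1 hr.2 (by norm_num))
  have h3 := ge_of_tendsto' h2 h1
  rw [zero_mul, add_zero] at h3
  exact abs_le_of_sq_le_sq' h3 (norm_nonneg _) |>.2

theorem norm_poisson_le (T : MultiContraction n H) : ‖poisson T‖ ≤ 1 :=
  (ofCoords_norm_le _ _ _).trans (by simp)

/-- the algebra generated by the pairs `(L_i, S_i)` -/
def pairAlg (S : Fin n → (H →L[ℂ] H)) :
    Subalgebra ℂ ((Fock n →L[ℂ] Fock n) × (H →L[ℂ] H)) :=
  Algebra.adjoin ℂ (Set.range (fun i => (creation i, S i)))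

theorem ampLeft_comp {E : Type*} [NormedAddCommGroup E] [InnerProductSpace ℂ E] [CompleteSpace E]
    (A B : Fock n →L[ℂ] Fock n) :
    (ampLeft (A ∘L B) : FockTensor n E →L[ℂ] FockTensor n E) = ampLeft A ∘L ampLeft B := by
  ext1 f
  refine ext_slice (fun k => ?_)
  simp [slice_ampLeft]

theorem ampLeft_add {E : Type*} [NormedAddCommGroup E] [InnerProductSpace ℂ E] [CompleteSpace E]
    (A B : Fock n →L[ℂ] Fock n) :
    (ampLeft (A + B) : FockTensor n E →L[ℂ] FockTensor n E) = ampLeft A + ampLeft B := by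
  ext1 f
  refine ext_slice (fun k => ?_)
  simp [slice_ampLeft]

theorem ampLeft_smul_one {E : Type*} [NormedAddCommGroup E] [InnerProductSpace ℂ E]
    [CompleteSpace E] (c : ℂ) (f : FockTensor n E) :
    ampLeft (c • (1 : Fock n →L[ℂ] Fock n)) f = c • f := by
  refine ext_slice (fun k => ?_)
  simp [slice_ampLeft]

theorem ampLeft_adjoint_creation {E : Type*} [NormedAddCommGroup E] [InnerProductSpace ℂ E]
    [CompleteSpace E] (i : Fin n) (f : FockTensor n E) (w : List (Fin n)) :
    ampLeft (adjoint (creation i)) f w = f (i :: w) := by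
  refine ext_inner_left ℂ (fun k => ?_)
  rw [inner_ampLeft, ← inner_e_left, adjoint_inner_right, creation_e, inner_e_left, slice_apply]

theorem adjoint_algebraMap {K : Type*} [NormedAddCommGroup K] [InnerProductSpace ℂ K]
    [CompleteSpace K] (c : ℂ) :
    adjoint (algebraMap ℂ (K →L[ℂ] K) c) = star c • (1 : K →L[ℂ] K) := by
  rw [Algebra.algebraMap_eq_smul_one, map_smulₛₗ]
  congr 1
  exact star_one _

theorem intertwine (S : MultiContraction n H) {p : (Fock n →L[ℂ] Fock n) × (H →L[ℂ] H)}
    (hp : p ∈ pairAlg S.op) :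
    ampLeft (adjoint p.1) ∘L poisson S = poisson S ∘L adjoint p.2 := by
  induction hp using Algebra.adjoin_induction with
  | mem p hp =>
    obtain ⟨i, rfl⟩ := hp
    ext h w
    change ((ampLeft (adjoint (creation i)) (poisson S h) w : S.defectStar) : H) =
      ((poisson S (adjoint (S.op i) h) w : S.defectStar) : H)
    rw [ampLeft_adjoint_creation, poisson_apply, poisson_apply]
    have : S.word (i :: w) = S.op i ∘L S.word w := by
      simp [MultiContraction.word, ContinuousLinearMap.mul_def]
    rw [this, adjoint_comp]
    rfl
  | algebraMap c =>
    ext1 h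
    change ampLeft (adjoint (algebraMap ℂ (Fock n →L[ℂ] Fock n) c)) (poisson S h) =
      poisson S (adjoint (algebraMap ℂ (H →L[ℂ] H) c) h)
    rw [adjoint_algebraMap, adjoint_algebraMap, ampLeft_smul_one]
    simp
  | add p q _ _ hp hq =>
    rw [Prod.fst_add, Prod.snd_add, map_add, map_add, ampLeft_add, add_comp, hp, hq, comp_add]
  | mul p q _ _ hp hq =>
    change ampLeft (adjoint (p.1 ∘L q.1)) ∘L poisson S = poisson S ∘L adjoint (p.2 ∘L q.2)
    rw [adjoint_comp, adjoint_comp, ampLeft_comp, comp_assoc, hp, ← comp_assoc, hq, comp_assoc]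

theorem norm_le_scale (T : MultiContraction n H) (r : ℝ) (hr : r ∈ Set.Ico (0 : ℝ) 1)
    {p : (Fock n →L[ℂ] Fock n) × (H →L[ℂ] H)} (hp : p ∈ pairAlg (scale T r hr).op) :
    ‖p.2‖ ≤ ‖p.1‖ := by
  rw [← LinearIsometryEquiv.norm_map adjoint p.2]
  refine opNorm_le_bound _ (norm_nonneg _) (fun h => ?_)
  refine (norm_poisson_scale T r hr _).trans ?_
  have h1 := congrArg (fun B => B h) (intertwine (scale T r hr) hp)
  simp only [comp_apply] at h1
  rw [← h1]
  refine (le_opNorm _ _).trans ?_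
  refine mul_le_mul ((norm_ampLeft_le _).trans ?_) ?_ (norm_nonneg _) (norm_nonneg _)
  · rw [LinearIsometryEquiv.norm_map]
  · simpa using (le_opNorm (poisson (scale T r hr)) h).trans
      (mul_le_mul_of_nonneg_right (norm_poisson_le _) (norm_nonneg _))

/-- von Neumann's inequality for multicontractions -/
theorem von_neumann (T : MultiContraction n H)
    {p : (Fock n →L[ℂ] Fock n) × (H →L[ℂ] H)} (hp : p ∈ pairAlg T.op) : ‖p.2‖ ≤ ‖p.1‖ := by
  have key : ∃ B : ℝ → (H →L[ℂ] H), (∀ r (hr : r ∈ Set.Ico (0 : ℝ) 1),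
      (p.1, B r) ∈ pairAlg (scale T r hr).op) ∧ Tendsto B (𝓝[<] 1) (𝓝 p.2) := by
    induction hp using Algebra.adjoin_induction with
    | mem p hp =>
      obtain ⟨i, rfl⟩ := hp
      refine ⟨fun r => (r : ℂ) • T.op i, fun r hr => Algebra.subset_adjoin ⟨i, rfl⟩, ?_⟩
      have h1 : Continuous fun r : ℝ => (r : ℂ) • T.op i := by fun_prop
      have h2 := h1.tendsto 1
      simp only [Complex.ofReal_one, one_smul] at h2
      exact h2.mono_left nhdsWithin_le_nhds
    | algebraMap c =>
      exact ⟨fun _ => algebraMap ℂ _ c, fun r hr => Subalgebra.algebraMap_mem _ c,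
        tendsto_const_nhds⟩
    | add p q _ _ hp hq =>
      obtain ⟨B, hB, hB'⟩ := hp
      obtain ⟨C, hC, hC'⟩ := hq
      exact ⟨fun r => B r + C r, fun r hr => Subalgebra.add_mem _ (hB r hr) (hC r hr),
        hB'.add hC'⟩
    | mul p q _ _ hp hq =>
      obtain ⟨B, hB, hB'⟩ := hp
      obtain ⟨C, hC, hC'⟩ := hq
      exact ⟨fun r => B r * C r, fun r hr => Subalgebra.mul_mem _ (hB r hr) (hC r hr),
        hB'.mul hC'⟩
  obtain ⟨B, hB, hB'⟩ := key
  refine le_of_tendsto hB'.norm ?_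
  filter_upwards [Ioo_mem_nhdsLT (show (0 : ℝ) < 1 by norm_num)] with r hr
  exact norm_le_scale T r ⟨hr.1.le, hr.2⟩ (hB r _)

/-- The graph of the functional calculus: the norm closure of `{(p(L), p(T))}`. -/
def calcGraph (T : MultiContraction n H) :
    Subalgebra ℂ ((Fock n →L[ℂ] Fock n) × (H →L[ℂ] H)) :=
  (pairAlg T.op).topologicalClosure

theorem calcGraph_norm_le (T : MultiContraction n H)
    {p : (Fock n →L[ℂ] Fock n) × (H →L[ℂ] H)} (hp : p ∈ calcGraph T) : ‖p.2‖ ≤ ‖p.1‖ := by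
  have h1 : IsClosed {p : (Fock n →L[ℂ] Fock n) × (H →L[ℂ] H) | ‖p.2‖ ≤ ‖p.1‖} :=
    isClosed_le (by fun_prop) (by fun_prop)
  exact closure_minimal (fun p hp => von_neumann T hp) h1 hp

theorem calcGraph_fst_mem (T : MultiContraction n H)
    {p : (Fock n →L[ℂ] Fock n) × (H →L[ℂ] H)} (hp : p ∈ calcGraph T) : p.1 ∈ discAlgebra n := by
  have h1 : pairAlg T.op ≤ (discAlgebra n).comap (AlgHom.fst ℂ _ _) := by
    refine Algebra.adjoin_le ?_
    rintro _ ⟨i, rfl⟩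
    exact creation_mem i
  have h2 : IsClosed {p : (Fock n →L[ℂ] Fock n) × (H →L[ℂ] H) | p.1 ∈ discAlgebra n} :=
    (Subalgebra.isClosed_topologicalClosure _).preimage continuous_fst
  exact closure_minimal (fun p hp => h1 hp) h2 hp

/-- the first projection of the graph -/
def calcFst (T : MultiContraction n H) : calcGraph T →ₐ[ℂ] discAlgebra n :=
  ((AlgHom.fst ℂ _ _).comp (calcGraph T).val).codRestrict (discAlgebra n)
    (fun p => calcGraph_fst_mem T p.2)

theorem calcFst_bijective (T : MultiContraction n H) : Function.Bijective (calcFst T) := by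
  have hiso : Isometry (fun p : calcGraph T => (p : (Fock n →L[ℂ] Fock n) × (H →L[ℂ] H)).1) := by
    refine Isometry.of_dist_eq (fun p q => ?_)
    rw [dist_eq_norm, Subtype.dist_eq, dist_eq_norm, Prod.norm_def]
    have := calcGraph_norm_le T (Subalgebra.sub_mem _ p.2 q.2)
    exact (max_eq_left this).symm
  constructor
  · intro p q h
    exact hiso.injective (congrArg Subtype.val h)
  · have hc : CompleteSpace (calcGraph T) :=
      (Subalgebra.isClosed_topologicalClosure (pairAlg T.op)).completeSpace_coe
    have h1 : IsClosed (Set.range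
        (fun p : calcGraph T => (p : (Fock n →L[ℂ] Fock n) × (H →L[ℂ] H)).1)) :=
      hiso.isClosedEmbedding.isClosed_range
    have h2 : Algebra.adjoin ℂ (Set.range (creation (n := n))) ≤
        (AlgHom.range ((AlgHom.fst ℂ _ _).comp (calcGraph T).val)) := by
      refine Algebra.adjoin_le ?_
      rintro _ ⟨i, rfl⟩
      exact ⟨⟨(creation i, T.op i), Subalgebra.le_topologicalClosure _
        (Algebra.subset_adjoin ⟨i, rfl⟩)⟩, rfl⟩
    rintro ⟨f, hf⟩
    obtain ⟨p, hp⟩ := closure_minimal (fun f hf => h2 hf) h1 hf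
    exact ⟨p, Subtype.ext hp⟩

/-- The functional calculus `f ↦ f(T)`: the contractive homomorphism (`norm_calc_le`) on the
norm-closed algebra generated by the `L_i` that maps `L_i` to `T_i` (`calc_leftGen`). It is the only
continuous one (`calc_unique`). -/
def MultiContraction.calc (T : MultiContraction n H) : discAlgebra n →ₐ[ℂ] (H →L[ℂ] H) :=
  ((AlgHom.snd ℂ _ _).comp (calcGraph T).val).comp
    (AlgEquiv.ofBijective (calcFst T) (calcFst_bijective T)).symm.toAlgHom

theorem calc_of_mem (T : MultiContraction n H) {f : discAlgebra n} {B : H →L[ℂ] H}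
    (h : ((f : Fock n →L[ℂ] Fock n), B) ∈ calcGraph T) : T.calc f = B := by
  have : (AlgEquiv.ofBijective (calcFst T) (calcFst_bijective T)).symm f = ⟨_, h⟩ := by
    rw [AlgEquiv.symm_apply_eq]
    rfl
  simp [MultiContraction.calc, this]

/-- `L_i` as an element of the algebra it generates with the other `L_k` -/
def leftGen (i : Fin n) : discAlgebra n := ⟨creation i, creation_mem i⟩

theorem calc_leftGen (T : MultiContraction n H) (i : Fin n) : T.calc (leftGen i) = T.op i :=
  calc_of_mem T (Subalgebra.le_topologicalClosure _ (Algebra.subset_adjoin ⟨i, rfl⟩))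

theorem norm_calc_le (T : MultiContraction n H) (f : discAlgebra n) : ‖T.calc f‖ ≤ ‖f‖ := by
  obtain ⟨p, rfl⟩ := (calcFst_bijective T).2 f
  have h : T.calc (calcFst T p) = (p : (Fock n →L[ℂ] Fock n) × (H →L[ℂ] H)).2 :=
    calc_of_mem T p.2
  rw [h]
  exact calcGraph_norm_le T p.2

theorem calc_unique (T : MultiContraction n H) (ρ : discAlgebra n →ₐ[ℂ] (H →L[ℂ] H))
    (hρ : Continuous ρ) (h : ∀ i, ρ (leftGen i) = T.op i) : ρ = T.calc := by
  have hc : Continuous T.calc :=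
    AddMonoidHomClass.continuous_of_bound T.calc 1 (fun f => by rw [one_mul]; exact norm_calc_le T f)
  have h0 : ∀ f (hf : f ∈ Algebra.adjoin ℂ (Set.range (creation (n := n)))),
      ρ ⟨f, Subalgebra.le_topologicalClosure _ hf⟩ =
        T.calc ⟨f, Subalgebra.le_topologicalClosure _ hf⟩ := by
    intro f hf
    induction hf using Algebra.adjoin_induction with
    | mem f hf => obtain ⟨i, rfl⟩ := hf; exact (h i).trans (calc_leftGen T i).symm
    | algebraMap c => exact (ρ.commutes c).trans (T.calc.commutes c).symm
    | add f g hf hg h1 h2 =>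
      refine (map_add ρ ⟨f, Subalgebra.le_topologicalClosure _ hf⟩
        ⟨g, Subalgebra.le_topologicalClosure _ hg⟩).trans ?_
      rw [h1, h2]; exact (map_add T.calc _ _).symm
    | mul f g hf hg h1 h2 =>
      refine (map_mul ρ ⟨f, Subalgebra.le_topologicalClosure _ hf⟩
        ⟨g, Subalgebra.le_topologicalClosure _ hg⟩).trans ?_
      rw [h1, h2]; exact (map_mul T.calc _ _).symm
  ext1 f
  have hd : IsClosed {f : discAlgebra n | ρ f = T.calc f} := isClosed_eq hρ hc
  have hf : f ∈ closure {f : discAlgebra n | ρ f = T.calc f} := by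
    have hsub : (Algebra.adjoin ℂ (Set.range (creation (n := n))) :
        Set (Fock n →L[ℂ] Fock n)) ⊆
          Subtype.val '' {f : discAlgebra n | ρ f = T.calc f} :=
      fun g hg => ⟨⟨g, Subalgebra.le_topologicalClosure _ hg⟩, h0 g hg, rfl⟩
    exact closure_subtype.2 (closure_mono hsub f.2)
  exact hd.closure_subset hf

end Calculus

section Constrained

open ContinuousLinearMap

variable {n : ℕ} {H : Type*} [NormedAddCommGroup H] [InnerProductSpace ℂ H] [CompleteSpace H]

/-- Closure of a set of operators on the Fock space in the weak operator topology. -/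
def wotClosure (S : Set (Fock n →L[ℂ] Fock n)) : Set (Fock n →L[ℂ] Fock n) :=
  {A | ContinuousLinearMapWOT.ofCLM A ∈ closure (ContinuousLinearMapWOT.ofCLM '' S)}

/-- `𝔍`, the WOT-closure of `𝔧`. -/
def wotIdeal (j : TwoSidedIdeal (discAlgebra n)) : Set (Fock n →L[ℂ] Fock n) :=
  wotClosure (Subtype.val '' (j : Set (discAlgebra n)))

/-- `ℳ_𝔍 = closure (𝔍 F)` -/
def idealSpace (J : Set (Fock n →L[ℂ] Fock n)) : Submodule ℂ (Fock n) :=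
  (Submodule.span ℂ {η | ∃ A ∈ J, ∃ ξ, η = A ξ}).topologicalClosure

/-- `𝒩_𝔍 = F ⊖ ℳ_𝔍` -/
def coSpace (J : Set (Fock n →L[ℂ] Fock n)) : Submodule ℂ (Fock n) := (idealSpace J)ᗮ

/-- the closed subspace `𝒩 ⊗ E` of `F ⊗ E` -/
def tensorSub (N : Submodule ℂ (Fock n)) (E : Type*) [NormedAddCommGroup E]
    [InnerProductSpace ℂ E] : Submodule ℂ (FockTensor n E) :=
  (Submodule.span ℂ {f | ∃ ξ ∈ N, ∃ k : E, f = tmul ξ k}).topologicalClosure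

instance (N : Submodule ℂ (Fock n)) (E : Type*) [NormedAddCommGroup E]
    [InnerProductSpace ℂ E] [CompleteSpace E] : CompleteSpace (tensorSub N E) :=
  (Submodule.isClosed_topologicalClosure _).completeSpace_coe

theorem tensorOp_mem {E E' : Type*} [NormedAddCommGroup E] [InnerProductSpace ℂ E]
    [CompleteSpace E] [NormedAddCommGroup E'] [InnerProductSpace ℂ E']
    {A : Fock n →L[ℂ] Fock n} {N N' : Submodule ℂ (Fock n)} (hA : ∀ ξ ∈ N, A ξ ∈ N')
    (B : E →L[ℂ] E') {f : FockTensor n E} (hf : f ∈ tensorSub N E) :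
    tensorOp A B f ∈ tensorSub N' E' := by
  have h : tensorSub N E ≤
      (tensorSub N' E').comap (tensorOp A B : FockTensor n E →ₗ[ℂ] FockTensor n E') := by
    refine Submodule.topologicalClosure_minimal _ (Submodule.span_le.2 ?_)
      ((Submodule.isClosed_topologicalClosure _).preimage (tensorOp A B).continuous)
    rintro _ ⟨ξ, hξ, k, rfl⟩
    change tensorOp A B (tmul ξ k) ∈ tensorSub N' E'
    rw [tensorOp_tmul]
    exact Submodule.le_topologicalClosure _ (Submodule.subset_span ⟨_, hA ξ hξ, _, rfl⟩)
  exact h hf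

/-- The restriction of `A ⊗ B` to a map `𝒩 ⊗ E → 𝒩' ⊗ E'`, when `A 𝒩 ⊆ 𝒩'`. -/
def tensorRestrict {E E' : Type*} [NormedAddCommGroup E] [InnerProductSpace ℂ E]
    [CompleteSpace E] [NormedAddCommGroup E'] [InnerProductSpace ℂ E']
    (A : Fock n →L[ℂ] Fock n) (B : E →L[ℂ] E') (N N' : Submodule ℂ (Fock n))
    (hA : ∀ ξ ∈ N, A ξ ∈ N') : tensorSub N E →L[ℂ] tensorSub N' E' :=
  (tensorOp A B ∘L (tensorSub N E).subtypeL).codRestrict _ (fun f => tensorOp_mem hA B f.2)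

theorem fockUnitary_mem (X : PseudoUnitary n) (J : Set (Fock n →L[ℂ] Fock n)) {ξ : Fock n}
    (hξ : ξ ∈ coSpace J) : fockUnitary X ξ ∈ coSpace (conjAut X '' J) := by
  have h0 : ∀ A ∈ J, ∀ η, ⟪A η, ξ⟫_ℂ = 0 := fun A hA η =>
    (Submodule.mem_orthogonal _ _).1 hξ _
      (Submodule.le_topologicalClosure _ (Submodule.subset_span ⟨A, hA, η, rfl⟩))
  have h1 : idealSpace (conjAut X '' J) ≤ (ℂ ∙ (fockUnitary X ξ))ᗮ := by
    refine Submodule.topologicalClosure_minimal _ (Submodule.span_le.2 ?_)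
      (Submodule.isClosed_orthogonal _)
    rintro _ ⟨_, ⟨A, hA, rfl⟩, η, rfl⟩
    refine Submodule.mem_orthogonal_singleton_iff_inner_left.2 ?_
    change ⟪fockUnitary X (A ((fockUnitary X).symm η)), fockUnitary X ξ⟫_ℂ = 0
    rw [LinearIsometryEquiv.inner_map_map]
    exact h0 A hA _
  refine (Submodule.mem_orthogonal _ _).2 (fun η hη => ?_)
  exact Submodule.mem_orthogonal_singleton_iff_inner_left.1 (h1 hη)

theorem fockUnitary_symm_mem (X : PseudoUnitary n) (J : Set (Fock n →L[ℂ] Fock n)) {ξ : Fock n}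
    (hξ : ξ ∈ coSpace (conjAut X '' J)) : (fockUnitary X).symm ξ ∈ coSpace J := by
  have h0 : ∀ A ∈ J, ∀ η, ⟪conjAut X A η, ξ⟫_ℂ = 0 := fun A hA η =>
    (Submodule.mem_orthogonal _ _).1 hξ _
      (Submodule.le_topologicalClosure _
        (Submodule.subset_span ⟨_, Set.mem_image_of_mem _ hA, η, rfl⟩))
  have h1 : idealSpace J ≤ (ℂ ∙ ((fockUnitary X).symm ξ))ᗮ := by
    refine Submodule.topologicalClosure_minimal _ (Submodule.span_le.2 ?_)
      (Submodule.isClosed_orthogonal _)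
    rintro _ ⟨A, hA, η, rfl⟩
    refine Submodule.mem_orthogonal_singleton_iff_inner_left.2 ?_
    have h2 := h0 A hA (fockUnitary X η)
    change ⟪fockUnitary X (A ((fockUnitary X).symm (fockUnitary X η))), ξ⟫_ℂ = 0 at h2
    rw [LinearIsometryEquiv.symm_apply_apply] at h2
    rw [← LinearIsometryEquiv.inner_map_map (fockUnitary X),
      LinearIsometryEquiv.apply_symm_apply, h2]
  refine (Submodule.mem_orthogonal _ _).2 (fun η hη => ?_)
  exact Submodule.mem_orthogonal_singleton_iff_inner_left.1 (h1 hη)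

/-- `U_X` as a bounded operator -/
abbrev UOp (X : PseudoUnitary n) : Fock n →L[ℂ] Fock n := (fockUnitary X : Fock n →L[ℂ] Fock n)

/-- `U_X^*` -/
abbrev UAdj (X : PseudoUnitary n) : Fock n →L[ℂ] Fock n :=
  ((fockUnitary X).symm : Fock n →L[ℂ] Fock n)

/-- `T` is `𝔧`-constrained: `f(T) = 0` for all `f ∈ 𝔧`. -/
def IsConstrained (T : MultiContraction n H) (j : TwoSidedIdeal (discAlgebra n)) : Prop :=
  ∀ f ∈ j, T.calc f = 0

/-- `K_{𝔍,T} = P_{𝒩_𝔍 ⊗ 𝒟_{T^*}} K_T` -/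
def constrainedPoisson (J : Set (Fock n →L[ℂ] Fock n)) (T : MultiContraction n H) :
    H →L[ℂ] tensorSub (coSpace J) T.defectStar :=
  (tensorSub (coSpace J) T.defectStar).orthogonalProjectionOnto ∘L poisson T

/-- `Θ_{𝔍,T} = P_{𝒩_𝔍 ⊗ 𝒟_{T^*}} Θ_T | 𝒩_𝔍 ⊗ 𝒟_T` -/
def constrainedCharFun (J : Set (Fock n →L[ℂ] Fock n)) (T : MultiContraction n H) :
    tensorSub (coSpace J) T.defect →L[ℂ] tensorSub (coSpace J) T.defectStar :=
  (tensorSub (coSpace J) T.defectStar).orthogonalProjectionOnto ∘L charFun T ∘L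
    (tensorSub (coSpace J) T.defect).subtypeL

/-- `Φ_X(𝔧) = {f | Φ_X⁻¹(f) ∈ 𝔧}` -/
def imageIdeal (X : PseudoUnitary n) (j : TwoSidedIdeal (discAlgebra n)) :
    TwoSidedIdeal (discAlgebra n) :=
  j.comap (aut X).symm

/-- The commutator ideal: the smallest norm-closed two-sided ideal that contains all commutators. -/
def commutatorIdeal (n : ℕ) : TwoSidedIdeal (discAlgebra n) :=
  sInf {I | IsClosed (I : Set (discAlgebra n)) ∧ ∀ f g, f * g - g * f ∈ I}

/-- The characteristic function at a point `λ` of the ball (the commutative characteristic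
function), `θ_T(λ) = -T + D_{T^*} (1 - ∑ λ_i T_i^*)⁻¹ [λ_1 I, …, λ_n I] D_T : 𝒟_T → 𝒟_{T^*}`. -/
def symbol (T : MultiContraction n H) (lam : Fin n → ℂ) : T.defect →L[ℂ] T.defectStar :=
  ContinuousLinearMap.codRestrict
    ((-T.row + defectOp (adjoint T.row) ∘L Ring.inverse (1 - ∑ i, lam i • adjoint (T.op i)) ∘L
      rowOp (fun i => lam i • (1 : H →L[ℂ] H)) ∘L defectOp T.row) ∘L T.defect.subtypeL)
    T.defectStar
    (fun k => Submodule.add_mem _ (Submodule.neg_mem _ (map_defectSpace T.norm_row_le k.2))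
      (mem_defectSpace _ _))

/-- The automorphism `φ_X(λ) = (x - λ z^t)⁻¹ (λ X₂₂ - y)` of the unit ball. -/
def ballAut (X : PseudoUnitary n) (lam : Fin n → ℂ) : Fin n → ℂ :=
  fun i => (X.x - ∑ j, lam j * X.z j)⁻¹ * (∑ j, lam j * X.blk j i - X.y i)

/-- `Θ_{T'} = (U_X ⊗ Z_*^*) Θ_T (U_X^* ⊗ Z)` and `K_{T'} = (U_X ⊗ Z_*^*) K_T`. -/
def Transforms (X : PseudoUnitary n) (T T' : MultiContraction n H)
    (Z : T'.defect ≃ₗᵢ[ℂ] T.defect) (Zs : T'.defectStar ≃ₗᵢ[ℂ] T.defectStar) : Prop :=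
  charFun T' = tensorOp (UOp X) (Zs.symm : T.defectStar →L[ℂ] T'.defectStar) ∘L charFun T ∘L
      tensorOp (UAdj X) (Z : T'.defect →L[ℂ] T.defect) ∧
    poisson T' = tensorOp (UOp X) (Zs.symm : T.defectStar →L[ℂ] T'.defectStar) ∘L poisson T

/-- The entries of `T` commute. -/
def IsCommuting (T : MultiContraction n H) : Prop := ∀ i k, T.op i ∘L T.op k = T.op k ∘L T.op i

end Constrained

end

end NCFock

open NCFock

/-! Everything about `T' = Φ_X⁻¹(T)` comes from one linear fractional formula. Put `C = \bar x +
T[\bar y]`, the operator `codenom X T`. The element `\bar x + L[\bar y]` is the preimage under `Φ_X`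
of `(x - L[z])⁻¹`, so `C` is invertible and `C T'_i = \bar z_i + ∑_k \bar X_{ik} T_k`, where
`X_{ik}` are the entries of `X₂₂`. Taking adjoints, the column `(C^* g, T'^* C^* g)` is `X` applied
to the column `(g, T^* g)`. As `X` preserves the form of `J`, `‖C^* g‖² - ‖T'^* C^* g‖² = ‖g‖² -
‖T^* g‖²`. Hence `T'` is a row contraction, and `D_{T^*} g ↦ D_{T'^*} C^* g` extends to the unitary
`Z_*^*`. Dually, `X^*` maps `(-T' p, p)` to `(-T G p, G p)` with `G p = X₂₂^* p - y^* T' p`, and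
`D_{T'} p ↦ D_T G p` extends to `Z`.

The rule for `K_T` follows from the relation `(A^* ⊗ I) K_T = K_T A(T)^*` for all `A` in the algebra
(`poisson_calc`): the vectors `U_X^* e_w` have the form `A e_∅`, so their pairings with `K_T h` are
values of the functional calculus (`poisson_moebius`).

The rule for `Θ_T` is reduced to the one for `K_T`. The characteristic function commutes with all `A
⊗ I` (`charFun_ampLeft`), hence it is determined by its values on `e_∅ ⊗ k`, and these are `-e_∅ ⊗ T
k + ∑_i (L_i ⊗ I) K_T (D_T k)_i` (`charFun_vacuum`). The comparison on the vacuum uses the recursion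
of `K_{T'}` and two identities that express `D_{T'}` and `T'` on the defect space through `Z` and
`Z_*` (`defectOp_moebius`, `rowDefect_moebius`).

The constrained statements hold for arbitrary `Z, Z_*` with `(∗)`, because `U_X ⊗ Z_*^*` intertwines
the projections onto `𝒩_𝔍 ⊗ 𝒟_{T^*}` and `𝒩_{𝔍'} ⊗ 𝒟_{T'^*}`. For the last formula, the vectors `v_λ
= (I - L[\bar λ])⁻¹ e_∅` are joint eigenvectors of the `L_i^*`. Slicing `Θ_T` against `v_λ` gives
`θ_T(λ)`, and `U_X^*` maps `v_λ` to a multiple of the vector at `φ_X(λ)` (`UAdj_kernelVec`). -/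

namespace NCFock

open scoped InnerProductSpace ENNReal

noncomputable section

set_option linter.unusedSectionVars false

/-! ### Tensor products of operators and slices of vectors in `F ⊗ E`. -/

section TensorCalculus

open ContinuousLinearMap

variable {n : ℕ} {E E' E'' V : Type*}
  [NormedAddCommGroup E] [InnerProductSpace ℂ E] [CompleteSpace E]
  [NormedAddCommGroup E'] [InnerProductSpace ℂ E'] [CompleteSpace E']
  [NormedAddCommGroup E''] [InnerProductSpace ℂ E''] [CompleteSpace E'']
  [NormedAddCommGroup V] [NormedSpace ℂ V]

theorem ampRight_tmul (B : E →L[ℂ] E') (ξ : Fock n) (k : E) :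
    ampRight B (tmul ξ k) = tmul ξ (B k) := by
  ext w; simp

theorem slice_tmul (ξ : Fock n) (k k' : E) : slice k' (tmul ξ k) = ⟪k', k⟫_ℂ • ξ := by
  ext w; simp [mul_comm]

theorem ampLeft_tmul (A : Fock n →L[ℂ] Fock n) (ξ : Fock n) (k : E) :
    ampLeft A (tmul ξ k) = tmul (A ξ) k := by
  refine ext_slice (fun k' => ?_)
  rw [slice_ampLeft, slice_tmul, slice_tmul, map_smul]

/-- The expansion `f = ∑_w e_w ⊗ f w` converges in norm, so a bounded operator is determined by its
values on the `e_w ⊗ k`. -/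
theorem ext_tmul {A B : FockTensor n E →L[ℂ] V}
    (h : ∀ w k, A (tmul (e w) k) = B (tmul (e w) k)) : A = B := by
  ext f
  have h0 := lp.hasSum_single (E := fun _ : List (Fin n) => E) (p := 2) (by norm_num) f
  have h1 : ∀ w, lp.single 2 w (f w) = tmul (e w) (f w) := by
    intro w
    ext v
    by_cases hv : v = w
    · subst hv; simp [e_apply]
    · simp [e_apply, hv]
  simp only [h1] at h0
  have hA := h0.mapL A
  have hB := h0.mapL B
  simp only [h] at hA hB
  exact hA.unique hB

theorem inner_tmul_left (ξ : Fock n) (k : E) (f : FockTensor n E) :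
    ⟪tmul ξ k, f⟫_ℂ = ⟪ξ, slice k f⟫_ℂ := by
  rw [lp.inner_eq_tsum, lp.inner_eq_tsum]
  refine tsum_congr (fun w => ?_)
  rw [tmul_apply, inner_smul_left, slice_apply]
  simp [mul_comm]

theorem inner_tmul_e_left (w : List (Fin n)) (k : E) (f : FockTensor n E) :
    ⟪tmul (e w) k, f⟫_ℂ = ⟪k, f w⟫_ℂ := by
  rw [inner_tmul_left, inner_e_left, slice_apply]

theorem tmul_add (ξ : Fock n) (k k' : E) : tmul ξ (k + k') = tmul ξ k + tmul ξ k' := by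
  ext w; simp

theorem ext_inner_tmul {f g : FockTensor n E}
    (h : ∀ w k, ⟪tmul (e w) k, f⟫_ℂ = ⟪tmul (e w) k, g⟫_ℂ) : f = g := by
  ext w
  refine ext_inner_left ℂ (fun k => ?_)
  rw [← inner_tmul_e_left, ← inner_tmul_e_left, h]

theorem inner_tmul_ampLeft (A : Fock n →L[ℂ] Fock n) (ξ : Fock n) (k : E) (f : FockTensor n E) :
    ⟪tmul ξ k, ampLeft A f⟫_ℂ = ⟪tmul (adjoint A ξ) k, f⟫_ℂ := by
  rw [inner_tmul_left, inner_tmul_left, slice_ampLeft, adjoint_inner_left]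

theorem inner_tmul_ampRight (B : E →L[ℂ] E') (ξ : Fock n) (k : E') (f : FockTensor n E) :
    ⟪tmul ξ k, ampRight B f⟫_ℂ = ⟪tmul ξ (adjoint B k), f⟫_ℂ := by
  rw [inner_tmul_left, inner_tmul_left]
  congr 1
  ext w
  simp [adjoint_inner_left]

theorem ampLeft_ampRight (A : Fock n →L[ℂ] Fock n) (B : E →L[ℂ] E') (f : FockTensor n E) :
    ampLeft A (ampRight B f) = ampRight B (ampLeft A f) := by
  have : ampLeft A ∘L ampRight B = ampRight B ∘L ampLeft A :=
    ext_tmul (fun w k => by simp [ampLeft_tmul, ampRight_tmul])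
  exact congrArg (fun D => D f) this

theorem tensorOp_apply (A : Fock n →L[ℂ] Fock n) (B : E →L[ℂ] E') (f : FockTensor n E) :
    tensorOp A B f = ampRight B (ampLeft A f) := rfl

theorem ampLeft_ampLeft (A B : Fock n →L[ℂ] Fock n) (f : FockTensor n E) :
    ampLeft A (ampLeft B f) = ampLeft (A ∘L B) f := by
  rw [ampLeft_comp]; rfl

theorem tensorOp_tensorOp (A A' : Fock n →L[ℂ] Fock n) (B : E →L[ℂ] E') (B' : E' →L[ℂ] E'')
    (f : FockTensor n E) :
    tensorOp A' B' (tensorOp A B f) = tensorOp (A' ∘L A) (B' ∘L B) f := by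
  simp only [tensorOp_apply, ampLeft_ampRight, ampLeft_ampLeft]
  rfl

theorem ampLeft_eq_tensorOp (A : Fock n →L[ℂ] Fock n) (f : FockTensor n E) :
    ampLeft A f = tensorOp A (ContinuousLinearMap.id ℂ E) f := by
  ext w; rfl

theorem inner_tmul_tensorOp (A : Fock n →L[ℂ] Fock n) (B : E →L[ℂ] E') (ξ : Fock n) (k : E')
    (f : FockTensor n E) :
    ⟪tmul ξ k, tensorOp A B f⟫_ℂ = ⟪tmul (adjoint A ξ) (adjoint B k), f⟫_ℂ := by
  rw [tensorOp_apply, inner_tmul_ampRight, inner_tmul_ampLeft]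

/-- `f ↦ (⟨ξ, ·⟩ ⊗ I) f`, the adjoint of `k ↦ ξ ⊗ k`. -/
def leftSlice (ξ : Fock n) : FockTensor n E →L[ℂ] E :=
  adjoint (LinearMap.mkContinuous
    { toFun := fun k : E => tmul ξ k
      map_add' := fun k k' => by ext w; simp
      map_smul' := fun c k => by
        ext w
        rw [tmul_apply]
        exact smul_comm _ _ _ } ‖ξ‖ (fun k => by
        -- The bound `‖ξ ⊗ k‖ ≤ ‖ξ‖ ‖k‖`, since `ξ ⊗ k` is by definition the image of `ξ` under an
        -- operator of norm at most `‖k‖`.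
        refine (le_opNorm (ampRight (toSpanSingleton ℂ k)) ξ).trans ?_
        rw [mul_comm]
        refine mul_le_mul_of_nonneg_left ?_ (norm_nonneg _)
        refine (ofCoords_norm_le _ _ _).trans ?_
        simp))

theorem inner_leftSlice (ξ : Fock n) (k : E) (f : FockTensor n E) :
    ⟪k, leftSlice ξ f⟫_ℂ = ⟪tmul ξ k, f⟫_ℂ := by
  rw [leftSlice, adjoint_inner_right]
  rfl

theorem leftSlice_tmul (ξ η : Fock n) (k : E) : leftSlice ξ (tmul η k) = ⟪ξ, η⟫_ℂ • k := by
  refine ext_inner_left ℂ (fun k' => ?_)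
  rw [inner_leftSlice, inner_tmul_left, slice_tmul, inner_smul_right, inner_smul_right, mul_comm]

/-- The first tensor factor moves onto the slicing vector. In this way `U_X` comes to act on the
kernel vectors. -/
theorem leftSlice_tensorOp (ξ : Fock n) (A : Fock n →L[ℂ] Fock n) (B : E →L[ℂ] E')
    (f : FockTensor n E) : leftSlice ξ (tensorOp A B f) = B (leftSlice (adjoint A ξ) f) := by
  refine ext_inner_left ℂ (fun k => ?_)
  rw [inner_leftSlice, inner_tmul_tensorOp, ← inner_leftSlice, adjoint_inner_left]

theorem leftSlice_ampLeft (ξ : Fock n) (A : Fock n →L[ℂ] Fock n) (f : FockTensor n E) :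
    leftSlice ξ (ampLeft A f) = leftSlice (adjoint A ξ) f := by
  rw [ampLeft_eq_tensorOp, leftSlice_tensorOp]; rfl

theorem leftSlice_smul (c : ℂ) (ξ : Fock n) (f : FockTensor n E) :
    leftSlice (c • ξ) f = star c • leftSlice ξ f := by
  refine ext_inner_left ℂ (fun k => ?_)
  rw [inner_smul_right, inner_leftSlice, inner_leftSlice, inner_tmul_left, inner_tmul_left,
    inner_smul_left]
  rfl

theorem ampLeft_creation_nil (i : Fin n) (f : FockTensor n E) :
    ampLeft (creation i) f [] = 0 := by
  refine ext_inner_left ℂ (fun k => ?_)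
  rw [inner_ampLeft, creation_nil, inner_zero_right]

theorem ampLeft_creation_cons (i j : Fin n) (w : List (Fin n)) (f : FockTensor n E) :
    ampLeft (creation i) f (j :: w) = if j = i then f w else 0 := by
  refine ext_inner_left ℂ (fun k => ?_)
  rw [inner_ampLeft, creation_cons, slice_apply]
  split_ifs <;> simp

end TensorCalculus

/-! ### Density of the polynomials in the algebra. -/

section DiscAlgebra

variable {n : ℕ}

/-- A closed subalgebra that contains the generators is everything. -/
theorem discAlgebra_induction {S : Subalgebra ℂ (discAlgebra n)}
    (hS : IsClosed (S : Set (discAlgebra n))) (h : ∀ i, leftGen i ∈ S) (f : discAlgebra n) :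
    f ∈ S := by
  have h0 : ∀ f (hf : f ∈ Algebra.adjoin ℂ (Set.range (creation (n := n)))),
      (⟨f, Subalgebra.le_topologicalClosure _ hf⟩ : discAlgebra n) ∈ S := by
    intro f hf
    induction hf using Algebra.adjoin_induction with
    | mem f hf => obtain ⟨i, rfl⟩ := hf; exact h i
    | algebraMap c => exact S.algebraMap_mem c
    | add f g hf hg h1 h2 => exact S.add_mem h1 h2
    | mul f g hf hg h1 h2 => exact S.mul_mem h1 h2
  have hf : f ∈ closure (S : Set (discAlgebra n)) := by
    -- Closures in the subtype are computed among all operators, where `f` lies in the closure of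
    -- the polynomials by definition of `discAlgebra n`.
    have hsub : (Algebra.adjoin ℂ (Set.range (creation (n := n))) :
        Set (Fock n →L[ℂ] Fock n)) ⊆ Subtype.val '' (S : Set (discAlgebra n)) :=
      fun g hg => ⟨⟨g, Subalgebra.le_topologicalClosure _ hg⟩, h0 g hg, rfl⟩
    exact closure_subtype.2 (closure_mono hsub f.2)
  exact hS.closure_subset hf

end DiscAlgebra

/-! ### Intertwining properties of the Poisson kernel and the characteristic function. -/

section PoissonCharFun

open ContinuousLinearMap

variable {n : ℕ} {H : Type*} [NormedAddCommGroup H] [InnerProductSpace ℂ H] [CompleteSpace H]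
  (T : MultiContraction n H)

/-- `D_{T^*}` as an operator into its defect space. -/
def dStar : H →L[ℂ] T.defectStar :=
  (defectOp (adjoint T.row)).codRestrict _ (mem_defectSpace (adjoint T.row))

/-- `D_T` as an operator into its defect space. -/
def dRow : Pow n H →L[ℂ] T.defect :=
  (defectOp T.row).codRestrict _ (mem_defectSpace T.row)

/-- `T` as an operator between the defect spaces. -/
def rowDefect : T.defect →L[ℂ] T.defectStar :=
  (T.row ∘L T.defect.subtypeL).codRestrict _ (fun k => map_defectSpace T.norm_row_le k.2)

@[simp] theorem coe_dStar (h : H) : (dStar T h : H) = defectOp (adjoint T.row) h := rfl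

@[simp] theorem coe_dRow (p : Pow n H) : (dRow T p : Pow n H) = defectOp T.row p := rfl

@[simp] theorem coe_rowDefect (k : T.defect) : (rowDefect T k : H) = T.row k := rfl

theorem denseRange_dStar : DenseRange (dStar T) := by
  rw [DenseRange, Subtype.dense_iff]
  intro x hx
  rw [← Set.range_comp]
  exact hx

theorem denseRange_dRow : DenseRange (dRow T) := by
  rw [DenseRange, Subtype.dense_iff]
  intro x hx
  rw [← Set.range_comp]
  exact hx

theorem word_cons (i : Fin n) (w : List (Fin n)) : T.word (i :: w) = T.op i ∘L T.word w := by
  simp [MultiContraction.word, ContinuousLinearMap.mul_def]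

theorem sum_coord {E : Type*} [NormedAddCommGroup E] {ι : Type*} (s : Finset ι)
    (f : ι → FockTensor n E) (w : List (Fin n)) : (∑ i ∈ s, f i) w = ∑ i ∈ s, f i w := by
  classical
  induction s using Finset.induction_on with
  | empty => simp
  | insert i s hi ih => rw [Finset.sum_insert hi, Finset.sum_insert hi, ← ih]; rfl

theorem poisson_nil (h : H) : poisson T h [] = dStar T h := by
  ext; rw [poisson_apply, adjoint_word_nil]; rfl

theorem poisson_cons (h : H) (i : Fin n) (w : List (Fin n)) :
    poisson T h (i :: w) = poisson T (adjoint (T.op i) h) w := by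
  ext; rw [poisson_apply, poisson_apply, word_cons, adjoint_comp]; rfl

/-- Splits off the first letter of the word, using `T_{jw}^* = T_w^* T_j^*`. -/
theorem poisson_recursion (h : H) :
    poisson T h = tmul (e []) (dStar T h) +
      ∑ j, ampLeft (creation j) (poisson T (adjoint (T.op j) h)) := by
  ext1
  funext w
  rw [lp.coeFn_add, Pi.add_apply, sum_coord, tmul_apply]
  cases w with
  | nil => simp [poisson_nil, ampLeft_creation_nil, e_apply]
  | cons j w => simp [poisson_cons, ampLeft_creation_cons, e_apply]

/-- For the input `e_∅ ⊗ k` the state at the word `j w` reduces to `T_w^* (D_T k)_j`. Applying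
`D_{T^*}` gives a coordinate of `K_T (D_T k)_j`. So the first column of `Θ_T` is built from the
Poisson kernel. -/
theorem charFun_vacuum (k : T.defect) :
    charFun T (tmul (e []) k) = -tmul (e []) (rowDefect T k) +
      ∑ i, ampLeft (creation i) (poisson T ((defectOp T.row (k : Pow n H)) i)) := by
  ext1
  funext w
  rw [lp.coeFn_add, Pi.add_apply, sum_coord, lp.coeFn_neg, Pi.neg_apply, tmul_apply]
  ext1
  rw [charFun_apply]
  cases w with
  | nil => simp [ampLeft_creation_nil, e_apply]
  | cons j w =>
    rw [show (∑ m : Fin (j :: w).length, adjoint (T.word ((j :: w).drop (m + 1)))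
        (defectOp T.row (tmul (e []) k ((j :: w).take m) : T.defect) (j :: w)[m])) =
        adjoint (T.word w) (defectOp T.row (k : Pow n H) j) from ?_]
    · simp only [ampLeft_creation_cons, e_apply, tmul_apply]
      simp [poisson_apply]
    -- The input lives on the empty word, and `take m` is empty for `m = 0` only.
    · refine (Fin.sum_univ_succ (n := w.length) _).trans ?_
      rw [Finset.sum_eq_zero]
      · simp [e_apply]
        rfl
      · intro m _
        simp [e_apply]

/-- `Θ_T` is a series in right creation operators, which commute with the left ones. In coordinates,
a letter in front shifts the splitting positions by one, and the new term at position `0` vanishes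
because `(L_i ⊗ I) f` vanishes at the empty word. -/
theorem charFun_creation (i : Fin n) (f : FockTensor n T.defect) :
    charFun T (ampLeft (creation i) f) = ampLeft (creation i) (charFun T f) := by
  ext1
  funext w
  ext1
  rw [charFun_apply]
  cases w with
  | nil => simp [ampLeft_creation_nil]
  | cons j w =>
    rw [ampLeft_creation_cons, ampLeft_creation_cons]
    rw [show (∑ m : Fin (j :: w).length, adjoint (T.word ((j :: w).drop (m + 1)))
        (defectOp T.row (ampLeft (creation i) f ((j :: w).take m) : T.defect) (j :: w)[m])) =
        if j = i then ∑ m : Fin w.length, adjoint (T.word (w.drop (m + 1)))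
        (defectOp T.row (f (w.take m)) w[m]) else 0 from ?_]
    · by_cases h : j = i
      · simp only [if_pos h, charFun_apply]
      · simp [if_neg h]
    · refine (Fin.sum_univ_succ (n := w.length) _).trans ?_
      by_cases h : j = i
      · simp [ampLeft_creation_nil, ampLeft_creation_cons, h]
      · simp [ampLeft_creation_nil, ampLeft_creation_cons, h]

/-- The map is linear in `A` and bounded by `‖f‖ ‖A‖`. It makes the subalgebras in the next two
density arguments closed. -/
theorem continuous_ampLeft {E : Type*} [NormedAddCommGroup E] [InnerProductSpace ℂ E]
    [CompleteSpace E] (f : FockTensor n E) :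
    Continuous fun A : Fock n →L[ℂ] Fock n => ampLeft A f := by
  have hs : ∀ (c : ℂ) (A : Fock n →L[ℂ] Fock n), ampLeft (c • A) f = c • ampLeft A f :=
    fun c A => ext_slice (fun k => by simp [slice_ampLeft])
  have ha : ∀ (A B : Fock n →L[ℂ] Fock n), ampLeft (A + B) f = ampLeft A f + ampLeft B f :=
    fun A B => by rw [ampLeft_add]; rfl
  let φ : (Fock n →L[ℂ] Fock n) →ₗ[ℂ] FockTensor n E :=
    { toFun := fun A => ampLeft A f
      map_add' := ha
      map_smul' := hs }
  exact (φ.mkContinuous ‖f‖ (fun A => by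
    refine (le_opNorm (ampLeft A) f).trans ?_
    rw [mul_comm]
    exact mul_le_mul_of_nonneg_left (norm_ampLeft_le A) (norm_nonneg _))).continuous

/-- The elements `A` with this property form a closed subalgebra that contains the generators by
`charFun_creation`. -/
theorem charFun_ampLeft (A : discAlgebra n) (f : FockTensor n T.defect) :
    charFun T (ampLeft (A : Fock n →L[ℂ] Fock n) f) =
      ampLeft (A : Fock n →L[ℂ] Fock n) (charFun T f) := by
  let S : Subalgebra ℂ (discAlgebra n) :=
    { carrier := {A | ∀ f, charFun T (ampLeft (A : Fock n →L[ℂ] Fock n) f) =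
        ampLeft (A : Fock n →L[ℂ] Fock n) (charFun T f)}
      mul_mem' := fun {A B} hA hB f => by
        change charFun T (ampLeft ((A : Fock n →L[ℂ] Fock n) ∘L B) f) =
          ampLeft ((A : Fock n →L[ℂ] Fock n) ∘L B) (charFun T f)
        rw [← ampLeft_ampLeft, hA, hB, ampLeft_ampLeft]
      add_mem' := fun {A B} hA hB f => by
        change charFun T (ampLeft ((A : Fock n →L[ℂ] Fock n) + (B : Fock n →L[ℂ] Fock n)) f) =
          ampLeft ((A : Fock n →L[ℂ] Fock n) + (B : Fock n →L[ℂ] Fock n)) (charFun T f)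
        rw [ampLeft_add, ampLeft_add, add_apply, add_apply, map_add, hA, hB]
      algebraMap_mem' := fun c f => by
        change charFun T (ampLeft (algebraMap ℂ (Fock n →L[ℂ] Fock n) c) f) =
          ampLeft (algebraMap ℂ (Fock n →L[ℂ] Fock n) c) (charFun T f)
        rw [Algebra.algebraMap_eq_smul_one, ampLeft_smul_one, ampLeft_smul_one, map_smul] }
  have hS : IsClosed (S : Set (discAlgebra n)) := by
    have : (S : Set (discAlgebra n)) = ⋂ f, {A : discAlgebra n |
        charFun T (ampLeft (A : Fock n →L[ℂ] Fock n) f) =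
        ampLeft (A : Fock n →L[ℂ] Fock n) (charFun T f)} := by
      ext A; simp [S]
    rw [this]
    refine isClosed_iInter (fun f => isClosed_eq ?_ ?_)
    · exact (charFun T).continuous.comp ((continuous_ampLeft f).comp continuous_subtype_val)
    · exact (continuous_ampLeft _).comp continuous_subtype_val
  exact discAlgebra_induction hS (fun i f => charFun_creation T i f) A f

theorem continuous_calc : Continuous T.calc :=
  AddMonoidHomClass.continuous_of_bound T.calc 1 (fun f => by rw [one_mul]; exact norm_calc_le T f)

/-- On generators this is `poisson_cons`. Both sides reverse products and are continuous in `A`, so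
the elements with this property form a closed subalgebra. -/
theorem poisson_calc (A : discAlgebra n) (h : H) :
    ampLeft (adjoint (A : Fock n →L[ℂ] Fock n)) (poisson T h) =
      poisson T (adjoint (T.calc A) h) := by
  have hstar : ∀ c, adjoint (T.calc (algebraMap ℂ (discAlgebra n) c)) = star c • 1 := fun c => by
    rw [AlgHom.commutes, adjoint_algebraMap]
  let S : Subalgebra ℂ (discAlgebra n) :=
    { carrier := {A | ∀ h, ampLeft (adjoint (A : Fock n →L[ℂ] Fock n)) (poisson T h) =
        poisson T (adjoint (T.calc A) h)}
      mul_mem' := fun {A B} hA hB h => by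
        change ampLeft (adjoint ((A : Fock n →L[ℂ] Fock n) ∘L B)) (poisson T h) = _
        rw [map_mul, ContinuousLinearMap.mul_def, adjoint_comp, adjoint_comp, ← ampLeft_ampLeft,
          hA, hB]
        rfl
      add_mem' := fun {A B} hA hB h => by
        change ampLeft (adjoint ((A : Fock n →L[ℂ] Fock n) + (B : Fock n →L[ℂ] Fock n))) (poisson T h) = _
        rw [map_add, ampLeft_add, add_apply, hA, hB, map_add, map_add, add_apply, map_add]
      algebraMap_mem' := fun c h => by
        rw [hstar]
        change ampLeft (adjoint (algebraMap ℂ (Fock n →L[ℂ] Fock n) c)) (poisson T h) = _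
        rw [adjoint_algebraMap, ampLeft_smul_one, smul_apply, one_apply_eq_self, map_smul] }
  have hS : IsClosed (S : Set (discAlgebra n)) := by
    have : (S : Set (discAlgebra n)) = ⋂ h, {A : discAlgebra n |
        ampLeft (adjoint (A : Fock n →L[ℂ] Fock n)) (poisson T h) =
        poisson T (adjoint (T.calc A) h)} := by
      ext A; simp [S]
    rw [this]
    refine isClosed_iInter (fun h => isClosed_eq ?_ ?_)
    · exact (continuous_ampLeft _).comp
        ((adjoint (𝕜 := ℂ) (E := Fock n) (F := Fock n)).continuous.comp continuous_subtype_val)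
    · exact (poisson T).continuous.comp
        ((ContinuousLinearMap.apply ℂ H h).continuous.comp
          ((adjoint (𝕜 := ℂ) (E := H) (F := H)).continuous.comp (continuous_calc T)))
  refine discAlgebra_induction hS (fun i h => ?_) A h
  rw [calc_leftGen]
  ext1
  funext w
  change ampLeft (adjoint (creation i)) (poisson T h) w = _
  rw [ampLeft_adjoint_creation, poisson_cons]

end PoissonCharFun

/-! ### The indefinite form of `J` on columns of Hilbert space vectors. -/

section MatrixAction

variable {n : ℕ} {K : Type*} [NormedAddCommGroup K] [InnerProductSpace ℂ K]

/-- The action of a scalar matrix on columns of vectors. -/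
def matAct (M : Matrix (Unit ⊕ Fin n) (Unit ⊕ Fin n) ℂ) (h : Unit ⊕ Fin n → K) :
    Unit ⊕ Fin n → K := fun p => ∑ q, M p q • h q

theorem matAct_mul (M N : Matrix (Unit ⊕ Fin n) (Unit ⊕ Fin n) ℂ) (h : Unit ⊕ Fin n → K) :
    matAct (M * N) h = matAct M (matAct N h) := by
  funext p
  simp only [matAct, Matrix.mul_apply, Finset.sum_smul, Finset.smul_sum, smul_smul]
  exact Finset.sum_comm

theorem matAct_signature (h : Unit ⊕ Fin n → K) :
    matAct (signature n) h = Sum.elim (fun _ => -h (.inl ())) (fun i => h (.inr i)) := by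
  funext p
  cases p with
  | inl u => simp [matAct, signature, Fintype.sum_sum_type]
  | inr i => simp [matAct, signature, Fintype.sum_sum_type, Matrix.one_apply]

theorem matAct_inl (M : Matrix (Unit ⊕ Fin n) (Unit ⊕ Fin n) ℂ) (a : K) (b : Fin n → K) :
    matAct M (Sum.elim (fun _ => a) b) (.inl ()) =
      M (.inl ()) (.inl ()) • a + ∑ i, M (.inl ()) (.inr i) • b i := by
  simp [matAct, Fintype.sum_sum_type]

theorem matAct_inr (M : Matrix (Unit ⊕ Fin n) (Unit ⊕ Fin n) ℂ) (a : K) (b : Fin n → K)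
    (k : Fin n) :
    matAct M (Sum.elim (fun _ => a) b) (.inr k) =
      M (.inr k) (.inl ()) • a + ∑ i, M (.inr k) (.inr i) • b i := by
  simp [matAct, Fintype.sum_sum_type]

/-- Matrices in `U(1,n)` preserve the indefinite form on columns of vectors. -/
theorem indef_norm (X : PseudoUnitary n) (h : Unit ⊕ Fin n → K) :
    - ‖matAct X.mat h (.inl ())‖ ^ 2 + ∑ j, ‖matAct X.mat h (.inr j)‖ ^ 2 =
      - ‖h (.inl ())‖ ^ 2 + ∑ j, ‖h (.inr j)‖ ^ 2 := by
  have h1 : ∀ p, ((‖matAct X.mat h p‖ ^ 2 : ℝ) : ℂ) =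
      ∑ q, ∑ q', star (X.mat p q) * X.mat p q' * ⟪h q, h q'⟫_ℂ := by
    intro p
    rw [Complex.ofReal_pow]
    rw [← RCLike.ofReal_eq_complex_ofReal, ← inner_self_eq_norm_sq_to_K, matAct, sum_inner]
    refine Finset.sum_congr rfl (fun q _ => ?_)
    rw [inner_sum]
    refine Finset.sum_congr rfl (fun q' _ => ?_)
    rw [inner_smul_left, inner_smul_right, starRingEnd_apply]; ring
  -- The coefficient of `⟪h q, h q'⟫` is the `(q, q')` entry of `X^* J X`.
  have h2 : ∀ q, -∑ q', star (X.mat (.inl ()) q) * X.mat (.inl ()) q' * ⟪h q, h q'⟫_ℂ +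
      ∑ j, ∑ q', star (X.mat (.inr j) q) * X.mat (.inr j) q' * ⟪h q, h q'⟫_ℂ =
      ∑ q', signature n q q' * ⟪h q, h q'⟫_ℂ := by
    intro q
    rw [Finset.sum_comm, ← Finset.sum_neg_distrib, ← Finset.sum_add_distrib]
    refine Finset.sum_congr rfl (fun q' _ => ?_)
    rw [← X.col_rel q q', add_mul, Finset.sum_mul]
    ring
  have hn : ∀ v : K, ((‖v‖ ^ 2 : ℝ) : ℂ) = ⟪v, v⟫_ℂ := fun v => by
    rw [inner_self_eq_norm_sq_to_K]; simp
  apply Complex.ofReal_injective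
  rw [Complex.ofReal_add, Complex.ofReal_neg, Complex.ofReal_sum, Complex.ofReal_add,
    Complex.ofReal_neg, Complex.ofReal_sum]
  simp only [h1, hn]
  rw [Finset.sum_comm (s := (Finset.univ : Finset (Fin n))), ← Finset.sum_neg_distrib,
    ← Finset.sum_add_distrib]
  simp only [h2]
  simp [Fintype.sum_sum_type, signature, Matrix.one_apply]

/-- `X^*` as an element of `U(1,n)`. -/
def PseudoUnitary.adj (X : PseudoUnitary n) : PseudoUnitary n :=
  ⟨X.mat.conjTranspose, by rw [Matrix.conjTranspose_conjTranspose]; exact X.mul_conj⟩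

end MatrixAction

/-! ### The row contraction `Φ_X⁻¹(T)` and its defect norms. -/

section Moebius

open ContinuousLinearMap

variable {n : ℕ} {H : Type*} [NormedAddCommGroup H] [InnerProductSpace ℂ H] [CompleteSpace H]
  (X : PseudoUnitary n) (T : MultiContraction n H)

/-- `x I - L[z]` as an element of the algebra. -/
def denomElt : discAlgebra n :=
  ⟨denom X, Subalgebra.sub_mem _ (Subalgebra.algebraMap_mem _ _) (linComb_mem _)⟩

/-- The element `\bar x I + L[\bar y]`, whose image under `Φ_X` is `(x I - L[z])⁻¹`. -/
def codenomElt : discAlgebra n :=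
  algebraMap ℂ _ (star X.x) + ∑ k, star (X.y k) • leftGen k

theorem aut_leftGen_comb (c : ℂ) (a : Fin n → ℂ) :
    (aut X (algebraMap ℂ _ c + ∑ k, a k • leftGen k) : Fock n →L[ℂ] Fock n) =
      algebraMap ℂ _ c + ∑ k, a k • gen X k := by
  rw [map_add, map_sum, AlgEquiv.commutes]
  simp only [map_smul]
  rw [Subalgebra.coe_add, AddSubmonoidClass.coe_finsetSum]
  congr 1
  refine Finset.sum_congr rfl (fun k _ => ?_)
  rw [Subalgebra.coe_smul, aut_coe]
  congr 1
  exact conjAut_creation X k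

theorem denomElt_mul_aut : denomElt X * aut X (codenomElt X) = 1 := by
  ext1
  rw [Subalgebra.coe_mul, codenomElt, aut_leftGen_comb]
  exact denom_mul_eq_one X

theorem _root_.IsUnit.mul_eq_one_symm {M : Type*} [Monoid M] {a b : M} (ha : IsUnit a)
    (h : a * b = 1) : b * a = 1 := by
  obtain ⟨u, rfl⟩ := ha
  calc b * u = (↑u⁻¹ * u) * b * u := by rw [u.inv_mul, one_mul]
    _ = 1 := by rw [mul_assoc (↑u⁻¹ : M), h, mul_one, u.inv_mul]

theorem aut_mul_denomElt : aut X (codenomElt X) * denomElt X = 1 :=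
  Subtype.ext ((denom_spec X).1.mul_eq_one_symm (congrArg Subtype.val (denomElt_mul_aut X)))

theorem mul_codenomElt : (aut X).symm (denomElt X) * codenomElt X = 1 := by
  apply (aut X).injective
  rw [map_mul, AlgEquiv.apply_symm_apply, denomElt_mul_aut, map_one]

/-- Under `Φ_X` both sides become `(x - L[z])⁻¹ L_i`, by `denom_mul_eq_creation`. So `Φ_X⁻¹(L_i)` is
a linear fraction whose coefficients are the conjugated entries of `X`. -/
theorem codenomElt_mul_symm_leftGen (i : Fin n) :
    codenomElt X * (aut X).symm (leftGen i) =
      algebraMap ℂ _ (star (X.z i)) + ∑ k, star (X.blk i k) • leftGen k := by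
  apply (aut X).injective
  have h : leftGen i = denomElt X *
      aut X (algebraMap ℂ _ (star (X.z i)) + ∑ k, star (X.blk i k) • leftGen k) := by
    ext1
    rw [Subalgebra.coe_mul, aut_leftGen_comb]
    exact (denom_mul_eq_creation X i).symm
  rw [map_mul, AlgEquiv.apply_symm_apply]
  conv_lhs => rw [h]
  rw [← mul_assoc, aut_mul_denomElt, one_mul]

/-- `\bar x I + T[\bar y]`. -/
def codenom : H →L[ℂ] H := T.calc (codenomElt X)

/-- The inverse of `\bar x I + T[\bar y]`. -/
def codenomInv : H →L[ℂ] H := T.calc ((aut X).symm (denomElt X))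

/-- The entries of `Φ_X⁻¹(T)`. -/
def moebiusOp (i : Fin n) : H →L[ℂ] H := T.calc ((aut X).symm (leftGen i))

theorem calc_comb (c : ℂ) (a : Fin n → ℂ) :
    T.calc (algebraMap ℂ _ c + ∑ k, a k • leftGen k) = c • 1 + ∑ k, a k • T.op k := by
  rw [map_add, map_sum, AlgHom.commutes, Algebra.algebraMap_eq_smul_one]
  simp only [map_smul, calc_leftGen]

theorem codenomInv_comp : codenomInv X T ∘L codenom X T = 1 := by
  change T.calc _ * T.calc _ = 1
  rw [← map_mul, mul_codenomElt, map_one]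

theorem codenom_eq : codenom X T = star X.x • 1 + ∑ k, star (X.y k) • T.op k := calc_comb T _ _

theorem codenom_comp_moebiusOp (i : Fin n) :
    codenom X T ∘L moebiusOp X T i = star (X.z i) • 1 + ∑ k, star (X.blk i k) • T.op k := by
  change T.calc _ * T.calc _ = _
  rw [← map_mul, codenomElt_mul_symm_leftGen, calc_comb]

theorem codenom_apply (h : H) :
    codenom X T h = star X.x • h + ∑ k, star (X.y k) • T.op k h := by
  rw [codenom_eq]; simp

theorem codenom_moebiusOp_apply (i : Fin n) (h : H) :
    codenom X T (moebiusOp X T i h) = star (X.z i) • h + ∑ k, star (X.blk i k) • T.op k h := by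
  rw [← comp_apply, codenom_comp_moebiusOp]; simp

theorem adjoint_comb (c : ℂ) (a : Fin n → ℂ) (g : H) :
    adjoint (star c • (1 : H →L[ℂ] H) + ∑ k, star (a k) • T.op k) g =
      c • g + ∑ k, a k • adjoint (T.op k) g := by
  refine ext_inner_right ℂ (fun h => ?_)
  rw [adjoint_inner_left]
  simp [inner_add_left, inner_add_right, inner_smul_left, inner_smul_right, sum_inner, inner_sum,
    adjoint_inner_left]

theorem adjoint_codenom_apply (g : H) :
    adjoint (codenom X T) g = X.x • g + ∑ k, X.y k • adjoint (T.op k) g := by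
  rw [codenom_eq, adjoint_comb]

/-- Together with `adjoint_codenom_apply` this says that the column of `C^* g` and the `T'_i^* C^*
g` is `X` applied to the column of `g` and the `T_k^* g`, where `C = codenom X T`. -/
theorem adjoint_moebiusOp_codenom (i : Fin n) (g : H) :
    adjoint (moebiusOp X T i) (adjoint (codenom X T) g) =
      X.z i • g + ∑ k, X.blk i k • adjoint (T.op k) g := by
  rw [← comp_apply, ← adjoint_comp, codenom_comp_moebiusOp, adjoint_comb]

/-- A left inverse of `C` becomes a right inverse of `C^*`. Hence every vector has the form `C^* g`,
and identities for `T'^*` may be checked on such vectors. -/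
theorem adjoint_codenom_surj (h : H) : adjoint (codenom X T) (adjoint (codenomInv X T) h) = h := by
  rw [← comp_apply, ← adjoint_comp, codenomInv_comp]
  have : adjoint (1 : H →L[ℂ] H) = 1 := star_one _
  simp [this]

/-- This is `indef_norm` for the column of `g` and the `T_k^* g`. -/
theorem moebius_norm_adjoint (g : H) :
    - ‖adjoint (codenom X T) g‖ ^ 2 +
        ∑ i, ‖adjoint (moebiusOp X T i) (adjoint (codenom X T) g)‖ ^ 2 =
      - ‖g‖ ^ 2 + ∑ i, ‖adjoint (T.op i) g‖ ^ 2 := by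
  have h := indef_norm X (Sum.elim (fun _ => g) (fun k => adjoint (T.op k) g))
  simp only [matAct_inl, matAct_inr, Sum.elim_inl, Sum.elim_inr] at h
  rw [← h, adjoint_codenom_apply]
  simp only [← adjoint_codenom_apply, adjoint_moebiusOp_codenom]
  rw [adjoint_codenom_apply]
  rfl

/-- The row contraction `Φ_X⁻¹(T)`. -/
def moebius : MultiContraction n H where
  op := moebiusOp X T
  contr := by
    rw [contr_iff]
    intro h
    -- With `h = C^* g` the form at `(h, T'^* h)` equals the form at `(g, T^* g)`, which is
    -- nonpositive because `T` is a row contraction.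
    have h1 := moebius_norm_adjoint X T (adjoint (codenomInv X T) h)
    rw [adjoint_codenom_surj] at h1
    have h2 := (contr_iff _).1 T.contr (adjoint (codenomInv X T) h)
    linarith

theorem norm_adjoint_row_sq (S : MultiContraction n H) (h : H) :
    ‖adjoint S.row h‖ ^ 2 = ∑ i, ‖adjoint (S.op i) h‖ ^ 2 := by
  rw [PiLp.norm_sq_eq_of_L2]
  simp only [adjoint_rowOp_apply]

theorem norm_dStar_sq (S : MultiContraction n H) (h : H) :
    ‖dStar S h‖ ^ 2 = ‖h‖ ^ 2 - ‖adjoint S.row h‖ ^ 2 := by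
  rw [Submodule.coe_norm, coe_dStar, norm_defectOp_sq (by simpa using S.norm_row_le)]

theorem norm_dRow_sq (S : MultiContraction n H) (p : Pow n H) :
    ‖dRow S p‖ ^ 2 = ‖p‖ ^ 2 - ‖S.row p‖ ^ 2 := by
  rw [Submodule.coe_norm, coe_dRow, norm_defectOp_sq S.norm_row_le]

/-- The number `‖D_{T^*} g‖²` is the negative of the form at `(g, T^* g)`. This isometry defines
`defectStarUnitary`. -/
theorem norm_dStar_moebius (g : H) :
    ‖dStar (moebius X T) (adjoint (codenom X T) g)‖ = ‖dStar T g‖ := by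
  refine (sq_eq_sq₀ (norm_nonneg _) (norm_nonneg _)).1 ?_
  rw [norm_dStar_sq, norm_dStar_sq, norm_adjoint_row_sq, norm_adjoint_row_sq]
  have := moebius_norm_adjoint X T g
  change - _ + ∑ i, ‖adjoint ((moebius X T).op i) _‖ ^ 2 = _ at this
  linarith

/-- The operator `p ↦ X_{22}^* p - y^* T' p` on `H^n`. -/
def colOp : Pow n H →L[ℂ] Pow n H :=
  ((PiLp.continuousLinearEquiv 2 ℂ (fun _ : Fin n => H)).symm : (Fin n → H) →L[ℂ] Pow n H) ∘L
    ContinuousLinearMap.pi (fun k =>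
      ∑ i, star (X.blk i k) • PiLp.proj 2 (fun _ : Fin n => H) i -
        star (X.y k) • (moebius X T).row)

theorem colOp_apply (p : Pow n H) (k : Fin n) :
    colOp X T p k = ∑ i, star (X.blk i k) • p i - star (X.y k) • (moebius X T).row p := by
  simp [colOp]

theorem codenom_row_moebius (p : Pow n H) :
    codenom X T ((moebius X T).row p) =
      ∑ i, star (X.z i) • p i + ∑ k, ∑ i, star (X.blk i k) • T.op k (p i) := by
  rw [rowOp_apply, map_sum]
  rw [Finset.sum_comm, ← Finset.sum_add_distrib]
  exact Finset.sum_congr rfl (fun i _ => codenom_moebiusOp_apply X T i (p i))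

/-- `X^*` carries the vectors `(-T' p, p)` to vectors of the same kind for `T`. The lower
coordinates are the definition of `colOp`; the first one is `codenom_row_moebius`, rearranged. -/
theorem matAct_adj_colOp (p : Pow n H) :
    matAct X.adj.mat (Sum.elim (fun _ => -(moebius X T).row p) (fun i => p i)) =
      Sum.elim (fun _ => -T.row (colOp X T p)) (fun i => colOp X T p i) := by
  funext q
  cases q with
  | inl u =>
    rw [matAct_inl, Sum.elim_inl, rowOp_apply T.op]
    have h1 := codenom_row_moebius X T p
    rw [codenom_apply] at h1
    simp only [colOp_apply, map_sub, map_sum, map_smul, Finset.sum_sub_distrib]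
    change star X.x • _ + ∑ i, star (X.z i) • p i = _
    rw [smul_neg]
    rw [← sub_eq_zero] at h1 ⊢
    rw [← neg_eq_zero, ← h1]
    abel
  | inr k =>
    rw [matAct_inr, Sum.elim_inr, colOp_apply]
    change star (X.y k) • _ + ∑ i, star (X.blk i k) • p i = _
    rw [smul_neg]
    abel

/-- The matrix `X^*` preserves the form, whose value at `(-T p, p)` is `‖D_T p‖²`. -/
theorem norm_dRow_colOp (p : Pow n H) : ‖dRow T (colOp X T p)‖ = ‖dRow (moebius X T) p‖ := by
  refine (sq_eq_sq₀ (norm_nonneg _) (norm_nonneg _)).1 ?_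
  rw [norm_dRow_sq, norm_dRow_sq, PiLp.norm_sq_eq_of_L2, PiLp.norm_sq_eq_of_L2]
  have h := indef_norm X.adj (Sum.elim (fun _ => -(moebius X T).row p) (fun i => p i))
  rw [matAct_adj_colOp] at h
  simp only [Sum.elim_inl, Sum.elim_inr, norm_neg] at h
  linarith

/-- Inverts `matAct_adj_colOp` through `X J X^* = J` and takes the first coordinate. -/
theorem row_moebius_eq (p : Pow n H) :
    (moebius X T).row p = X.x • T.row (colOp X T p) + ∑ k, X.y k • colOp X T p k := by
  have h := congrFun (congrArg (fun M => matAct M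
    (Sum.elim (fun _ => -(moebius X T).row p) (fun i => p i))) X.mul_conj) (.inl ())
  simp only [matAct_mul] at h
  change matAct X.mat (matAct (signature n) (matAct X.adj.mat _)) _ = _ at h
  rw [matAct_adj_colOp, matAct_signature, matAct_signature, matAct_inl] at h
  simp only [Sum.elim_inl, Sum.elim_inr, neg_neg] at h
  exact h.symm

theorem colOp_surjective : Function.Surjective (colOp X T) := by
  intro q
  -- If `q = G p` with `G = colOp X T`, then `X J X^* = J` forces `(T' p, p) = X (T q, q)`. So `(a,
  -- b) = X (T q, q)` is the only candidate, and it remains to show `T' b = a`.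
  set a := X.x • T.row q + ∑ k, X.y k • q k with ha
  set b : Pow n H := WithLp.toLp 2 (fun i => X.z i • T.row q + ∑ k, X.blk i k • q k) with hb
  have h1 : matAct X.mat (Sum.elim (fun _ => T.row q) (fun i => q i)) =
      Sum.elim (fun _ => a) (fun i => b i) := by
    funext s
    cases s with
    | inl u => rw [matAct_inl]; rfl
    | inr k => rw [matAct_inr]; rfl
  have h2 := congrArg (fun M => matAct M (Sum.elim (fun _ => T.row q) (fun i => q i))) X.rel
  simp only [matAct_mul] at h2
  rw [h1, matAct_signature, matAct_signature] at h2
  have h3 := congrFun h2 (.inl ())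
  rw [matAct_inl] at h3
  have h4 := fun k => congrFun h2 (.inr k)
  simp only [matAct_inr] at h4
  simp only [Sum.elim_inl, Sum.elim_inr] at h3 h4
  change star X.x • -a + ∑ i, star (X.z i) • b i = _ at h3
  change ∀ k, star (X.y k) • -a + ∑ i, star (X.blk i k) • b i = _ at h4
  -- The equation `T' b = a` is checked after applying `C`, which has a left inverse. The
  -- ingredients are the coordinates `h3`, `h4` of `X^* J (a, b) = J (T q, q)`.
  have h5 : codenom X T ((moebius X T).row b) = codenom X T a := by
    rw [codenom_row_moebius, codenom_apply]
    have h6 : ∀ k, ∑ i, star (X.blk i k) • T.op k (b i) =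
        T.op k (q k) + star (X.y k) • T.op k a := by
      intro k
      have := congrArg (T.op k) (h4 k)
      rw [map_add, map_smul, map_neg, map_sum] at this
      simp only [map_smul] at this
      rw [← this, smul_neg]; abel
    simp only [h6, Finset.sum_add_distrib]
    rw [rowOp_apply, smul_neg] at h3
    rw [← sub_eq_zero] at h3 ⊢
    rw [← h3]
    abel
  have h7 : (moebius X T).row b = a := by
    have := congrArg (codenomInv X T) h5
    simpa only [← comp_apply (codenomInv X T), codenomInv_comp, one_apply_eq_self] using this
  refine ⟨b, ?_⟩
  ext k
  rw [colOp_apply, h7, ← h4 k, smul_neg]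
  abel

end Moebius

/-! ### The transformation rules for `K_T` and `Θ_T`. -/

section Transformation

open ContinuousLinearMap

variable {n : ℕ} {H : Type*} [NormedAddCommGroup H] [InnerProductSpace ℂ H] [CompleteSpace H]
  (X : PseudoUnitary n) (T : MultiContraction n H)

/-- The unitary `𝒟_{T^*} → 𝒟_{T'^*}` that maps `D_{T^*} g` to `D_{T'^*} (\bar x + T[\bar y])^* g`. -/
def defectStarUnitary : T.defectStar ≃ₗᵢ[ℂ] (moebius X T).defectStar :=
  (LinearEquiv.refl ℂ H).extendOfIsometry (dStar T).toLinearMap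
    (dStar (moebius X T) ∘L adjoint (codenom X T)).toLinearMap (denseRange_dStar T)
    ((denseRange_dStar (moebius X T)).comp
      (Function.Surjective.denseRange (fun h => ⟨_, adjoint_codenom_surj X T h⟩))
      (dStar (moebius X T)).continuous)
    (fun g => norm_dStar_moebius X T g)

theorem defectStarUnitary_apply (g : H) :
    defectStarUnitary X T (dStar T g) = dStar (moebius X T) (adjoint (codenom X T) g) :=
  LinearEquiv.extendOfIsometry_eq (LinearEquiv.refl ℂ H) (dStar T).toLinearMap _ _ _ _ g

/-- The unitary `𝒟_{T'} → 𝒟_T` that maps `D_{T'} p` to `D_T (X_{22}^* - y^* T') p`. -/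
def defectUnitary : (moebius X T).defect ≃ₗᵢ[ℂ] T.defect :=
  (LinearEquiv.refl ℂ (Pow n H)).extendOfIsometry (dRow (moebius X T)).toLinearMap
    (dRow T ∘L colOp X T).toLinearMap (denseRange_dRow _)
    ((denseRange_dRow T).comp (colOp_surjective X T).denseRange (dRow T).continuous)
    (fun p => norm_dRow_colOp X T p)

theorem defectUnitary_apply (p : Pow n H) :
    defectUnitary X T (dRow (moebius X T) p) = dRow T (colOp X T p) :=
  LinearEquiv.extendOfIsometry_eq (LinearEquiv.refl ℂ (Pow n H))
    (dRow (moebius X T)).toLinearMap _ _ _ _ p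

theorem adjoint_UOp : adjoint (UOp X) = UAdj X := (fockUnitary X).adjoint_eq_symm

theorem UOp_UAdj : UOp X ∘L UAdj X = ContinuousLinearMap.id ℂ _ := by
  ext1 ξ; exact (fockUnitary X).apply_symm_apply ξ

theorem UAdj_UOp : UAdj X ∘L UOp X = ContinuousLinearMap.id ℂ _ := by
  ext1 ξ; exact (fockUnitary X).symm_apply_apply ξ

theorem UOp_comp (f : discAlgebra n) :
    UOp X ∘L (f : Fock n →L[ℂ] Fock n) = (aut X f : Fock n →L[ℂ] Fock n) ∘L UOp X := by
  ext1 ξ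
  change _ = fockUnitary X ((f : Fock n →L[ℂ] Fock n) ((fockUnitary X).symm (fockUnitary X ξ)))
  rw [LinearIsometryEquiv.symm_apply_apply]
  rfl

theorem UAdj_comp (f : discAlgebra n) :
    UAdj X ∘L (f : Fock n →L[ℂ] Fock n) =
      ((aut X).symm f : Fock n →L[ℂ] Fock n) ∘L UAdj X := by
  ext1 ξ
  apply (fockUnitary X).injective
  change UOp X (UAdj X _) =
    (UOp X ∘L ((aut X).symm f : Fock n →L[ℂ] Fock n)) (UAdj X ξ)
  rw [UOp_comp, AlgEquiv.apply_symm_apply]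
  change (UOp X ∘L UAdj X) _ = (f : Fock n →L[ℂ] Fock n) ((UOp X ∘L UAdj X) ξ)
  rw [UOp_UAdj]
  rfl

theorem UOp_vacuum : UOp X (e []) = vac X := fockUnitary_e X []

/-- After applying `U_X` the right side becomes `(x - L[z]) U_X e_∅`, which is `e_∅` since `U_X e_∅
= (x - L[z])⁻¹ e_∅`. -/
theorem UAdj_vacuum :
    UAdj X (e []) = ((aut X).symm (denomElt X) : Fock n →L[ℂ] Fock n) (e []) := by
  apply (fockUnitary X).injective
  change (UOp X ∘L UAdj X) (e []) =
    (UOp X ∘L ((aut X).symm (denomElt X) : Fock n →L[ℂ] Fock n)) (e [])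
  rw [UOp_UAdj, UOp_comp, AlgEquiv.apply_symm_apply, comp_apply, UOp_vacuum]
  exact (denom_vac X).symm

/-- The monomial `L_w`. -/
def wordElt (w : List (Fin n)) : discAlgebra n := (w.map leftGen).prod

theorem wordElt_vacuum (w : List (Fin n)) : (wordElt w : Fock n →L[ℂ] Fock n) (e []) = e w := by
  induction w with
  | nil => rfl
  | cons i w ih =>
    rw [← creation_e, ← ih]
    rfl

theorem calc_symm_wordElt (w : List (Fin n)) :
    T.calc ((aut X).symm (wordElt w)) = (moebius X T).word w := by
  rw [wordElt, map_list_prod, map_list_prod, List.map_map, List.map_map]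
  rfl

/-- Writes `U_X^* e_w` as an algebra element applied to the vacuum, so that `poisson_calc` evaluates
its pairings with `K_T h`. -/
theorem UAdj_e (w : List (Fin n)) :
    UAdj X (e w) = ((aut X).symm (wordElt w * denomElt X) : Fock n →L[ℂ] Fock n) (e []) := by
  rw [← wordElt_vacuum, ← comp_apply, UAdj_comp, comp_apply, UAdj_vacuum, map_mul]
  rfl

/-- Pairing with `e_w ⊗ k` moves `U_X^*` onto `e_w`. The algebra element from `UAdj_e` takes the
value `T'_w C⁻¹` at `T`, and `Z_*^* D_{T^*} (C⁻¹)^* = D_{T'^*}` turns the result into the coordinate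
`D_{T'^*} T'_w^* h`. -/
theorem poisson_moebius :
    poisson (moebius X T) = tensorOp (UOp X)
      (defectStarUnitary X T : T.defectStar →L[ℂ] (moebius X T).defectStar) ∘L poisson T := by
  ext1 h
  refine ext_inner_tmul (fun w k => ?_)
  rw [comp_apply, inner_tmul_tensorOp,
    adjoint_UOp, UAdj_e, LinearIsometryEquiv.adjoint_eq_symm]
  have h1 : ∀ (A : discAlgebra n) (k : T.defectStar),
      ⟪tmul ((A : Fock n →L[ℂ] Fock n) (e [])) k, poisson T h⟫_ℂ =
        ⟪k, dStar T (adjoint (T.calc A) h)⟫_ℂ := by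
    intro A k
    have := inner_tmul_ampLeft (adjoint (A : Fock n →L[ℂ] Fock n)) (e []) k (poisson T h)
    rw [adjoint_adjoint] at this
    rw [← this, poisson_calc, inner_tmul_e_left, poisson_nil]
  rw [h1, map_mul, map_mul, calc_symm_wordElt, ContinuousLinearMap.mul_def, adjoint_comp,
    inner_tmul_e_left]
  change _ = ⟪(defectStarUnitary X T).symm k, dStar T (adjoint (codenomInv X T)
    (adjoint ((moebius X T).word w) h))⟫_ℂ
  rw [← LinearIsometryEquiv.inner_map_map (defectStarUnitary X T),
    LinearIsometryEquiv.apply_symm_apply, defectStarUnitary_apply, adjoint_codenom_surj]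
  rfl

/-- On `𝒟_{T'}` this is `D_{T'} = G^* D_T Z` with `G = colOp X T`, the adjoint of the relation `Z
D_{T'} = D_T G` that defines `Z`. -/
theorem defectOp_moebius (k : (moebius X T).defect) (j : Fin n) :
    defectOp (moebius X T).row (k : Pow n H) j =
      ∑ i, X.blk j i • defectOp T.row (defectUnitary X T k : Pow n H) i -
        adjoint ((moebius X T).op j)
          (∑ i, X.y i • defectOp T.row (defectUnitary X T k : Pow n H) i) := by
  set q := defectOp T.row (defectUnitary X T k : Pow n H) with hq
  suffices h : defectOp (moebius X T).row (k : Pow n H) = WithLp.toLp 2 (fun j =>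
      ∑ i, X.blk j i • q i - adjoint ((moebius X T).op j) (∑ i, X.y i • q i)) by
    rw [h]
  refine ext_inner_right ℂ (fun p => ?_)
  have h1 : ⟪defectOp (moebius X T).row (k : Pow n H), p⟫_ℂ = ⟪q, colOp X T p⟫_ℂ := by
    calc ⟪defectOp (moebius X T).row (k : Pow n H), p⟫_ℂ
        = ⟪k, dRow (moebius X T) p⟫_ℂ := by
          rw [Submodule.coe_inner, coe_dRow, ← adjoint_inner_left, adjoint_defectOp]
      _ = ⟪defectUnitary X T k, dRow T (colOp X T p)⟫_ℂ := by
          rw [← defectUnitary_apply, LinearIsometryEquiv.inner_map_map]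
      _ = ⟪q, colOp X T p⟫_ℂ := by
          rw [Submodule.coe_inner, coe_dRow, ← adjoint_inner_left, adjoint_defectOp]
  rw [h1, PiLp.inner_apply, PiLp.inner_apply]
  simp only [colOp_apply, inner_sub_left, inner_sub_right, inner_sum, sum_inner, inner_smul_left,
    inner_smul_right, Finset.sum_sub_distrib, adjoint_inner_left, rowOp_apply, Finset.mul_sum]
  congr 1
  · rw [Finset.sum_comm]
    rfl
  · rw [Finset.sum_comm]
    rfl

/-- By density `k = D_{T'} p` suffices. Then `T D_T = D_{T^*} T`, for `T` and for `T'`, brings every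
term to the form `D_{T'^*}` of a vector, and the vectors agree by `row_moebius_eq`. -/
theorem rowDefect_moebius (k : (moebius X T).defect) :
    rowDefect (moebius X T) k = defectStarUnitary X T (rowDefect T (defectUnitary X T k)) +
      dStar (moebius X T)
        (∑ i, X.y i • defectOp T.row (defectUnitary X T k : Pow n H) i) := by
  let Y : Pow n H →L[ℂ] H := ∑ i, X.y i • PiLp.proj 2 (fun _ : Fin n => H) i
  have hY : ∀ q : Pow n H, Y q = ∑ i, X.y i • q i := fun q => by simp [Y]
  rw [← hY]
  refine (denseRange_dRow (moebius X T)).induction_on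
    (p := fun k => rowDefect (moebius X T) k = defectStarUnitary X T (rowDefect T
      (defectUnitary X T k)) + dStar (moebius X T) (Y (defectOp T.row
        (defectUnitary X T k : Pow n H)))) k ?_ ?_
  · refine isClosed_eq (rowDefect (moebius X T)).continuous ?_
    refine Continuous.add ?_ ?_
    · exact (defectStarUnitary X T).continuous.comp
        ((rowDefect T).continuous.comp (defectUnitary X T).continuous)
    · exact (dStar (moebius X T)).continuous.comp (Y.continuous.comp
        ((defectOp T.row).continuous.comp
          (continuous_subtype_val.comp (defectUnitary X T).continuous)))
  · intro p
    have h0 : ∀ (S : MultiContraction n H) (q : Pow n H),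
        rowDefect S (dRow S q) = dStar S (S.row q) := by
      intro S q
      ext1
      exact congrArg (fun B : Pow n H →L[ℂ] H => B q) (comp_defectOp S.norm_row_le)
    rw [h0, defectUnitary_apply, h0, defectStarUnitary_apply, ← map_add]
    congr 1
    set g := colOp X T p with hg
    -- The term `-T^* T g` cancels the part `∑_k y_k T_k^*` of `C^*` applied to `T g`.
    have h2 : defectOp T.row (dRow T g : Pow n H) = g - adjoint T.row (T.row g) :=
      congrArg (fun B : Pow n H →L[ℂ] Pow n H => B g) (defectOp_mul_self T.norm_row_le)
    rw [h2, hY, row_moebius_eq, adjoint_codenom_apply]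
    simp only [PiLp.sub_apply, adjoint_rowOp_apply, smul_sub, Finset.sum_sub_distrib]
    rw [← hg]
    abel

theorem poisson_moebius_apply (h : H) :
    tensorOp (UOp X) (defectStarUnitary X T : T.defectStar →L[ℂ] (moebius X T).defectStar)
      (poisson T h) = poisson (moebius X T) h := by
  rw [poisson_moebius]; rfl

/-- Since `U_X^* e_∅ = Φ_X⁻¹(x - L[z]) e_∅`, the right side is `(x - L[z]) ⊗ I` applied to `U_X ⊗
Z_*^*` of a column given by `charFun_vacuum`. This factor clears the denominators of `U_X e_∅` and
of the `Φ_X(L_i)`. What remains involves only `e_∅`, the `L_j` and `K_{T'}`. -/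
theorem charFun_moebius_vacuum (k : (moebius X T).defect) :
    charFun (moebius X T) (tmul (e []) k) = tensorOp (UOp X)
      (defectStarUnitary X T : T.defectStar →L[ℂ] (moebius X T).defectStar)
      (charFun T (tensorOp (UAdj X)
        (defectUnitary X T : (moebius X T).defect →L[ℂ] T.defect) (tmul (e []) k))) := by
  set q := defectOp T.row (defectUnitary X T k : Pow n H) with hq
  have hcomm : ∀ (A : discAlgebra n) (f : FockTensor n T.defectStar),
      tensorOp (UOp X) (defectStarUnitary X T : T.defectStar →L[ℂ] (moebius X T).defectStar)
        (ampLeft (A : Fock n →L[ℂ] Fock n) f) =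
      ampLeft (aut X A : Fock n →L[ℂ] Fock n) (tensorOp (UOp X)
        (defectStarUnitary X T : T.defectStar →L[ℂ] (moebius X T).defectStar) f) := by
    intro A f
    rw [ampLeft_eq_tensorOp, ampLeft_eq_tensorOp, tensorOp_tensorOp, tensorOp_tensorOp, UOp_comp]
    rfl
  have h1 : tensorOp (UAdj X) (defectUnitary X T : (moebius X T).defect →L[ℂ] T.defect)
      (tmul (e []) k) = ampLeft ((aut X).symm (denomElt X) : Fock n →L[ℂ] Fock n)
        (tmul (e []) (defectUnitary X T k)) := by
    rw [tensorOp_tmul, ampLeft_tmul, UAdj_vacuum]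
    rfl
  have hden : ∀ g : FockTensor n (moebius X T).defectStar, ∀ i,
      ampLeft (denom X) (ampLeft (gen X i) g) =
        ∑ j, X.blk j i • ampLeft (creation j) g - X.y i • g := by
    intro g i
    rw [ampLeft_ampLeft]
    have := denom_mul_gen X i
    rw [ContinuousLinearMap.mul_def] at this
    rw [this]
    refine ext_slice (fun k => ?_)
    rw [slice_ampLeft]
    simp only [map_sub, map_sum, map_smul, slice_ampLeft]
    simp [linComb, Algebra.algebraMap_eq_smul_one]
  have h2 : tensorOp (UOp X)
      (defectStarUnitary X T : T.defectStar →L[ℂ] (moebius X T).defectStar)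
      (charFun T (tmul (e []) (defectUnitary X T k))) =
      -tmul (vac X) (defectStarUnitary X T (rowDefect T (defectUnitary X T k))) +
        ∑ i, ampLeft (gen X i) (poisson (moebius X T) (q i)) := by
    rw [charFun_vacuum, map_add, map_neg, tensorOp_tmul, UOp_vacuum, map_sum]
    congr 1
    refine Finset.sum_congr rfl (fun i _ => ?_)
    refine (hcomm (leftGen i) _).trans ?_
    rw [poisson_moebius_apply, aut_coe]
    change ampLeft (conjAut X (creation i)) _ = _
    rw [conjAut_creation]
  rw [h1, charFun_ampLeft, hcomm, AlgEquiv.apply_symm_apply, h2]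
  change _ = ampLeft (denom X) _
  rw [map_add, map_neg, ampLeft_tmul, denom_vac, map_sum]
  simp only [hden, Finset.sum_sub_distrib]
  rw [charFun_vacuum, rowDefect_moebius]
  simp only [defectOp_moebius, map_sub, map_sum, map_smul, Finset.sum_sub_distrib]
  rw [← hq]
  -- The left side has no bare term `K_{T'} (∑_i y_i q_i)`. The recursion splits it into the vacuum
  -- part from `rowDefect_moebius` and the part with `T'_j^*` from `defectOp_moebius`.
  have h3 := poisson_recursion (moebius X T) (∑ i, X.y i • q i)
  simp only [map_sum, map_smul] at h3 ⊢
  rw [tmul_add, h3, Finset.sum_comm (s := Finset.univ) (t := Finset.univ)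
    (f := fun j i => X.blk j i • _)]
  abel

/-- Both sides commute with `L_i ⊗ I`: on the right, `L_i` becomes `Φ_X⁻¹(L_i)`, passes `Θ_T` by
`charFun_ampLeft`, and becomes `L_i` again. Induction on the word reduces the claim to the vacuum.
-/
theorem transforms_moebius :
    Transforms X T (moebius X T) (defectUnitary X T) (defectStarUnitary X T).symm := by
  refine ⟨ext_tmul (fun w k => ?_), poisson_moebius X T⟩
  rw [LinearIsometryEquiv.symm_symm]
  induction w with
  | nil => exact charFun_moebius_vacuum X T k
  | cons i w ih =>
    have h1 : tmul (e (i :: w)) k = ampLeft (creation i) (tmul (e w) k) := by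
      rw [ampLeft_tmul, creation_e]
    simp only [comp_apply] at ih ⊢
    rw [h1, charFun_creation, ih]
    have h2 : tensorOp (UAdj X) (defectUnitary X T : (moebius X T).defect →L[ℂ] T.defect)
        (ampLeft (creation i) (tmul (e w) k)) =
        ampLeft ((aut X).symm (leftGen i) : Fock n →L[ℂ] Fock n) (tensorOp (UAdj X)
          (defectUnitary X T : (moebius X T).defect →L[ℂ] T.defect) (tmul (e w) k)) := by
      rw [ampLeft_eq_tensorOp, ampLeft_eq_tensorOp, tensorOp_tensorOp, tensorOp_tensorOp]
      change tensorOp (UAdj X ∘L (leftGen i : Fock n →L[ℂ] Fock n)) _ _ = _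
      rw [UAdj_comp]
      rfl
    rw [h2, charFun_ampLeft, ampLeft_eq_tensorOp, ampLeft_eq_tensorOp, tensorOp_tensorOp,
      tensorOp_tensorOp, UOp_comp, AlgEquiv.apply_symm_apply]
    rfl

end Transformation

/-! ### Constrained objects, ideals and their images under `Φ_X`. -/

section ConstrainedTransformation

open ContinuousLinearMap

variable {n : ℕ} {H : Type*} [NormedAddCommGroup H] [InnerProductSpace ℂ H] [CompleteSpace H]
  (X : PseudoUnitary n) (T : MultiContraction n H)

theorem adjoint_tensorOp {E E' : Type*} [NormedAddCommGroup E] [InnerProductSpace ℂ E]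
    [CompleteSpace E] [NormedAddCommGroup E'] [InnerProductSpace ℂ E'] [CompleteSpace E']
    (A : Fock n →L[ℂ] Fock n) (B : E →L[ℂ] E') :
    adjoint (tensorOp A B) = tensorOp (adjoint A) (adjoint B) := by
  refine ext_tmul (fun w k => ext_inner_right ℂ (fun f => ?_))
  rw [adjoint_inner_left, inner_tmul_tensorOp, tensorOp_tmul]

/-- The image of the projected part lies in `N' ⊗ E'` by `h₁`. The image of the remainder is
orthogonal to `N' ⊗ E'`, since the adjoint `U_X^* ⊗ V^*` maps that space back into `N ⊗ E` by `h₂`.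
-/
theorem projection_tensorOp {E E' : Type*} [NormedAddCommGroup E] [InnerProductSpace ℂ E]
    [CompleteSpace E] [NormedAddCommGroup E'] [InnerProductSpace ℂ E'] [CompleteSpace E']
    (V : E ≃ₗᵢ[ℂ] E') {N N' : Submodule ℂ (Fock n)} (h₁ : ∀ ξ ∈ N, UOp X ξ ∈ N')
    (h₂ : ∀ ξ ∈ N', UAdj X ξ ∈ N) (f : FockTensor n E) :
    (tensorSub N' E').orthogonalProjectionOnto (tensorOp (UOp X) (V : E →L[ℂ] E') f) =
      tensorRestrict (UOp X) (V : E →L[ℂ] E') N N' h₁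
        ((tensorSub N E).orthogonalProjectionOnto f) := by
  refine Subtype.ext (Submodule.eq_starProjection_of_mem_of_inner_eq_zero (Subtype.prop _) ?_)
  intro g hg
  change ⟪tensorOp (UOp X) (V : E →L[ℂ] E') f -
    tensorOp (UOp X) (V : E →L[ℂ] E') ((tensorSub N E).starProjection f), g⟫_ℂ = 0
  rw [← map_sub, ← adjoint_inner_right, adjoint_tensorOp, adjoint_UOp,
    LinearIsometryEquiv.adjoint_eq_symm]
  exact Submodule.starProjection_inner_eq_zero f _ (tensorOp_mem h₂ _ hg)

variable {X T}

/-- Only the transport of the two co-spaces enters, so the same statement serves a general pair `𝔍,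
𝔍'` and the commutator case `𝔍 = 𝔍' = ℭ`. -/
theorem Transforms.constrainedPoisson_eq {T' : MultiContraction n H}
    {Z : T'.defect ≃ₗᵢ[ℂ] T.defect} {Zs : T'.defectStar ≃ₗᵢ[ℂ] T.defectStar}
    (h : Transforms X T T' Z Zs) {J J' : Set (Fock n →L[ℂ] Fock n)}
    (h₁ : ∀ ξ ∈ coSpace J, UOp X ξ ∈ coSpace J') (h₂ : ∀ ξ ∈ coSpace J', UAdj X ξ ∈ coSpace J) :
    constrainedPoisson J' T' =
      tensorRestrict (UOp X) (Zs.symm : T.defectStar →L[ℂ] T'.defectStar)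
        (coSpace J) (coSpace J') h₁ ∘L constrainedPoisson J T := by
  ext1 g
  rw [constrainedPoisson, h.2]
  exact projection_tensorOp X Zs.symm h₁ h₂ _

theorem Transforms.constrainedCharFun_eq {T' : MultiContraction n H}
    {Z : T'.defect ≃ₗᵢ[ℂ] T.defect} {Zs : T'.defectStar ≃ₗᵢ[ℂ] T.defectStar}
    (h : Transforms X T T' Z Zs) {J J' : Set (Fock n →L[ℂ] Fock n)}
    (h₁ : ∀ ξ ∈ coSpace J, UOp X ξ ∈ coSpace J') (h₂ : ∀ ξ ∈ coSpace J', UAdj X ξ ∈ coSpace J) :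
    constrainedCharFun J' T' =
      tensorRestrict (UOp X) (Zs.symm : T.defectStar →L[ℂ] T'.defectStar)
        (coSpace J) (coSpace J') h₁ ∘L constrainedCharFun J T ∘L
      tensorRestrict (UAdj X) (Z : T'.defect →L[ℂ] T.defect) (coSpace J') (coSpace J) h₂ := by
  ext1 g
  rw [constrainedCharFun, h.1]
  exact projection_tensorOp X Zs.symm h₁ h₂ _

variable (X T)

theorem coe_aut_symm (f : discAlgebra n) : ((aut X).symm f : Fock n →L[ℂ] Fock n) =
    UAdj X ∘L (f : Fock n →L[ℂ] Fock n) ∘L UOp X := by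
  rw [← comp_assoc, UAdj_comp, comp_assoc, UAdj_UOp]
  rfl

theorem continuous_aut_symm : Continuous (aut X).symm := by
  have h : Continuous fun f : discAlgebra n =>
      UAdj X ∘L (f : Fock n →L[ℂ] Fock n) ∘L UOp X := by fun_prop
  exact continuous_induced_rng.2 (h.congr (fun f => (coe_aut_symm X f).symm))

theorem continuous_aut : Continuous (aut X) := by
  have h : Continuous fun f : discAlgebra n =>
      UOp X ∘L (f : Fock n →L[ℂ] Fock n) ∘L UAdj X := by fun_prop
  exact continuous_induced_rng.2 h

/-- `f ↦ Φ_X⁻¹(f)(T)` is a continuous homomorphism with value `T'_i` at `L_i`, so uniqueness of the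
functional calculus applies. -/
theorem calc_moebius (f : discAlgebra n) :
    (moebius X T).calc f = T.calc ((aut X).symm f) := by
  have h := calc_unique (moebius X T) (T.calc.comp (aut X).symm.toAlgHom)
    ((continuous_calc T).comp (continuous_aut_symm X)) (fun i => rfl)
  rw [← h]
  rfl

theorem mem_imageIdeal (j : TwoSidedIdeal (discAlgebra n)) (f : discAlgebra n) :
    f ∈ imageIdeal X j ↔ (aut X).symm f ∈ j := TwoSidedIdeal.mem_comap _

theorem isClosed_imageIdeal {j : TwoSidedIdeal (discAlgebra n)}
    (hj : IsClosed (j : Set (discAlgebra n))) :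
    IsClosed (imageIdeal X j : Set (discAlgebra n)) := by
  have : (imageIdeal X j : Set (discAlgebra n)) =
      (aut X).symm ⁻¹' (j : Set (discAlgebra n)) := by
    ext f; exact mem_imageIdeal X j f
  rw [this]
  exact hj.preimage (continuous_aut_symm X)

theorem isConstrained_moebius {j : TwoSidedIdeal (discAlgebra n)} (h : IsConstrained T j) :
    IsConstrained (moebius X T) (imageIdeal X j) := by
  intro f hf
  rw [calc_moebius]
  exact h _ ((mem_imageIdeal X j f).1 hf)

/-- Conjugation by a unitary is a homeomorphism of the weak operator topology: a functional `A ↦ y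
(U A U^* ξ)` is again of the form `A ↦ y' (A ξ')`. -/
theorem conjAut_image_wotClosure (S : Set (Fock n →L[ℂ] Fock n)) :
    conjAut X '' wotClosure S = wotClosure (conjAut X '' S) := by
  let φ : (Fock n →WOT[ℂ] Fock n) ≃ₜ (Fock n →WOT[ℂ] Fock n) :=
    { toFun := fun A => ContinuousLinearMapWOT.ofCLM (conjAut X A.toCLM)
      invFun := fun A => ContinuousLinearMapWOT.ofCLM ((conjAut X).symm A.toCLM)
      left_inv := fun A => by simp
      right_inv := fun A => by simp
      continuous_toFun := ContinuousLinearMapWOT.continuous_of_dual_apply_continuous (fun ξ y =>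
        ContinuousLinearMapWOT.continuous_dual_apply (UAdj X ξ) (y ∘L UOp X))
      continuous_invFun := ContinuousLinearMapWOT.continuous_of_dual_apply_continuous (fun ξ y =>
        ContinuousLinearMapWOT.continuous_dual_apply (UOp X ξ) (y ∘L UAdj X)) }
  have h1 : ContinuousLinearMapWOT.ofCLM '' (conjAut X '' S) =
      φ '' (ContinuousLinearMapWOT.ofCLM '' S) := by
    rw [Set.image_image, Set.image_image]
    rfl
  ext A
  rw [wotClosure, wotClosure, h1]
  change _ ↔ ContinuousLinearMapWOT.ofCLM A ∈ closure _
  rw [← φ.image_closure]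
  constructor
  · rintro ⟨B, hB, rfl⟩
    exact ⟨_, hB, rfl⟩
  · rintro ⟨B, hB, hBA⟩
    exact ⟨B.toCLM, hB, congrArg ContinuousLinearMapWOT.toCLM hBA⟩

theorem coe_imageIdeal (j : TwoSidedIdeal (discAlgebra n)) :
    Subtype.val '' (imageIdeal X j : Set (discAlgebra n)) =
      conjAut X '' (Subtype.val '' (j : Set (discAlgebra n))) := by
  ext A
  constructor
  · rintro ⟨f, hf, rfl⟩
    refine ⟨_, ⟨_, (mem_imageIdeal X j f).1 hf, rfl⟩, ?_⟩
    rw [← aut_coe, AlgEquiv.apply_symm_apply]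
  · rintro ⟨_, ⟨f, hf, rfl⟩, rfl⟩
    refine ⟨aut X f, (mem_imageIdeal X j _).2 ?_, rfl⟩
    rw [AlgEquiv.symm_apply_apply]
    exact hf

theorem conjAut_image_wotIdeal (j : TwoSidedIdeal (discAlgebra n)) :
    conjAut X '' wotIdeal j = wotIdeal (imageIdeal X j) := by
  rw [wotIdeal, wotIdeal, conjAut_image_wotClosure, coe_imageIdeal]

theorem commutator_mem_commutatorIdeal (f g : discAlgebra n) :
    f * g - g * f ∈ commutatorIdeal n := by
  rw [commutatorIdeal, TwoSidedIdeal.mem_sInf]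
  exact fun I hI => hI.2 f g

theorem isClosed_commutatorIdeal : IsClosed (commutatorIdeal n : Set (discAlgebra n)) := by
  have : (commutatorIdeal n : Set (discAlgebra n)) =
      ⋂ I ∈ {I : TwoSidedIdeal (discAlgebra n) | IsClosed (I : Set (discAlgebra n)) ∧
        ∀ f g, f * g - g * f ∈ I}, (I : Set (discAlgebra n)) := by
    ext f
    simp only [SetLike.mem_coe, commutatorIdeal, TwoSidedIdeal.mem_sInf, Set.mem_iInter]
  rw [this]
  exact isClosed_biInter (fun I hI => hI.1)

theorem commutatorIdeal_le {I : TwoSidedIdeal (discAlgebra n)}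
    (hI : IsClosed (I : Set (discAlgebra n))) (h : ∀ f g, f * g - g * f ∈ I) :
    commutatorIdeal n ≤ I := sInf_le ⟨hI, h⟩

/-- `Φ_X` and its inverse are continuous automorphisms, so the preimages of `𝔠` under both are
closed ideals containing all commutators. Minimality gives the two inclusions. -/
theorem imageIdeal_commutatorIdeal : imageIdeal X (commutatorIdeal n) = commutatorIdeal n := by
  apply le_antisymm
  · have h : commutatorIdeal n ≤ (commutatorIdeal n).comap (aut X) := by
      refine commutatorIdeal_le ?_ (fun f g => ?_)
      · have : ((commutatorIdeal n).comap (aut X) : Set (discAlgebra n)) =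
            aut X ⁻¹' (commutatorIdeal n : Set (discAlgebra n)) := by
          ext f; exact TwoSidedIdeal.mem_comap _
        rw [this]
        exact isClosed_commutatorIdeal.preimage (continuous_aut X)
      · rw [TwoSidedIdeal.mem_comap, map_sub, map_mul, map_mul]
        exact commutator_mem_commutatorIdeal _ _
    intro f hf
    have h1 := h ((mem_imageIdeal X _ f).1 hf)
    rw [TwoSidedIdeal.mem_comap, AlgEquiv.apply_symm_apply] at h1
    exact h1
  · refine commutatorIdeal_le (isClosed_imageIdeal X isClosed_commutatorIdeal) (fun f g => ?_)
    rw [mem_imageIdeal, map_sub, map_mul, map_mul]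
    exact commutator_mem_commutatorIdeal _ _

variable {T} in
-- The elements whose value at `T` commutes with a fixed operator form a closed subalgebra. The
-- argument runs twice: first against each `T_i`, then against `g(T)`.
theorem IsCommuting.calc_commute (h : IsCommuting T) (f g : discAlgebra n) :
    Commute (T.calc f) (T.calc g) := by
  have key : ∀ B : H →L[ℂ] H, (∀ i, T.op i * B = B * T.op i) →
      ∀ f, T.calc f * B = B * T.calc f := by
    intro B hB f
    let S : Subalgebra ℂ (discAlgebra n) := (Subalgebra.centralizer ℂ {B}).comap T.calc
    have hS : ∀ f, f ∈ S ↔ T.calc f * B = B * T.calc f := fun f => by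
      simp [S, Subalgebra.mem_comap, Subalgebra.mem_centralizer_iff, eq_comm]
    have hc : IsClosed (S : Set (discAlgebra n)) := by
      have : (S : Set (discAlgebra n)) = {f | T.calc f * B = B * T.calc f} := by
        ext f; exact hS f
      rw [this]
      have := continuous_calc T
      exact isClosed_eq (by fun_prop) (by fun_prop)
    exact (hS f).1 (discAlgebra_induction hc (fun i => (hS _).2 (by rw [calc_leftGen, hB])) f)
  refine key _ (fun i => (key _ (fun k => ?_) g).symm) f
  exact h k i

/-- For commuting `T` the kernel of the functional calculus is a closed ideal containing all
commutators, hence contains `𝔠`. Conversely, commutators of generators suffice. -/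
theorem isConstrained_commutatorIdeal_iff :
    IsConstrained T (commutatorIdeal n) ↔ IsCommuting T := by
  constructor
  · intro h i k
    have := h _ (commutator_mem_commutatorIdeal (leftGen i) (leftGen k))
    rw [map_sub, map_mul, map_mul, calc_leftGen, calc_leftGen, sub_eq_zero] at this
    exact this
  · intro h f hf
    have h1 : commutatorIdeal n ≤ TwoSidedIdeal.ker T.calc := by
      refine commutatorIdeal_le ?_ (fun f g => ?_)
      · have : (TwoSidedIdeal.ker T.calc : Set (discAlgebra n)) = T.calc ⁻¹' {0} := by
          ext f; exact TwoSidedIdeal.mem_ker _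
        rw [this]
        exact isClosed_singleton.preimage (continuous_calc T)
      · rw [TwoSidedIdeal.mem_ker, map_sub, map_mul, map_mul, sub_eq_zero]
        exact h.calc_commute f g
    exact (TwoSidedIdeal.mem_ker _).1 (h1 hf)

variable {T} in
theorem IsCommuting.moebius (h : IsCommuting T) : IsCommuting (moebius X T) :=
  fun _ _ => h.calc_commute _ _

end ConstrainedTransformation

/-! ### Kernel vectors and the commutative characteristic function. -/

section Symbol

open ContinuousLinearMap

variable {n : ℕ} {H : Type*} [NormedAddCommGroup H] [InnerProductSpace ℂ H] [CompleteSpace H]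
  (X : PseudoUnitary n) (T : MultiContraction n H)

/-- The vector `(I - L[\bar λ])⁻¹ e_∅ = ∑_w \bar λ_w e_w`. -/
def kernelVec (lam : Fin n → ℂ) : Fock n := Ring.inverse (1 - linComb (star lam)) (e [])

variable {lam : Fin n → ℂ}

theorem norm_linComb_star_lt (hlam : ∑ i, ‖lam i‖ ^ 2 < 1) :
    ‖linComb (star lam)‖ < 1 := by
  refine (norm_linComb_le _).trans_lt ?_
  rw [Real.sqrt_lt' one_pos]
  simpa using hlam

theorem kernelVec_eq (hlam : ∑ i, ‖lam i‖ ^ 2 < 1) :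
    kernelVec lam = e [] + ∑ i, star (lam i) • creation i (kernelVec lam) := by
  have h := Ring.mul_inverse_cancel _ (isUnit_one_sub_of_norm_lt_one (norm_linComb_star_lt hlam))
  have h1 := congrArg (fun A => A (e [])) h
  change kernelVec lam - linComb (star lam) (kernelVec lam) = e [] at h1
  rw [sub_eq_iff_eq_add] at h1
  conv_lhs => rw [h1]
  congr 1
  simp [linComb]

theorem kernelVec_nil (hlam : ∑ i, ‖lam i‖ ^ 2 < 1) : kernelVec lam [] = 1 := by
  rw [kernelVec_eq hlam, lp.coeFn_add, Pi.add_apply, sum_coord]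
  simp [e_apply]

theorem kernelVec_cons (hlam : ∑ i, ‖lam i‖ ^ 2 < 1) (i : Fin n) (w : List (Fin n)) :
    kernelVec lam (i :: w) = star (lam i) * kernelVec lam w := by
  conv_lhs => rw [kernelVec_eq hlam, lp.coeFn_add, Pi.add_apply, sum_coord]
  simp [e_apply]

theorem inner_kernelVec_vacuum (hlam : ∑ i, ‖lam i‖ ^ 2 < 1) :
    ⟪kernelVec lam, e []⟫_ℂ = 1 := by
  rw [← inner_conj_symm, inner_e_left, kernelVec_nil hlam, map_one]

/-- The coefficients of the kernel vector are multiplicative in the word. So pairing with it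
replaces each `L_i` by the number `λ_i`. -/
theorem adjoint_creation_kernelVec (hlam : ∑ i, ‖lam i‖ ^ 2 < 1) (i : Fin n) :
    adjoint (creation i) (kernelVec lam) = star (lam i) • kernelVec lam := by
  ext w
  rw [← inner_e_left, adjoint_inner_right, creation_e, inner_e_left, kernelVec_cons hlam]
  rfl

theorem inner_kernelVec_creation (hlam : ∑ i, ‖lam i‖ ^ 2 < 1)
    (i : Fin n) (ξ : Fock n) :
    ⟪kernelVec lam, creation i ξ⟫_ℂ = lam i * ⟪kernelVec lam, ξ⟫_ℂ := by
  rw [← adjoint_inner_left, adjoint_creation_kernelVec hlam, inner_smul_left]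
  simp

theorem leftSlice_kernelVec_creation (hlam : ∑ i, ‖lam i‖ ^ 2 < 1)
    {E : Type*} [NormedAddCommGroup E] [InnerProductSpace ℂ E]
    [CompleteSpace E] (i : Fin n) (f : FockTensor n E) :
    leftSlice (kernelVec lam) (ampLeft (creation i) f) =
      lam i • leftSlice (kernelVec lam) f := by
  rw [leftSlice_ampLeft, adjoint_creation_kernelVec hlam, leftSlice_smul, star_star]

/-- The sum is the adjoint of the value of `L[\bar λ]` at `T`, so its norm is at most `‖L[\bar λ]‖ <
1` by contractivity of the functional calculus. -/
theorem isUnit_one_sub_adjoint (hlam : ∑ i, ‖lam i‖ ^ 2 < 1) :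
    IsUnit (1 - ∑ i, lam i • adjoint (T.op i)) := by
  refine isUnit_one_sub_of_norm_lt_one ?_
  have h1 : ∑ i, lam i • adjoint (T.op i) =
      adjoint (T.calc (∑ i, star (lam i) • leftGen i)) := by
    rw [map_sum, map_sum]
    refine Finset.sum_congr rfl (fun i _ => ?_)
    rw [map_smul, calc_leftGen, map_smulₛₗ]
    simp
  rw [h1, LinearIsometryEquiv.norm_map]
  refine (norm_calc_le _ _).trans_lt ?_
  have h2 : ((∑ i, star (lam i) • leftGen i : discAlgebra n) : Fock n →L[ℂ] Fock n) =
      linComb (star lam) := by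
    rw [AddSubmonoidClass.coe_finsetSum]
    rfl
  change ‖((∑ i, star (lam i) • leftGen i : discAlgebra n) : Fock n →L[ℂ] Fock n)‖ < 1
  rw [h2]
  exact norm_linComb_star_lt hlam

/-- Slicing `poisson_recursion` turns it into a linear equation that is solved by inverting `1 - ∑
λ_i T_i^*`. -/
theorem leftSlice_kernelVec_poisson (hlam : ∑ i, ‖lam i‖ ^ 2 < 1) (h : H) :
    leftSlice (kernelVec lam) (poisson T h) =
      dStar T (Ring.inverse (1 - ∑ i, lam i • adjoint (T.op i)) h) := by
  have h1 : ∀ g, leftSlice (kernelVec lam)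
      (poisson T ((1 - ∑ i, lam i • adjoint (T.op i)) g)) = dStar T g := by
    intro g
    have h2 := congrArg (leftSlice (kernelVec lam)) (poisson_recursion T g)
    rw [map_add, leftSlice_tmul, inner_kernelVec_vacuum hlam, one_smul, map_sum] at h2
    simp only [leftSlice_kernelVec_creation hlam] at h2
    simp only [sub_apply, one_apply_eq_self, sum_apply, smul_apply, map_sub, map_sum, map_smul]
    rw [h2, add_sub_cancel_right]
  rw [← h1]
  congr 2
  have := Ring.mul_inverse_cancel _ (isUnit_one_sub_adjoint T hlam)
  exact (congrArg (fun A : H →L[ℂ] H => A h) this).symm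

theorem leftSlice_kernelVec_charFun_vacuum (hlam : ∑ i, ‖lam i‖ ^ 2 < 1)
    (k : T.defect) :
    leftSlice (kernelVec lam) (charFun T (tmul (e []) k)) = symbol T lam k := by
  rw [charFun_vacuum, map_add, map_neg, leftSlice_tmul, inner_kernelVec_vacuum hlam, one_smul,
    map_sum]
  simp only [leftSlice_kernelVec_creation hlam, leftSlice_kernelVec_poisson T hlam]
  have h1 : ∑ i, lam i • dStar T (Ring.inverse (1 - ∑ i, lam i • adjoint (T.op i))
      (defectOp T.row (k : Pow n H) i)) = dStar T (Ring.inverse (1 - ∑ i, lam i • adjoint (T.op i))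
        (rowOp (fun i => lam i • (1 : H →L[ℂ] H)) (defectOp T.row (k : Pow n H)))) := by
    rw [rowOp_apply]
    simp only [smul_apply, one_apply_eq_self, map_sum, map_smul]
  rw [h1]
  rfl

/-- The slice of `charFun_vacuum` is `θ_T(λ)`. Each further letter multiplies both sides by the same
`λ_i`. -/
theorem leftSlice_kernelVec_charFun (hlam : ∑ i, ‖lam i‖ ^ 2 < 1)
    (f : FockTensor n T.defect) :
    leftSlice (kernelVec lam) (charFun T f) = symbol T lam (leftSlice (kernelVec lam) f) := by
  suffices h : leftSlice (kernelVec lam) ∘L charFun T =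
      symbol T lam ∘L leftSlice (kernelVec lam) from congrArg (fun A => A f) h
  refine ext_tmul (fun w k => ?_)
  simp only [comp_apply]
  induction w with
  | nil =>
    rw [leftSlice_kernelVec_charFun_vacuum T hlam, leftSlice_tmul, inner_kernelVec_vacuum hlam,
      one_smul]
  | cons i w ih =>
    rw [← creation_e, ← ampLeft_tmul, charFun_creation, leftSlice_kernelVec_creation hlam, ih,
      leftSlice_kernelVec_creation hlam, map_smul]

theorem inner_kernelVec_denom (hlam : ∑ i, ‖lam i‖ ^ 2 < 1) (ξ : Fock n) :
    ⟪kernelVec lam, denom X ξ⟫_ℂ = (X.x - ∑ j, lam j * X.z j) * ⟪kernelVec lam, ξ⟫_ℂ := by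
  simp only [denom, linComb, Algebra.algebraMap_eq_smul_one, sub_apply, smul_apply,
    one_apply_eq_self, sum_apply, inner_sub_right, inner_sum, inner_smul_right,
    inner_kernelVec_creation hlam, sub_mul, Finset.sum_mul]
  congr 1
  exact Finset.sum_congr rfl (fun j _ => by ring)

/-- Pairing `(x - L[z]) U_X e_∅ = e_∅` with the kernel vector writes `1` as a multiple of this
number. -/
theorem ballDenom_ne_zero (hlam : ∑ i, ‖lam i‖ ^ 2 < 1) :
    X.x - ∑ j, lam j * X.z j ≠ 0 := by
  intro h
  have h1 := inner_kernelVec_denom X hlam (vac X)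
  rw [denom_vac, inner_kernelVec_vacuum hlam, h, zero_mul] at h1
  exact one_ne_zero h1

theorem inner_kernelVec_gen (hlam : ∑ i, ‖lam i‖ ^ 2 < 1) (i : Fin n) (ξ : Fock n) :
    ⟪kernelVec lam, gen X i ξ⟫_ℂ = ballAut X lam i * ⟪kernelVec lam, ξ⟫_ℂ := by
  have h1 := inner_kernelVec_denom X hlam (gen X i ξ)
  have h2 : denom X (gen X i ξ) = linComb (fun j => X.blk j i) ξ - X.y i • ξ := by
    have := congrArg (fun A => A ξ) (denom_mul_gen X i)
    simpa [Algebra.algebraMap_eq_smul_one] using this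
  have h3 : ⟪kernelVec lam, linComb (fun j => X.blk j i) ξ⟫_ℂ =
      (∑ j, lam j * X.blk j i) * ⟪kernelVec lam, ξ⟫_ℂ := by
    simp only [linComb, sum_apply, smul_apply, inner_sum, inner_smul_right,
      inner_kernelVec_creation hlam, Finset.sum_mul]
    exact Finset.sum_congr rfl (fun j _ => by ring)
  rw [h2, inner_sub_right, inner_smul_right, h3] at h1
  rw [ballAut, mul_assoc, eq_inv_mul_iff_mul_eq₀ (ballDenom_ne_zero X hlam), ← h1]
  ring

theorem sum_norm_ballAut_lt (hlam : ∑ i, ‖lam i‖ ^ 2 < 1) :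
    ∑ i, ‖ballAut X lam i‖ ^ 2 < 1 := by
  set d := X.x - ∑ j, lam j * X.z j with hd
  have hd0 : d ≠ 0 := ballDenom_ne_zero X hlam
  -- Here `X^*` maps `(1, -\bar λ)` to `(\bar d, -\overline{d φ_X(λ)})`, so `|d|² (1 - ‖φ_X(λ)‖²) =
  -- 1 - ‖λ‖²`.
  have h := indef_norm X.adj (K := ℂ) (Sum.elim (fun _ => 1) (fun i => -star (lam i)))
  simp only [matAct_inl, matAct_inr, Sum.elim_inl, Sum.elim_inr] at h
  have h1 : X.adj.mat (.inl ()) (.inl ()) • (1 : ℂ) +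
      ∑ i, X.adj.mat (.inl ()) (.inr i) • (-star (lam i)) = star d := by
    change star X.x • (1 : ℂ) + ∑ i, star (X.z i) • (-star (lam i)) = _
    simp [hd, sub_eq_add_neg, mul_comm]
  have h2 : ∀ k, X.adj.mat (.inr k) (.inl ()) • (1 : ℂ) +
      ∑ i, X.adj.mat (.inr k) (.inr i) • (-star (lam i)) = -star (d * ballAut X lam k) := by
    intro k
    change star (X.y k) • (1 : ℂ) + ∑ i, star (X.blk i k) • (-star (lam i)) = _
    rw [ballAut, mul_inv_cancel_left₀ hd0]
    simp [mul_comm]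
    abel
  simp only [h1, h2, norm_neg, norm_star, norm_mul, mul_pow, ← Finset.mul_sum, norm_one] at h
  have h3 : 0 < ‖d‖ ^ 2 := by positivity
  nlinarith

/-- The coefficient at `w` is the conjugate of `⟪v_λ, U_X e_w⟫`. There the vacuum contributes `d⁻¹`
and each letter a factor `φ_X(λ)_i`, by `inner_kernelVec_gen`. -/
theorem UAdj_kernelVec (hlam : ∑ i, ‖lam i‖ ^ 2 < 1) :
    UAdj X (kernelVec lam) =
      star (X.x - ∑ j, lam j * X.z j)⁻¹ • kernelVec (ballAut X lam) := by
  set d := X.x - ∑ j, lam j * X.z j with hd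
  have h0 : ∀ w, UAdj X (kernelVec lam) w = star ⟪kernelVec lam, basisImage X w⟫_ℂ := by
    intro w
    rw [← inner_e_left, ← adjoint_UOp, adjoint_inner_right]
    change ⟪fockUnitary X (e w), _⟫_ℂ = _
    rw [fockUnitary_e, ← inner_conj_symm]
    rfl
  ext w
  change _ = star d⁻¹ * kernelVec (ballAut X lam) w
  rw [h0]
  induction w with
  | nil =>
    rw [kernelVec_nil (sum_norm_ballAut_lt X hlam), mul_one]
    congr 1
    refine eq_inv_of_mul_eq_one_right ?_
    change d * ⟪kernelVec lam, vac X⟫_ℂ = 1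
    rw [← inner_kernelVec_denom X hlam, denom_vac, inner_kernelVec_vacuum hlam]
  | cons i w ih =>
    rw [kernelVec_cons (sum_norm_ballAut_lt X hlam)]
    change star ⟪kernelVec lam, gen X i (basisImage X w)⟫_ℂ = _
    rw [inner_kernelVec_gen X hlam, star_mul', ih]
    ring

variable {X T}

/-- Slices the rule for `Θ_{T'}` at `e_∅ ⊗ k` against `v_λ`. The operator `U_X` moves to the slicing
vector, which becomes a multiple of the kernel vector at `φ_X(λ)`. -/
theorem Transforms.symbol_eq (hlam : ∑ i, ‖lam i‖ ^ 2 < 1) {T' : MultiContraction n H}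
    {Z : T'.defect ≃ₗᵢ[ℂ] T.defect} {Zs : T'.defectStar ≃ₗᵢ[ℂ] T.defectStar}
    (h : Transforms X T T' Z Zs) :
    symbol T' lam = (Zs.symm : T.defectStar →L[ℂ] T'.defectStar) ∘L
      symbol T (ballAut X lam) ∘L (Z : T'.defect →L[ℂ] T.defect) := by
  ext1 k
  have hmu := sum_norm_ballAut_lt X hlam
  rw [← leftSlice_kernelVec_charFun_vacuum T' hlam, h.1]
  simp only [comp_apply]
  rw [leftSlice_tensorOp, adjoint_UOp, UAdj_kernelVec X hlam, leftSlice_smul, star_star,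
    leftSlice_kernelVec_charFun T hmu, tensorOp_tmul, leftSlice_tmul]
  -- The scalar factors combine to `⟪U_X^* v_λ, U_X^* e_∅⟫ = ⟪v_λ, e_∅⟫ = 1`.
  have h1 : (X.x - ∑ j, lam j * X.z j)⁻¹ * ⟪kernelVec (ballAut X lam), UAdj X (e [])⟫_ℂ = 1 := by
    have h2 := inner_smul_left (𝕜 := ℂ) (kernelVec (ballAut X lam)) (UAdj X (e []))
      (star (X.x - ∑ j, lam j * X.z j)⁻¹)
    rw [← UAdj_kernelVec X hlam, starRingEnd_apply, star_star] at h2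
    rw [← h2]
    exact ((fockUnitary X).symm.inner_map_map _ _).trans (inner_kernelVec_vacuum hlam)
  simp only [map_smul]
  rw [smul_smul, h1, one_smul]

end Symbol

end

end NCFock

/-! ### The theorem. -/

theorem theorem6p2 {n : ℕ} {H : Type*} [NormedAddCommGroup H] [InnerProductSpace ℂ H]
    [CompleteSpace H] (X : PseudoUnitary n) (T : MultiContraction n H) :
    ∃ T' : MultiContraction n H,
      -- `T' = Φ_X⁻¹(T)`
      (∀ i, T'.op i = T.calc ((aut X).symm (leftGen i))) ∧
      (∃ (Z : T'.defect ≃ₗᵢ[ℂ] T.defect) (Zs : T'.defectStar ≃ₗᵢ[ℂ] T.defectStar),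
        Transforms X T T' Z Zs) ∧
      -- the transformation rule for constrained objects
      (∀ (Z : T'.defect ≃ₗᵢ[ℂ] T.defect) (Zs : T'.defectStar ≃ₗᵢ[ℂ] T.defectStar),
        Transforms X T T' Z Zs →
        ∀ j : TwoSidedIdeal (discAlgebra n), IsClosed (j : Set (discAlgebra n)) →
          IsConstrained T j →
          IsClosed (imageIdeal X j : Set (discAlgebra n)) ∧
          IsConstrained T' (imageIdeal X j) ∧
          conjAut X '' wotIdeal j = wotIdeal (imageIdeal X j) ∧
          constrainedCharFun (conjAut X '' wotIdeal j) T' =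
            tensorRestrict (UOp X) (Zs.symm : T.defectStar →L[ℂ] T'.defectStar)
                (coSpace (wotIdeal j)) (coSpace (conjAut X '' wotIdeal j))
                (fun _ hξ => fockUnitary_mem X (wotIdeal j) hξ) ∘L
              constrainedCharFun (wotIdeal j) T ∘L
              tensorRestrict (UAdj X) (Z : T'.defect →L[ℂ] T.defect)
                (coSpace (conjAut X '' wotIdeal j)) (coSpace (wotIdeal j))
                (fun _ hξ => fockUnitary_symm_mem X (wotIdeal j) hξ) ∧
          constrainedPoisson (conjAut X '' wotIdeal j) T' =
            tensorRestrict (UOp X) (Zs.symm : T.defectStar →L[ℂ] T'.defectStar)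
                (coSpace (wotIdeal j)) (coSpace (conjAut X '' wotIdeal j))
                (fun _ hξ => fockUnitary_mem X (wotIdeal j) hξ) ∘L
              constrainedPoisson (wotIdeal j) T) ∧
      -- the commutator ideal
      (IsConstrained T (commutatorIdeal n) ↔ IsCommuting T) ∧
      imageIdeal X (commutatorIdeal n) = commutatorIdeal n ∧
      conjAut X '' wotIdeal (commutatorIdeal n) = wotIdeal (commutatorIdeal n) ∧
      ∃ (h₁ : ∀ ξ ∈ coSpace (wotIdeal (commutatorIdeal n)),
          UOp X ξ ∈ coSpace (wotIdeal (commutatorIdeal n)))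
        (h₂ : ∀ ξ ∈ coSpace (wotIdeal (commutatorIdeal n)),
          UAdj X ξ ∈ coSpace (wotIdeal (commutatorIdeal n))),
        IsCommuting T →
          IsCommuting T' ∧
          ∀ (Z : T'.defect ≃ₗᵢ[ℂ] T.defect) (Zs : T'.defectStar ≃ₗᵢ[ℂ] T.defectStar),
            Transforms X T T' Z Zs →
            constrainedCharFun (wotIdeal (commutatorIdeal n)) T' =
              tensorRestrict (UOp X) (Zs.symm : T.defectStar →L[ℂ] T'.defectStar) _ _ h₁ ∘L
                constrainedCharFun (wotIdeal (commutatorIdeal n)) T ∘L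
                tensorRestrict (UAdj X) (Z : T'.defect →L[ℂ] T.defect) _ _ h₂ ∧
            constrainedPoisson (wotIdeal (commutatorIdeal n)) T' =
              tensorRestrict (UOp X) (Zs.symm : T.defectStar →L[ℂ] T'.defectStar) _ _ h₁ ∘L
                constrainedPoisson (wotIdeal (commutatorIdeal n)) T ∧
            ∀ lam : Fin n → ℂ, ∑ i, ‖lam i‖ ^ 2 < 1 →
              symbol T' lam = (Zs.symm : T.defectStar →L[ℂ] T'.defectStar) ∘L
                symbol T (ballAut X lam) ∘L (Z : T'.defect →L[ℂ] T.defect) := by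
  -- As `Φ_X(ℭ) = ℭ`, the transport of co-spaces becomes invariance of `𝒩_ℭ` under `U_X` and
  -- `U_X^*`.
  have hc : conjAut X '' wotIdeal (commutatorIdeal n) = wotIdeal (commutatorIdeal n) := by
    rw [conjAut_image_wotIdeal, imageIdeal_commutatorIdeal]
  have h₁ : ∀ ξ ∈ coSpace (wotIdeal (commutatorIdeal n)),
      UOp X ξ ∈ coSpace (wotIdeal (commutatorIdeal n)) := fun ξ hξ => by
    have := fockUnitary_mem X _ hξ
    rwa [hc] at this
  have h₂ : ∀ ξ ∈ coSpace (wotIdeal (commutatorIdeal n)),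
      UAdj X ξ ∈ coSpace (wotIdeal (commutatorIdeal n)) := fun ξ hξ =>
    fockUnitary_symm_mem X _ (by rwa [hc])
  refine ⟨moebius X T, fun i => rfl, ⟨_, _, transforms_moebius X T⟩, ?_,
    isConstrained_commutatorIdeal_iff T, imageIdeal_commutatorIdeal X, hc, h₁, h₂, ?_⟩
  · intro Z Zs h j hj hT
    exact ⟨isClosed_imageIdeal X hj, isConstrained_moebius X T hT, conjAut_image_wotIdeal X j,
      h.constrainedCharFun_eq _ _, h.constrainedPoisson_eq _
        (fun _ hξ => fockUnitary_symm_mem X (wotIdeal j) hξ)⟩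
  · intro hT
    exact ⟨hT.moebius X, fun Z Zs h => ⟨h.constrainedCharFun_eq h₁ h₂,
      h.constrainedPoisson_eq h₁ h₂, fun lam hlam => h.symbol_eq hlam⟩⟩
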